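/- Let $M$ be a smooth connected manifold of dimension $m+1$, $m\ge 1$, with a smooth complete Riemannian metric $g$ and norm $\|v\|=g(v,v)^{1/2}$. For a function $L$ on $TM$ let $\partial_vL(x,v)[w]=\frac{d}{ds}L(x,v+sw)|_{s=0}$ and, in local coordinates $(x^i)$ of $M$ and the induced coordinates $(x^i,v^i)$ of $TM$, $\partial_xL(x,v)[w]=\sum_i\frac{\partial L}{\partial x^i}(x,v)\,w^i$. Let $L\colon TM\to\mathbb R$ be of class $C^1$ and assume the following. (1) There are a $C^1$ vector field $K$, a $C^1$ one-form $Q$ and a $C^1$ function $d\colon M\to\mathbb R$ such that $L$ is invariant under the local flow $\psi_t$ of $K$, that is, $L(\psi_t(x),d\psi_t(x)[v])=L(x,v)$; $\partial_vL(x,v)[K_x]=Q_x(v)+d(x)$ for all $(x,v)\in TM$; $d$ is invariant under the flow of $K$; and $Q_x(K_x)<0$ for all $x\in M$. (2) The function $L_c(x,v):=L(x,v)-Q_x(v)^2/Q_x(K_x)$ satisfies, for some continuous $C,\lambda\colon M\to(0,+\infty)$ and for all $x\in M$ and $v,v_1,v_2\in T_xM$, $$L_c(x,v)\le C(x)(\|v\|^2+1),\quad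 \|\partial_xL_c(x,v)\|\le C(x)(\|v\|^2+1),\quad \|\partial_vL_c(x,v)\|\le C(x)(\|v\|+1),$$ $$\big(\partial_vL_c(x,v_2)-\partial_vL_c(x,v_1)\big)[v_2-v_1]\ge\lambda(x)\|v_2-v_1\|^2,$$ where the norms of the linear forms are taken with respect to $g_x$, and $\partial_xL_c$ is computed in the charts of some smooth atlas of $M$. For $p,q\in M$ let $\Omega^{1,2}_{p,q}$ be the Hilbert manifold of the absolutely continuous curves $z\colon[0,1]\to M$ with $\int_0^1 g(\dot z,\dot z)\,ds<\infty$, $z(0)=p$, $z(1)=q$, and let $\mathcal A(z)=\int_0^1L(z,\dot z)\,ds$. Then for every critical point $z$ of $\mathcal A$ on $\Omega^{1,2}_{p,q}$: (a) $z$ and $\partial_vL(z,\dot z)$ are of class $C^1$ on $[0,1]$; (b) the Euler–Lagrange equations hold in the classical sense: in every smooth coordinate system of $M$, for all $i\in\{0,\dots,m\}$ and all $s\in[0,1]$ with $z(s)$ in its domain, $$\frac{\partial L}{\partial x^i}(z(s),\dot z(s))=\frac{d}{ds}\Big(\frac{\partial L}{\partial v^i}(z(s),\dot z(s))\Big);$$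 (c) there is a constant $E\in\mathbb R$ such that $\partial_vL(z,\dot z)[\dot z]-L(z,\dot z)=E$ on $[0,1]$. -/

import Mathlib

open Set Filter Topology MeasureTheory Manifold Bundle
open scoped ContDiff

noncomputable section

namespace SymLagrangian

section Differential

variable {m : ℕ} {M : Type*} [TopologicalSpace M]
  [ChartedSpace (EuclideanSpace ℝ (Fin (m + 1))) M]

/-- The smooth charts of `M`: all charts that are `C^∞`-compatible with the given atlas. -/
abbrev smoothCharts (m : ℕ) (M : Type*) [TopologicalSpace M]
    [ChartedSpace (EuclideanSpace ℝ (Fin (m + 1))) M] :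
    Set (OpenPartialHomeomorph M (EuclideanSpace ℝ (Fin (m + 1)))) :=
  IsManifold.maximalAtlas (𝓡 (m + 1)) ∞ M

/-- The vertical derivative `∂_v L(x, v) : T_x M → ℝ`, that is the differential at `v` of the
restriction of `L` to the fibre `T_x M`. -/
def vertDeriv (L : TangentBundle (𝓡 (m + 1)) M → ℝ) (x : M) (v : TangentSpace (𝓡 (m + 1)) x) :
    TangentSpace (𝓡 (m + 1)) x →L[ℝ] ℝ :=
  fderiv ℝ (fun w : TangentSpace (𝓡 (m + 1)) x => L ⟨x, w⟩) v

/-- The components `(v^0, …, v^m)` of `v ∈ T_x M` in the coordinates `e`. -/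
def coordVec (e : OpenPartialHomeomorph M (EuclideanSpace ℝ (Fin (m + 1)))) (x : M)
    (v : TangentSpace (𝓡 (m + 1)) x) : EuclideanSpace ℝ (Fin (m + 1)) :=
  mfderiv (𝓡 (m + 1)) (𝓡 (m + 1)) e x v

/-- The Lagrangian `L` written in the coordinates `(x^0, …, x^m, v^0, …, v^m)` of `TM` that are
induced by the coordinates `e` on `M`. -/
def coordLagrangian (e : OpenPartialHomeomorph M (EuclideanSpace ℝ (Fin (m + 1))))
    (L : TangentBundle (𝓡 (m + 1)) M → ℝ) (y u : EuclideanSpace ℝ (Fin (m + 1))) : ℝ :=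
  L ⟨e.symm y, mfderiv (𝓡 (m + 1)) (𝓡 (m + 1)) e.symm y u⟩

/-- The horizontal derivative `∂_x L(x, v)[w] = ∑ i, ∂L/∂x^i (x, v) w^i`
in the coordinates `e`. -/
def horizDeriv (e : OpenPartialHomeomorph M (EuclideanSpace ℝ (Fin (m + 1))))
    (L : TangentBundle (𝓡 (m + 1)) M → ℝ) (x : M) (v w : TangentSpace (𝓡 (m + 1)) x) : ℝ :=
  fderiv ℝ (fun y => coordLagrangian e L y (coordVec e x v)) (e x) (coordVec e x w)

/-- The function `∂L/∂x^i` on `TM` in the coordinates `e`. -/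
def partialX (e : OpenPartialHomeomorph M (EuclideanSpace ℝ (Fin (m + 1))))
    (L : TangentBundle (𝓡 (m + 1)) M → ℝ) (i : Fin (m + 1))
    (x : M) (v : TangentSpace (𝓡 (m + 1)) x) : ℝ :=
  fderiv ℝ (fun y => coordLagrangian e L y (coordVec e x v)) (e x) (EuclideanSpace.single i 1)

/-- The function `∂L/∂v^i` on `TM` in the coordinates `e`. -/
def partialV (e : OpenPartialHomeomorph M (EuclideanSpace ℝ (Fin (m + 1))))
    (L : TangentBundle (𝓡 (m + 1)) M → ℝ) (i : Fin (m + 1))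
    (x : M) (v : TangentSpace (𝓡 (m + 1)) x) : ℝ :=
  fderiv ℝ (fun u => coordLagrangian e L (e x) u) (coordVec e x v) (EuclideanSpace.single i 1)

/-- `ψ` is a local flow of the vector field `K`, defined for initial points in the open set `U`
and for times in `(-δ, δ)`, and consisting of `C^1` maps. -/
structure IsLocalFlow (K : ∀ x : M, TangentSpace (𝓡 (m + 1)) x) (U : Set M) (δ : ℝ)
    (ψ : ℝ → M → M) : Prop where
  isOpen : IsOpen U
  zero : ∀ x ∈ U, ψ 0 x = x
  integralCurve : ∀ x ∈ U,
    IsMIntegralCurveOn (I := 𝓡 (m + 1)) (fun t => ψ t x) K (Ioo (-δ) δ)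
  contMDiffOn : ∀ t ∈ Ioo (-δ) δ, ContMDiffOn (𝓡 (m + 1)) (𝓡 (m + 1)) 1 (ψ t) U

/-- `L` is a `C^1` Lagrangian with the `C^1` infinitesimal symmetry `K`; its Noether charge
`∂_v L(x, v)[K]` is `Q(v) + d(x)`, where `Q` is a `C^1` one-form and `d` is a `C^1` function that
is invariant by the flow of `K`; and `Q(K) < 0`.
A one-form is `C^1` exactly when it is `C^1` as a function on `TM`. -/
structure SymmetryAssumption [IsManifold (𝓡 (m + 1)) ∞ M]
    (L : TangentBundle (𝓡 (m + 1)) M → ℝ)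
    (K : ∀ x : M, TangentSpace (𝓡 (m + 1)) x)
    (Q : ∀ x : M, TangentSpace (𝓡 (m + 1)) x →L[ℝ] ℝ) (d : M → ℝ) : Prop where
  contMDiff_L : ContMDiff (𝓡 (m + 1)).tangent 𝓘(ℝ, ℝ) 1 L
  contMDiff_K : ContMDiff (𝓡 (m + 1)) (𝓡 (m + 1)).tangent 1
    (fun x => (⟨x, K x⟩ : TangentBundle (𝓡 (m + 1)) M))
  contMDiff_Q : ContMDiff (𝓡 (m + 1)).tangent 𝓘(ℝ, ℝ) 1
    (fun ξ : TangentBundle (𝓡 (m + 1)) M => Q ξ.proj ξ.snd)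
  contMDiff_d : ContMDiff (𝓡 (m + 1)) 𝓘(ℝ, ℝ) 1 d
  invariant_L : ∀ (U : Set M) (δ : ℝ) (ψ : ℝ → M → M), IsLocalFlow K U δ ψ →
    ∀ t ∈ Ioo (-δ) δ, ∀ x ∈ U, ∀ v : TangentSpace (𝓡 (m + 1)) x,
      L ⟨ψ t x, mfderiv (𝓡 (m + 1)) (𝓡 (m + 1)) (ψ t) x v⟩ = L ⟨x, v⟩
  noether : ∀ (x : M) (v : TangentSpace (𝓡 (m + 1)) x), vertDeriv L x v (K x) = Q x v + d x
  invariant_d : ∀ (U : Set M) (δ : ℝ) (ψ : ℝ → M → M), IsLocalFlow K U δ ψ →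
    ∀ t ∈ Ioo (-δ) δ, ∀ x ∈ U, d (ψ t x) = d x
  neg : ∀ x : M, Q x (K x) < 0

/-- The Lagrangian `L_c(x, v) = L(x, v) - Q(v)² / Q(K)`. -/
def convexLagrangian (L : TangentBundle (𝓡 (m + 1)) M → ℝ)
    (K : ∀ x : M, TangentSpace (𝓡 (m + 1)) x)
    (Q : ∀ x : M, TangentSpace (𝓡 (m + 1)) x →L[ℝ] ℝ) (ξ : TangentBundle (𝓡 (m + 1)) M) : ℝ :=
  L ξ - (Q ξ.proj ξ.snd) ^ 2 / Q ξ.proj (K ξ.proj)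

/-- The velocity `ż(s) ∈ T_{z(s)} M` of a curve `z : [0, 1] → M` (one-sided at `0` and `1`).
Curves are functions on `ℝ` of which only the restriction to `[0, 1]` matters. -/
def velocity (m : ℕ) {M : Type*} [TopologicalSpace M]
    [ChartedSpace (EuclideanSpace ℝ (Fin (m + 1))) M] (z : ℝ → M) (s : ℝ) :
    TangentSpace (𝓡 (m + 1)) (z s) :=
  mfderivWithin 𝓘(ℝ, ℝ) (𝓡 (m + 1)) z (Icc 0 1) s (1 : ℝ)

/-- The action functional `𝒜(z) = ∫₀¹ L(z, ż) ds`. -/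
def action (L : TangentBundle (𝓡 (m + 1)) M → ℝ) (z : ℝ → M) : ℝ :=
  ∫ s in (0 : ℝ)..1, L ⟨z s, velocity m z s⟩

/-- `ε ↦ u ε` is differentiable at `ε = 0` as a curve in the Hilbert space
`W^{1,2}([a, b], ℝ^{m+1})`: for some `w` in this space, the difference quotient
`(u ε - u 0) / ε` tends to `w` in the `W^{1,2}` norm. -/
def SobolevDifferentiableAtZero (u : ℝ → ℝ → EuclideanSpace ℝ (Fin (m + 1))) (a b : ℝ) : Prop :=
  ∃ w : ℝ → EuclideanSpace ℝ (Fin (m + 1)),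
    AbsolutelyContinuousOnInterval w a b ∧
    MemLp (deriv w) 2 (volume.restrict (Icc a b)) ∧
    Tendsto (fun ε : ℝ =>
        eLpNorm (fun s => ε⁻¹ • (u ε s - u 0 s) - w s) 2 (volume.restrict (Icc a b)) +
        eLpNorm (fun s => ε⁻¹ • (deriv (u ε) s - deriv (u 0) s) - deriv w s) 2
          (volume.restrict (Icc a b)))
      (𝓝[≠] 0) (𝓝 0)

end Differential

section Riemannian

variable {m : ℕ} {M : Type*} [MetricSpace M]
  [ChartedSpace (EuclideanSpace ℝ (Fin (m + 1))) M] [IsManifold (𝓡 (m + 1)) ∞ M]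
  [RiemannianBundle (fun x : M => TangentSpace (𝓡 (m + 1)) x)]

/-- The growth conditions on a Lagrangian `Lc` and its pointwise strong convexity. The horizontal
derivative is taken in the charts of some atlas of `M`; its norm and that of the vertical
derivative are the norms of linear forms on the Euclidean space `(T_x M, g_x)`. -/
structure GrowthAssumption (Lc : TangentBundle (𝓡 (m + 1)) M → ℝ) : Prop where
  growth : ∃ C : M → ℝ, Continuous C ∧ (∀ x, 0 < C x) ∧
    (∀ (x : M) (v : TangentSpace (𝓡 (m + 1)) x), Lc ⟨x, v⟩ ≤ C x * (‖v‖ ^ 2 + 1)) ∧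
    (∃ 𝒰 ⊆ smoothCharts m M, (∀ x : M, ∃ e ∈ 𝒰, x ∈ e.source) ∧
      ∀ e ∈ 𝒰, ∀ x ∈ e.source, ∀ v w : TangentSpace (𝓡 (m + 1)) x,
        |horizDeriv e Lc x v w| ≤ C x * (‖v‖ ^ 2 + 1) * ‖w‖) ∧
    (∀ (x : M) (v : TangentSpace (𝓡 (m + 1)) x), ‖vertDeriv Lc x v‖ ≤ C x * (‖v‖ + 1))
  convex : ∃ lam : M → ℝ, Continuous lam ∧ (∀ x, 0 < lam x) ∧
    ∀ (x : M) (v₁ v₂ : TangentSpace (𝓡 (m + 1)) x),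
      lam x * ‖v₂ - v₁‖ ^ 2 ≤ (vertDeriv Lc x v₂ - vertDeriv Lc x v₁) (v₂ - v₁)

/-- `z ∈ Ω_{p,q}^{1,2}`: an absolutely continuous curve `z : [0, 1] → M` from `p` to `q` with
`∫₀¹ g(ż, ż) ds < ∞`. -/
structure IsPath (m : ℕ) {M : Type*} [MetricSpace M]
    [ChartedSpace (EuclideanSpace ℝ (Fin (m + 1))) M] [IsManifold (𝓡 (m + 1)) ∞ M]
    [RiemannianBundle (fun x : M => TangentSpace (𝓡 (m + 1)) x)]
    (p q : M) (z : ℝ → M) : Prop where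
  absolutelyContinuous : AbsolutelyContinuousOnInterval z 0 1
  finiteEnergy : ∫⁻ s in Icc (0 : ℝ) 1, ‖velocity m z s‖ₑ ^ 2 < ⊤
  left : z 0 = p
  right : z 1 = q

/-- `γ : ℝ → Ω_{p,q}^{1,2}` is a curve in the path space with `γ 0 = z` that is differentiable at
`0` for the Hilbert manifold structure of `Ω_{p,q}^{1,2}`: locally in `s ∈ [0, 1]`, in a chart
of `M`, it is differentiable at `0` in the `W^{1,2}` norm. -/
structure IsVariation (p q : M) (z : ℝ → M) (γ : ℝ → ℝ → M) : Prop where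
  isPath : ∀ ε, IsPath m p q (γ ε)
  zero : γ 0 = z
  differentiable : ∀ s ∈ Icc (0 : ℝ) 1, ∃ a b : ℝ, a < b ∧ Icc a b ⊆ Icc 0 1 ∧
    Icc a b ∈ 𝓝[Icc 0 1] s ∧ ∃ e ∈ smoothCharts m M,
      (∀ᶠ ε in 𝓝 (0 : ℝ), MapsTo (γ ε) (Icc a b) e.source) ∧
      SobolevDifferentiableAtZero (fun ε r => e (γ ε r)) a b

/-- `z` is a critical point of the action functional on `Ω_{p,q}^{1,2}`: its differential at `z`
vanishes, that is, the derivative of `𝒜` at `z` along every curve in `Ω_{p,q}^{1,2}` through `z`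
that is differentiable there is zero. -/
def IsCriticalPoint (L : TangentBundle (𝓡 (m + 1)) M → ℝ) (p q : M) (z : ℝ → M) : Prop :=
  IsPath m p q z ∧
    ∀ γ : ℝ → ℝ → M, IsVariation (m := m) p q z γ → HasDerivAt (fun ε => action L (γ ε)) 0 0

end Riemannian

end SymLagrangian

end

/-! In the velocity, `L` is the strongly convex `L_c` plus Q(v)²/Q(K), a nonpositive term of rank
one since Q(K) < 0. So `L` need not be convex, but the Noether charge controls the defect: the
momentum ∂_vL(x, v), evaluated on K, is Q(v) + d(x). Velocities with the same momentum therefore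
have the same Q, the correction vanishes on their difference, and strong convexity makes them equal
(`momentum_injective`). The same remark made quantitative bounds a velocity by its momentum
(`norm_le_of_momentum`). Hence the momentum map is injective and proper in v, and its inverse is
continuous along curves (`exists_continuousOn_velocity`).

Regularity is then local, in a chart. A path of finite energy has square integrable coordinate
velocity, and `L` and its differential grow at most quadratically (`exists_growth_coordLagrangian`),
so the action may be differentiated under the integral along variations z + εw with w smooth and
compactly supported in an open arc. Criticality gives the weak Euler–Lagrange equation, and the du
Bois-Reymond lemma turns it into: the momentum is almost everywhere equal to a constant plus the
primitive of ∂_xL. The momentum thus has a continuous representative, hence so has the velocity, and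
z is of class C^1. Now ∂_xL along z is continuous and the integrated equation can be differentiated
everywhere.

Energy needs a separate argument, because `L` is only C^1 and the velocity need not be
differentiable. For convex `L`, the tangent inequalities at times s₀ and s enclose the energy
increment between two quantities which are o(s - s₀) by the Euler–Lagrange equation. Here these
inequalities carry an error Q(ż(s) - ż(s₀))²/Q(K) (`le_excess`). But Q(ż) is the momentum on K minus
d, a differentiable function of s, so the error is O((s - s₀)²), and the energy has zero derivative
(`hasDerivWithinAt_energy`). -/

namespace SymLagrangian

/-! ### Absolutely continuous functions and the fundamental theorem of calculus. -/

section AbsolutelyContinuous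

/-- The identity is absolutely continuous, so the term `dist s t` costs nothing; it makes room for
perturbations of a path by Lipschitz functions of the parameter. -/
theorem absolutelyContinuousOnInterval_of_dist_le {X Y : Type*} [PseudoMetricSpace X]
    [PseudoMetricSpace Y] {f : ℝ → Y} {g : ℝ → X} {a b C : ℝ}
    (hg : AbsolutelyContinuousOnInterval g a b)
    (h : ∀ s ∈ uIcc a b, ∀ t ∈ uIcc a b, dist (f s) (f t) ≤ C * (dist (g s) (g t) + dist s t)) :
    AbsolutelyContinuousOnInterval f a b := by
  have hid : Tendsto (fun E : ℕ × (ℕ → ℝ × ℝ) ↦ ∑ i ∈ Finset.range E.1, dist (E.2 i).1 (E.2 i).2)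
      (AbsolutelyContinuousOnInterval.totalLengthFilter ⊓
        𝓟 (AbsolutelyContinuousOnInterval.disjWithin a b)) (𝓝 0) :=
    tendsto_comap.mono_left inf_le_left
  have hsum := (Tendsto.add hg hid).const_mul C
  rw [add_zero, mul_zero] at hsum
  refine squeeze_zero' (Eventually.of_forall fun E => Finset.sum_nonneg fun i _ => dist_nonneg)
    ?_ hsum
  refine mem_inf_of_right fun E hE => ?_
  simp only [mem_ofPred_eq]
  rw [← Finset.sum_add_distrib, Finset.mul_sum]
  exact Finset.sum_le_sum fun i hi => h _ (hE.1 i hi).1 _ (hE.1 i hi).2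

variable {G : Type*} [NormedAddCommGroup G] [NormedSpace ℝ G]

theorem absolutelyContinuousOnInterval_integral {f : ℝ → G} {a b : ℝ}
    (h : IntervalIntegrable f volume a b) :
    AbsolutelyContinuousOnInterval (fun x => ∫ t in a..x, f t) a b := by
  have hsub : ∀ x ∈ uIcc a b, IntervalIntegrable f volume a x := fun x hx =>
    h.mono_set (uIcc_subset_uIcc_left hx)
  refine absolutelyContinuousOnInterval_of_dist_le (C := 1)
    (h.norm.absolutelyContinuousOnInterval_intervalIntegral left_mem_uIcc) fun s hs t ht => ?_
  rw [dist_eq_norm, dist_eq_norm, intervalIntegral.integral_interval_sub_left (hsub s hs) (hsub t ht),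
    intervalIntegral.integral_interval_sub_left (hsub s hs).norm (hsub t ht).norm, one_mul]
  refine (intervalIntegral.norm_integral_le_abs_integral_norm).trans ?_
  rw [Real.norm_eq_abs]
  exact le_add_of_nonneg_right dist_nonneg

/-- An absolutely continuous function whose derivative vanishes almost everywhere is constant; this
applies to `f` minus the primitive of `g`. Since `g` is prescribed, a continuous representative of
the derivative can be inserted. -/
theorem sub_eq_integral_of_ae_hasDerivAt [CompleteSpace G] {f g : ℝ → G} {a b : ℝ}
    (hf : AbsolutelyContinuousOnInterval f a b) (hg : IntervalIntegrable g volume a b)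
    (h : ∀ᵐ x, x ∈ uIcc a b → HasDerivAt f (g x) x) :
    ∀ x ∈ uIcc a b, f x - f a = ∫ t in a..x, g t := by
  obtain ⟨C, hC⟩ := (hf.sub (absolutelyContinuousOnInterval_integral hg)).const_of_ae_hasDerivAt_zero
    (by
      filter_upwards [h, hg.ae_hasDerivAt_integral] with x hx hx' hxab
      simpa using (hx hxab).sub (hx' hxab a left_mem_uIcc))
  intro x hx
  have h1 := hC x hx
  have h2 := hC a left_mem_uIcc
  simp only [Pi.sub_apply, intervalIntegral.integral_same, sub_zero] at h1 h2
  rw [h2, ← h1]; abel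

theorem absolutelyContinuousOnInterval.ae_differentiableAt [FiniteDimensional ℝ G] {f : ℝ → G}
    {a b : ℝ} (hf : AbsolutelyContinuousOnInterval f a b) :
    ∀ᵐ x, x ∈ uIcc a b → DifferentiableAt ℝ f x :=
  hf.boundedVariationOn.ae_differentiableAt_of_mem_uIcc

end AbsolutelyContinuous

/-! ### The du Bois-Reymond lemma. -/

section DuBoisReymond

variable {G : Type*} [NormedAddCommGroup G] [NormedSpace ℝ G] [CompleteSpace G]

theorem intervalIntegral_eq_integral_of_forall_notMem_eq_zero {H : Type*} [NormedAddCommGroup H]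
    [NormedSpace ℝ H] {a b : ℝ} (hab : a < b) {f : ℝ → H} (hf : ∀ s ∉ Ioo a b, f s = 0) :
    ∫ s in a..b, f s = ∫ s, f s := by
  rw [intervalIntegral.integral_of_le hab.le]
  exact setIntegral_eq_integral_of_forall_compl_eq_zero fun x hx => hf x fun h' =>
    hx (Ioo_subset_Ioc_self h')

/-- Integration by parts of a test function against an integrable function. -/
theorem integral_smul_eq_neg_integral_deriv_smul {a b : ℝ} {P : ℝ → G}
    (hP : IntervalIntegrable P volume a b) {φ : ℝ → ℝ} (hφ : ContDiff ℝ ∞ φ)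
    (hsupp : tsupport φ ⊆ Ioo a b) :
    ∫ s in a..b, φ s • P s = - ∫ s in a..b, deriv φ s • ∫ t in a..s, P t := by
  have hAC := absolutelyContinuousOnInterval_integral hP
  have hφAC : AbsolutelyContinuousOnInterval φ a b :=
    (hφ.of_le (by exact_mod_cast le_top)).contDiffOn.absolutelyContinuousOnInterval
  have hφ' : Continuous (deriv φ) := hφ.continuous_deriv (by exact_mod_cast le_top)
  have h1 : IntervalIntegrable (fun s => φ s • P s) volume a b :=
    hP.continuousOn_smul hφ.continuous.continuousOn
  have h2 : IntervalIntegrable (fun s => deriv φ s • ∫ t in a..s, P t) volume a b :=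
    (hφ'.continuousOn.smul hAC.continuousOn).intervalIntegrable
  have key := sub_eq_integral_of_ae_hasDerivAt (hφAC.smul hAC) (h1.add h2) (by
    filter_upwards [hP.ae_hasDerivAt_integral] with x hx hxab
    exact ((hφ.differentiable (by simp) x).hasDerivAt.smul (hx hxab a left_mem_uIcc))) b
      right_mem_uIcc
  -- At `a` the primitive itself vanishes, so only the boundary term at `b` uses the support of `φ`.
  have hb : φ b = 0 := image_eq_zero_of_notMem_tsupport fun hb => lt_irrefl _ (hsupp hb).2
  simp only [Pi.smul_apply', hb, zero_smul, intervalIntegral.integral_same, smul_zero, sub_zero]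
    at key
  rw [intervalIntegral.integral_add h1 h2] at key
  exact eq_neg_of_add_eq_zero_left key.symm

/-- The **du Bois-Reymond lemma**. -/
theorem ae_eq_const_of_integral_deriv_smul_eq_zero {a b : ℝ} (hab : a < b) {R : ℝ → G}
    (hR : IntervalIntegrable R volume a b)
    (h : ∀ φ : ℝ → ℝ, ContDiff ℝ ∞ φ → HasCompactSupport φ → tsupport φ ⊆ Ioo a b →
      ∫ s in a..b, deriv φ s • R s = 0) :
    ∃ c, ∀ᵐ s, s ∈ Ioo a b → R s = c := by
  have hmid : (a + b) / 2 ∈ Ioo a b := ⟨by linarith, by linarith⟩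
  obtain ⟨ρ₀, hρs, hρc, hρd, hρr, hρ1⟩ :=
    exists_contDiff_tsupport_subset (n := ⊤) (Ioo_mem_nhds hmid.1 hmid.2)
  have hρpos : 0 < ∫ s, ρ₀ s :=
    integral_pos_of_integrable_nonneg_nonzero (x := (a + b) / 2) hρd.continuous
      (hρd.continuous.integrable_of_hasCompactSupport hρc)
      (fun x => (hρr (mem_range_self x)).1) (by simp [hρ1])
  -- A bump of total integral one: subtracting a multiple of it gives any test function mean zero.
  set I := ∫ s, ρ₀ s with hI
  let ρ : ℝ → ℝ := fun s => I⁻¹ * ρ₀ s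
  have hρdiff : ContDiff ℝ ∞ ρ := contDiff_const.mul hρd
  have hρts : tsupport ρ ⊆ Ioo a b := (tsupport_mul_subset_right).trans hρs
  have hρcomp : HasCompactSupport ρ := hρc.mul_left
  have zero_out : ∀ {φ : ℝ → ℝ}, tsupport φ ⊆ Ioo a b → ∀ s ∉ Ioo a b, φ s = 0 :=
    fun hφ s hs => image_eq_zero_of_notMem_tsupport fun h' => hs (hφ h')
  have hρint : ∫ s in a..b, ρ s = 1 := by
    rw [intervalIntegral_eq_integral_of_forall_notMem_eq_zero hab (zero_out hρts)]
    simp only [ρ, integral_const_mul]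
    exact inv_mul_cancel₀ hρpos.ne'
  -- The constant is forced: it is the mean of `R` with weight `ρ`.
  let c : G := ∫ s in a..b, ρ s • R s
  refine ⟨c, ?_⟩
  have hRint : IntegrableOn R (Ioo a b) := by
    have := (intervalIntegrable_iff_integrableOn_Ioo_of_le hab.le).1 hR
    exact this
  have main := IsOpen.ae_eq_zero_of_integral_contDiff_smul_eq_zero (μ := volume)
    (f := fun s => R s - c) (isOpen_Ioo (a := a) (b := b))
    ((hRint.sub (integrableOn_const (by simp))).locallyIntegrableOn) (by
      intro ψ hψ hψc hψs
      -- Having integral zero, `q` is the derivative of a test function `φ`, and the hypothesis for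
      -- `φ` reads ∫ ψ R = (∫ ψ) c.
      let q : ℝ → ℝ := fun s => ψ s - (∫ t in a..b, ψ t) * ρ s
      have hq : ContDiff ℝ ∞ q := hψ.sub (contDiff_const.mul hρdiff)
      let φ : ℝ → ℝ := fun s => ∫ t in a..s, q t
      have hφd : ∀ s, HasDerivAt φ (q s) s := fun s =>
        intervalIntegral.integral_hasDerivAt_right (hq.continuous.intervalIntegrable _ _)
          (hq.continuous.stronglyMeasurableAtFilter _ _) hq.continuous.continuousAt
      have hφ' : deriv φ = q := funext fun s => (hφd s).deriv
      have hφ : ContDiff ℝ ∞ φ := by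
        rw [contDiff_infty_iff_deriv, hφ']
        exact ⟨fun s => (hφd s).differentiableAt, hq⟩
      -- the support of `φ`
      have hK : IsCompact (tsupport ψ ∪ tsupport ρ) := hψc.isCompact.union hρcomp.isCompact
      have hKs : tsupport ψ ∪ tsupport ρ ⊆ Ioo a b := union_subset hψs hρts
      obtain ⟨a', b', hab', hKab⟩ : ∃ a' b', (a < a' ∧ b' < b) ∧
          tsupport ψ ∪ tsupport ρ ⊆ Icc a' b' := by
        have hne : (tsupport ψ ∪ tsupport ρ).Nonempty := by
          refine ⟨(a + b) / 2, Or.inr (subset_tsupport _ ?_)⟩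
          simp [ρ, hρ1, hρpos.ne']
        obtain ⟨a', ha', ha''⟩ := hK.exists_isLeast hne
        obtain ⟨b', hb', hb''⟩ := hK.exists_isGreatest hne
        exact ⟨a', b', ⟨(hKs ha').1, (hKs hb').2⟩, fun x hx => ⟨ha'' hx, hb'' hx⟩⟩
      have hq0 : ∀ s ∉ Icc a' b', q s = 0 := by
        intro s hs
        have h1 : ψ s = 0 := image_eq_zero_of_notMem_tsupport fun h' => hs (hKab (Or.inl h'))
        have h2 : ρ s = 0 := image_eq_zero_of_notMem_tsupport fun h' => hs (hKab (Or.inr h'))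
        simp [q, h1, h2]
      have hqtot : ∫ t in a..b, q t = 0 := by
        have hρi : IntervalIntegrable (fun s => (∫ t in a..b, ψ t) * ρ s) volume a b :=
          (continuous_const.mul hρdiff.continuous).intervalIntegrable _ _
        simp only [q]
        rw [intervalIntegral.integral_sub (hψ.continuous.intervalIntegrable _ _) hρi,
          intervalIntegral.integral_const_mul, hρint]
        simp
      have hφ0 : ∀ s ∉ Icc a' b', φ s = 0 := by
        intro s hs
        rw [mem_Icc, not_and_or, not_le, not_le] at hs
        rcases hs with hs | hs
        · refine intervalIntegral.integral_zero_ae (ae_of_all _ fun t ht => hq0 t fun ht' => ?_)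
          rcases mem_uIoc.1 ht with h' | h' <;> linarith [h'.1, h'.2, ht'.1, ht'.2, hab'.1]
        · have : φ s = (∫ t in a..b, q t) - ∫ t in s..b, q t := by
            rw [← intervalIntegral.integral_add_adjacent_intervals
              (hq.continuous.intervalIntegrable a s) (hq.continuous.intervalIntegrable s b)]
            simp [φ]
          rw [this, hqtot, zero_sub, neg_eq_zero]
          refine intervalIntegral.integral_zero_ae (ae_of_all _ fun t ht => hq0 t fun ht' => ?_)
          rcases mem_uIoc.1 ht with h' | h' <;> linarith [h'.1, h'.2, ht'.1, ht'.2, hab'.2]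
      have hφts : tsupport φ ⊆ Icc a' b' :=
        closure_minimal (fun s hs => by_contra fun h' => hs (hφ0 s h')) isClosed_Icc
      have hφI : tsupport φ ⊆ Ioo a b := fun s hs =>
        ⟨hab'.1.trans_le (hφts hs).1, (hφts hs).2.trans_lt hab'.2⟩
      have hz := h φ hφ (HasCompactSupport.intro isCompact_Icc fun s hs => hφ0 s hs) hφI
      rw [hφ'] at hz
      rw [← intervalIntegral_eq_integral_of_forall_notMem_eq_zero hab
        fun s hs => by rw [zero_out hψs s hs, zero_smul]]
      have i1 : IntervalIntegrable (fun s => ψ s • R s) volume a b :=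
        hR.continuousOn_smul hψ.continuous.continuousOn
      have i2 : IntervalIntegrable (fun s => ρ s • R s) volume a b :=
        hR.continuousOn_smul hρdiff.continuous.continuousOn
      have i3 : IntervalIntegrable (fun s => (∫ t in a..b, ψ t) • ρ s • R s) volume a b :=
        i2.smul _
      have i4 : IntervalIntegrable (fun s => ψ s • c) volume a b :=
        (hψ.continuous.smul continuous_const).intervalIntegrable _ _
      simp only [q, sub_smul, mul_smul] at hz
      rw [intervalIntegral.integral_sub i1 i3, intervalIntegral.integral_smul] at hz
      simp only [smul_sub]
      rw [intervalIntegral.integral_sub i1 i4, intervalIntegral.integral_smul_const]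
      exact hz)
  filter_upwards [main] with s hs hsab
  exact sub_eq_zero.1 (hs hsab)

/-- The du Bois-Reymond lemma for the weak equation `R' = P`. -/
theorem ae_eq_const_add_integral_of_weak {a b : ℝ} (hab : a < b) {P R : ℝ → G}
    (hP : IntervalIntegrable P volume a b) (hR : IntervalIntegrable R volume a b)
    (h : ∀ φ : ℝ → ℝ, ContDiff ℝ ∞ φ → HasCompactSupport φ → tsupport φ ⊆ Ioo a b →
      ∫ s in a..b, (φ s • P s + deriv φ s • R s) = 0) :
    ∃ c, ∀ᵐ s, s ∈ Ioo a b → R s = c + ∫ t in a..s, P t := by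
  have hA := (absolutelyContinuousOnInterval_integral hP).continuousOn.intervalIntegrable
    (μ := volume)
  -- Integration by parts absorbs the zero-order term into `R` minus the primitive of `P`.
  obtain ⟨c, hc⟩ := ae_eq_const_of_integral_deriv_smul_eq_zero hab (hR.sub hA) (by
    intro φ hφ hφc hφs
    have hφ' : Continuous (deriv φ) := hφ.continuous_deriv (by exact_mod_cast le_top)
    have hz := h φ hφ hφc hφs
    rw [intervalIntegral.integral_add (hP.continuousOn_smul hφ.continuous.continuousOn)
      (hR.continuousOn_smul hφ'.continuousOn),
      integral_smul_eq_neg_integral_deriv_smul hP hφ hφs] at hz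
    simp only [smul_sub]
    rw [intervalIntegral.integral_sub (hR.continuousOn_smul hφ'.continuousOn)
      (hA.continuousOn_smul hφ'.continuousOn)]
    rw [← hz]; abel)
  refine ⟨c, ?_⟩
  filter_upwards [hc] with s hs hsab
  rw [← hs hsab]; simp

end DuBoisReymond

end SymLagrangian

namespace SymLagrangian

/-! ### Functions of class C^1 in position and velocity. -/

section FiniteDimensional

variable {E : Type*} [NormedAddCommGroup E] [NormedSpace ℝ E]

/-- Strict differentiability matters in the energy argument, where increments in the position are
taken at a velocity that moves too. -/
theorem hasStrictFDerivAt_uncurry {F : E → E → ℝ} {U : Set E} (hU : IsOpen U)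
    (hF : ContDiffOn ℝ 1 (Function.uncurry F) (U ×ˢ univ)) {x : E} (hx : x ∈ U) (v : E) :
    HasStrictFDerivAt (Function.uncurry F) (fderiv ℝ (Function.uncurry F) (x, v)) (x, v) :=
  (hF.contDiffAt ((hU.prod isOpen_univ).mem_nhds ⟨hx, mem_univ v⟩)).hasStrictFDerivAt one_ne_zero

theorem hasFDerivAt_left {F : E → E → ℝ} {U : Set E} (hU : IsOpen U)
    (hF : ContDiffOn ℝ 1 (Function.uncurry F) (U ×ˢ univ)) {x : E} (hx : x ∈ U) (v : E) :
    HasFDerivAt (fun y => F y v) ((fderiv ℝ (Function.uncurry F) (x, v)).comp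
      (ContinuousLinearMap.inl ℝ E E)) x :=
  HasFDerivAt.comp (f := fun y => (y, v)) x (hasStrictFDerivAt_uncurry hU hF hx v).hasFDerivAt
    (hasFDerivAt_prodMk_left (𝕜 := ℝ) x v)

theorem hasFDerivAt_right {F : E → E → ℝ} {U : Set E} (hU : IsOpen U)
    (hF : ContDiffOn ℝ 1 (Function.uncurry F) (U ×ˢ univ)) {x : E} (hx : x ∈ U) (v : E) :
    HasFDerivAt (F x) ((fderiv ℝ (Function.uncurry F) (x, v)).comp
      (ContinuousLinearMap.inr ℝ E E)) v :=
  (hasStrictFDerivAt_uncurry hU hF hx v).hasFDerivAt.comp v (hasFDerivAt_prodMk_right x v)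

theorem continuousOn_fderiv_uncurry {F : E → E → ℝ} {U : Set E} (hU : IsOpen U)
    (hF : ContDiffOn ℝ 1 (Function.uncurry F) (U ×ˢ univ)) :
    ContinuousOn (fderiv ℝ (Function.uncurry F)) (U ×ˢ univ) :=
  hF.continuousOn_fderiv_of_isOpen (hU.prod isOpen_univ) le_rfl

theorem continuousOn_fderiv_right {F : E → E → ℝ} {U : Set E} (hU : IsOpen U)
    (hF : ContDiffOn ℝ 1 (Function.uncurry F) (U ×ˢ univ)) :
    ContinuousOn (fun ξ : E × E => fderiv ℝ (F ξ.1) ξ.2) (U ×ˢ univ) :=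
  ((continuousOn_fderiv_uncurry hU hF).clm_comp continuousOn_const).congr
    fun ξ hξ => (hasFDerivAt_right hU hF hξ.1 ξ.2).fderiv

theorem continuousOn_fderiv_left {F : E → E → ℝ} {U : Set E} (hU : IsOpen U)
    (hF : ContDiffOn ℝ 1 (Function.uncurry F) (U ×ˢ univ)) :
    ContinuousOn (fun ξ : E × E => fderiv ℝ (fun y => F y ξ.2) ξ.1) (U ×ˢ univ) :=
  ((continuousOn_fderiv_uncurry hU hF).clm_comp continuousOn_const).congr
    fun ξ hξ => (hasFDerivAt_left hU hF hξ.1 ξ.2).fderiv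

theorem fderiv_uncurry_apply {F : E → E → ℝ} {U : Set E} (hU : IsOpen U)
    (hF : ContDiffOn ℝ 1 (Function.uncurry F) (U ×ˢ univ)) {x : E} (hx : x ∈ U) (v w w' : E) :
    fderiv ℝ (Function.uncurry F) (x, v) (w, w') =
      fderiv ℝ (fun y => F y v) x w + fderiv ℝ (F x) v w' := by
  rw [(hasFDerivAt_left hU hF hx v).fderiv, (hasFDerivAt_right hU hF hx v).fderiv]
  simp only [ContinuousLinearMap.comp_apply, ContinuousLinearMap.inl_apply,
    ContinuousLinearMap.inr_apply, ← map_add]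
  simp

theorem norm_fderiv_uncurry_le {F : E → E → ℝ} {U : Set E} (hU : IsOpen U)
    (hF : ContDiffOn ℝ 1 (Function.uncurry F) (U ×ˢ univ)) {x : E} (hx : x ∈ U) (v : E) :
    ‖fderiv ℝ (Function.uncurry F) (x, v)‖ ≤
      ‖fderiv ℝ (fun y => F y v) x‖ + ‖fderiv ℝ (F x) v‖ := by
  refine ContinuousLinearMap.opNorm_le_bound _ (by positivity) fun w => ?_
  obtain ⟨w, w'⟩ := w
  rw [fderiv_uncurry_apply hU hF hx, add_mul]
  refine (norm_add_le _ _).trans (add_le_add ?_ ?_)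
  · exact (ContinuousLinearMap.le_opNorm _ _).trans
      (mul_le_mul_of_nonneg_left (norm_fst_le (w, w')) (norm_nonneg _))
  · exact (ContinuousLinearMap.le_opNorm _ _).trans
      (mul_le_mul_of_nonneg_left (norm_snd_le (w, w')) (norm_nonneg _))

/-- Since `f` is continuous only on `O`, measurability is first obtained for the push-forward
measure, which is concentrated on `O`. -/
theorem aestronglyMeasurable_comp_of_continuousOn {α X Y : Type*} [MeasurableSpace α]
    {μ : Measure α} [TopologicalSpace X] [MeasurableSpace X] [BorelSpace X]
    [SecondCountableTopology X] [TopologicalSpace.PseudoMetrizableSpace X]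
    [NormedAddCommGroup Y] {f : X → Y} {O : Set X}
    (hO : MeasurableSet O) (hf : ContinuousOn f O) {g : α → X} (hg : AEMeasurable g μ)
    (hgO : ∀ᵐ a ∂μ, g a ∈ O) : AEStronglyMeasurable (fun a => f (g a)) μ := by
  have h := hf.aestronglyMeasurable (μ := μ.map g) hO
  rw [Measure.restrict_eq_self_of_ae_mem ((ae_map_iff hg hO).2 hgO)] at h
  exact h.comp_aemeasurable hg

/-! ### First variation of the action in coordinates. -/

section Variation

variable [MeasurableSpace E] [BorelSpace E] [FiniteDimensional ℝ E]

/-- Differentiation under the integral by dominated convergence. Taking differences makes the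
integrand vanish at ε = 0, so integrability of the Lagrangian along the curve is not needed. The
function `y'` is any measurable function, not necessarily a derivative of `y`. -/
theorem hasDerivAt_integral_variation {F : E → E → ℝ} {U : Set E} (hU : IsOpen U)
    (hF : ContDiffOn ℝ 1 (Function.uncurry F) (U ×ˢ univ)) {a b r : ℝ} (hab : a ≤ b) (hr : 0 < r)
    {y y' w w' : ℝ → E} {g : ℝ → ℝ} (hy : ContinuousOn y (Icc a b)) (hy' : Measurable y')
    (hw : Continuous w) (hw' : Continuous w') (hg : IntervalIntegrable g volume a b)
    (hbound : ∀ᵐ s, s ∈ Ioo a b → ∀ x ∈ Metric.ball (y s) r, x ∈ U ∧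
      ∀ v ∈ Metric.ball (y' s) r, ‖fderiv ℝ (Function.uncurry F) (x, v)‖ ≤ g s) :
    (∀ᶠ ε in 𝓝 (0 : ℝ), IntervalIntegrable
      (fun s => F (y s + ε • w s) (y' s + ε • w' s) - F (y s) (y' s)) volume a b) ∧
    HasDerivAt (fun ε : ℝ => ∫ s in a..b,
      (F (y s + ε • w s) (y' s + ε • w' s) - F (y s) (y' s)))
      (∫ s in a..b, fderiv ℝ (Function.uncurry F) (y s, y' s) (w s, w' s)) 0 := by
  have := FiniteDimensional.proper ℝ E
  obtain ⟨W₁, hW₁⟩ := isCompact_Icc.exists_bound_of_continuousOn (hw.continuousOn (s := Icc a b))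
  obtain ⟨W₂, hW₂⟩ := isCompact_Icc.exists_bound_of_continuousOn (hw'.continuousOn (s := Icc a b))
  -- A positive common bound for both directions; for |ε| < r / W the perturbed points stay in the
  -- balls of radius `r`.
  set W : ℝ := max (max W₁ W₂) 0 + 1 with hWdef
  have hW0 : 0 < W := by positivity
  have hwW : ∀ s ∈ Icc a b, ‖w s‖ ≤ W := fun s hs => (hW₁ s hs).trans (by
    rw [hWdef]; linarith [le_max_left W₁ W₂, le_max_left (max W₁ W₂) 0])
  have hwW' : ∀ s ∈ Icc a b, ‖w' s‖ ≤ W := fun s hs => (hW₂ s hs).trans (by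
    rw [hWdef]; linarith [le_max_right W₁ W₂, le_max_left (max W₁ W₂) 0])
  set μ := volume.restrict (Ioo a b) with hμ
  have hae : ∀ᵐ s ∂μ, s ∈ Ioo a b ∧ ∀ x ∈ Metric.ball (y s) r, x ∈ U ∧
      ∀ v ∈ Metric.ball (y' s) r, ‖fderiv ℝ (Function.uncurry F) (x, v)‖ ≤ g s := by
    rw [hμ, ae_restrict_iff' measurableSet_Ioo]
    filter_upwards [hbound] with s hs hsab using ⟨hsab, hs hsab⟩
  set δ : ℝ := r / W with hδ
  have hδ0 : 0 < δ := div_pos hr hW0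
  have hball : ∀ s ∈ Icc a b, ∀ ε ∈ Metric.ball (0 : ℝ) δ,
      y s + ε • w s ∈ Metric.ball (y s) r ∧ y' s + ε • w' s ∈ Metric.ball (y' s) r := by
    intro s hs ε hε
    have h1 : |ε| * W < r := by
      have : |ε| < r / W := by simpa [hδ] using hε
      rwa [lt_div_iff₀ hW0] at this
    constructor
    · rw [mem_ball_iff_norm, add_sub_cancel_left, norm_smul, Real.norm_eq_abs]
      exact (mul_le_mul_of_nonneg_left (hwW s hs) (abs_nonneg ε)).trans_lt h1
    · rw [mem_ball_iff_norm, add_sub_cancel_left, norm_smul, Real.norm_eq_abs]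
      exact (mul_le_mul_of_nonneg_left (hwW' s hs) (abs_nonneg ε)).trans_lt h1
  have hym : AEMeasurable y μ :=
    (hy.mono Ioo_subset_Icc_self).aemeasurable measurableSet_Ioo
  have hpair : ∀ ε : ℝ, AEMeasurable (fun s => (y s + ε • w s, y' s + ε • w' s)) μ := fun ε =>
    (hym.add (hw.measurable.const_smul ε).aemeasurable).prodMk
      (hy'.add (hw'.measurable.const_smul ε)).aemeasurable
  have hmeas : ∀ ε ∈ Metric.ball (0 : ℝ) δ,
      AEStronglyMeasurable (fun s => F (y s + ε • w s) (y' s + ε • w' s)) μ := by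
    intro ε hε
    refine aestronglyMeasurable_comp_of_continuousOn (f := Function.uncurry F)
      (hU.prod isOpen_univ).measurableSet hF.continuousOn (hpair ε) ?_
    filter_upwards [hae] with s hs
    exact ⟨(hs.2 _ (hball s (Ioo_subset_Icc_self hs.1) ε hε).1).1, mem_univ _⟩
  have h0 : (0 : ℝ) ∈ Metric.ball (0 : ℝ) δ := Metric.mem_ball_self hδ0
  have hmeas0 : AEStronglyMeasurable (fun s => F (y s) (y' s)) μ := by
    simpa using hmeas 0 h0
  have hder : ∀ᵐ s ∂μ, ∀ ε ∈ Metric.ball (0 : ℝ) δ, HasDerivAt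
      (fun ε : ℝ => F (y s + ε • w s) (y' s + ε • w' s) - F (y s) (y' s))
      (fderiv ℝ (Function.uncurry F) (y s + ε • w s, y' s + ε • w' s) (w s, w' s)) ε := by
    filter_upwards [hae] with s hs ε hε
    have hUs := (hs.2 _ (hball s (Ioo_subset_Icc_self hs.1) ε hε).1).1
    have h1 : HasDerivAt (fun ε : ℝ => (y s + ε • w s, y' s + ε • w' s)) (w s, w' s) ε := by
      simpa using (((hasDerivAt_id ε).smul_const (w s)).const_add (y s)).prodMk
        (((hasDerivAt_id ε).smul_const (w' s)).const_add (y' s))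
    exact ((hasStrictFDerivAt_uncurry hU hF hUs _).hasFDerivAt.comp_hasDerivAt ε h1).sub_const _
  have hbd : ∀ᵐ s ∂μ, ∀ ε ∈ Metric.ball (0 : ℝ) δ,
      ‖fderiv ℝ (Function.uncurry F) (y s + ε • w s, y' s + ε • w' s) (w s, w' s)‖ ≤ g s * W := by
    filter_upwards [hae] with s hs ε hε
    obtain ⟨hb1, hb2⟩ := hball s (Ioo_subset_Icc_self hs.1) ε hε
    refine (ContinuousLinearMap.le_opNorm _ _).trans ?_
    have := (hs.2 _ hb1).2 _ hb2
    refine mul_le_mul this ?_ (norm_nonneg _) ((norm_nonneg _).trans this)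
    exact max_le (hwW s (Ioo_subset_Icc_self hs.1)) (hwW' s (Ioo_subset_Icc_self hs.1))
  have hgi : Integrable (fun s => g s * W) μ :=
    ((intervalIntegrable_iff_integrableOn_Ioo_of_le hab).1 hg).mul_const W
  have key := hasDerivAt_integral_of_dominated_loc_of_deriv_le (μ := μ) (bound := fun s => g s * W)
    (F := fun ε s => F (y s + ε • w s) (y' s + ε • w' s) - F (y s) (y' s))
    (F' := fun ε s => fderiv ℝ (Function.uncurry F) (y s + ε • w s, y' s + ε • w' s) (w s, w' s))
    (x₀ := (0 : ℝ)) (Metric.ball_mem_nhds _ hδ0)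
    (by
      filter_upwards [Metric.ball_mem_nhds (0 : ℝ) hδ0] with ε hε
      exact (hmeas ε hε).sub hmeas0)
    (by simp) (by
      refine aestronglyMeasurable_comp_of_continuousOn
        (f := fun ξ : (E × E) × (E × E) => fderiv ℝ (Function.uncurry F) ξ.1 ξ.2)
        (O := (U ×ˢ univ) ×ˢ univ)
        ((hU.prod isOpen_univ).prod isOpen_univ).measurableSet
        (((continuousOn_fderiv_uncurry hU hF).comp continuousOn_fst fun ξ hξ => hξ.1).clm_apply
          continuousOn_snd)
        ((hpair 0).prodMk (hw.measurable.prodMk hw'.measurable).aemeasurable) ?_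
      filter_upwards [hae] with s hs
      exact ⟨⟨(hs.2 _ (hball s (Ioo_subset_Icc_self hs.1) 0 h0).1).1, mem_univ _⟩, mem_univ _⟩)
    hbd hgi hder
  refine ⟨?_, ?_⟩
  · filter_upwards [Metric.ball_mem_nhds (0 : ℝ) hδ0] with ε hε
    rw [intervalIntegrable_iff_integrableOn_Ioo_of_le hab]
    refine Integrable.mono' (hgi.mul_const δ) ((hmeas ε hε).sub hmeas0) ?_
    filter_upwards [hder, hbd] with s hs1 hs2
    -- The mean value inequality in ε bounds the difference of Lagrangians by an integrable
    -- function.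
    have := (convex_ball (0 : ℝ) δ).norm_image_sub_le_of_norm_hasDerivWithin_le
      (fun ε' hε' => (hs1 ε' hε').hasDerivWithinAt) hs2 h0 hε
    simp only [zero_smul, add_zero, sub_self, sub_zero] at this
    refine this.trans (mul_le_mul_of_nonneg_left ?_ ((norm_nonneg _).trans (hs2 0 h0)))
    have : ‖ε‖ < δ := by simpa using hε
    exact this.le
  · have := key.2
    simp only [zero_smul, add_zero] at this
    simpa only [intervalIntegral.integral_of_le hab, integral_Ioc_eq_integral_Ioo] using this

/-- The weak Euler–Lagrange equation, integrated once. -/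
theorem ae_fderiv_eq_const_add_integral {F : E → E → ℝ} {U : Set E} (hU : IsOpen U)
    (hF : ContDiffOn ℝ 1 (Function.uncurry F) (U ×ˢ univ)) {a b : ℝ} (hab : a < b)
    {y y' : ℝ → E} {g : ℝ → ℝ} (hy : ContinuousOn y (Icc a b)) (hyU : ∀ s ∈ Icc a b, y s ∈ U)
    (hy' : Measurable y') (hg : IntervalIntegrable g volume a b)
    (hbound : ∀ᵐ s, s ∈ Ioo a b → ‖fderiv ℝ (Function.uncurry F) (y s, y' s)‖ ≤ g s)
    (hweak : ∀ w : ℝ → E, ContDiff ℝ ∞ w → HasCompactSupport w → tsupport w ⊆ Ioo a b →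
      ∫ s in a..b, fderiv ℝ (Function.uncurry F) (y s, y' s) (w s, deriv w s) = 0) :
    IntervalIntegrable (fun s => fderiv ℝ (fun x => F x (y' s)) (y s)) volume a b ∧
    ∃ c, ∀ᵐ s, s ∈ Ioo a b → fderiv ℝ (F (y s)) (y' s) =
      c + ∫ t in a..s, fderiv ℝ (fun x => F x (y' t)) (y t) := by
  have := FiniteDimensional.proper ℝ E
  set μ := volume.restrict (Ioo a b) with hμ
  have hae : ∀ᵐ s ∂μ, s ∈ Ioo a b ∧ ‖fderiv ℝ (Function.uncurry F) (y s, y' s)‖ ≤ g s := by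
    rw [hμ, ae_restrict_iff' measurableSet_Ioo]
    filter_upwards [hbound] with s hs hsab using ⟨hsab, hs hsab⟩
  have hym : AEMeasurable y μ :=
    (hy.mono Ioo_subset_Icc_self).aemeasurable measurableSet_Ioo
  have hD : IntegrableOn (fun s => fderiv ℝ (Function.uncurry F) (y s, y' s)) (Ioo a b) := by
    refine Integrable.mono' ((intervalIntegrable_iff_integrableOn_Ioo_of_le hab.le).1 hg) ?_
      (hae.mono fun s hs => hs.2)
    refine aestronglyMeasurable_comp_of_continuousOn (f := fderiv ℝ (Function.uncurry F))
      (hU.prod isOpen_univ).measurableSet (continuousOn_fderiv_uncurry hU hF)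
      (hym.prodMk hy'.aemeasurable) ?_
    filter_upwards [hae] with s hs
    exact ⟨hyU s (Ioo_subset_Icc_self hs.1), mem_univ _⟩
  -- Both partial derivatives are the full differential composed with a fixed linear map, so they
  -- inherit its integrability.
  have hcomp : ∀ (T : E →L[ℝ] E × E) (f : ℝ → (E →L[ℝ] ℝ)),
      (∀ s ∈ Ioo a b, f s = (fderiv ℝ (Function.uncurry F) (y s, y' s)).comp T) →
      IntervalIntegrable f volume a b := by
    intro T f hf
    rw [intervalIntegrable_iff_integrableOn_Ioo_of_le hab.le]
    refine IntegrableOn.congr_fun ?_ (fun s hs => (hf s hs).symm) measurableSet_Ioo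
    exact ((ContinuousLinearMap.compL ℝ E (E × E) ℝ).flip T).integrable_comp hD
  have hP := hcomp (ContinuousLinearMap.inl ℝ E E)
    (fun s => fderiv ℝ (fun x => F x (y' s)) (y s)) fun s hs =>
      (hasFDerivAt_left hU hF (hyU s (Ioo_subset_Icc_self hs)) _).fderiv
  have hR := hcomp (ContinuousLinearMap.inr ℝ E E)
    (fun s => fderiv ℝ (F (y s)) (y' s)) fun s hs =>
      (hasFDerivAt_right hU hF (hyU s (Ioo_subset_Icc_self hs)) _).fderiv
  refine ⟨hP, ae_eq_const_add_integral_of_weak hab hP hR fun φ hφ hφc hφs => ?_⟩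
  have hφ' : Continuous (deriv φ) := hφ.continuous_deriv (by exact_mod_cast le_top)
  have hint : IntervalIntegrable (fun s => φ s • fderiv ℝ (fun x => F x (y' s)) (y s) +
      deriv φ s • fderiv ℝ (F (y s)) (y' s)) volume a b :=
    (hP.continuousOn_smul hφ.continuous.continuousOn).add (hR.continuousOn_smul hφ'.continuousOn)
  -- The du Bois-Reymond lemma is used for covectors; evaluating its hypothesis on `v` amounts to
  -- the variation `φ • v`.
  ext v
  rw [ContinuousLinearMap.intervalIntegral_apply hint, zero_apply]
  have hdw : ∀ s, deriv (fun s => φ s • v) s = deriv φ s • v := fun s =>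
    ((hφ.differentiable (by simp) s).hasDerivAt.smul_const v).deriv
  rw [← hweak (fun s => φ s • v) (hφ.smul contDiff_const) hφc.smul_right
    ((tsupport_smul_subset_left φ fun _ => v).trans hφs)]
  refine intervalIntegral.integral_congr fun s hs => ?_
  rw [uIcc_of_le hab.le] at hs
  simp only [hdw]
  rw [fderiv_uncurry_apply hU hF (hyU s hs)]
  simp

end Variation

/-- A function with monotone gradient lies above its tangent hyperplanes. -/
theorem fderiv_apply_sub_le_of_monotone {f : E → ℝ} (hf : Differentiable ℝ f)
    (hmono : ∀ u v, 0 ≤ (fderiv ℝ f v - fderiv ℝ f u) (v - u)) (u v : E) :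
    fderiv ℝ f u (v - u) ≤ f v - f u := by
  have hd : ∀ t : ℝ, HasDerivAt (fun t : ℝ => f (u + t • (v - u)))
      (fderiv ℝ f (u + t • (v - u)) (v - u)) t := fun t => by
    have h1 : HasDerivAt (fun t : ℝ => u + t • (v - u)) (v - u) t := by
      simpa using ((hasDerivAt_id t).smul_const (v - u)).const_add u
    exact (hf _).hasFDerivAt.comp_hasDerivAt t h1
  obtain ⟨t, ht, hteq⟩ := exists_hasDerivAt_eq_slope (fun t : ℝ => f (u + t • (v - u)))
    (fun t => fderiv ℝ f (u + t • (v - u)) (v - u)) zero_lt_one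
    (fun t _ => (hd t).continuousAt.continuousWithinAt) fun t _ => hd t
  simp only [one_smul, add_sub_cancel, zero_smul, add_zero, sub_zero, div_one] at hteq
  rw [← hteq]
  have h := hmono u (u + t • (v - u))
  rw [add_sub_cancel_left, map_smul, smul_eq_mul] at h
  have := nonneg_of_mul_nonneg_right h ht.1
  rw [sub_apply] at this
  linarith

end FiniteDimensional

end SymLagrangian

namespace SymLagrangian

/-! ### The momentum map of a Lagrangian with a symmetry, in coordinates. -/

section CoordinateLagrangian

variable {E : Type*} [NormedAddCommGroup E] [NormedSpace ℝ E]

/-- The coordinate form of the assumptions, on an open set `U` where the constant `lam` of strong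
convexity can be chosen uniformly: `F` is the Lagrangian, `k` the infinitesimal symmetry, and
`q y u + δ y` the Noether charge. -/
structure IsCoordSymLagrangian (U : Set E) (F : E → E → ℝ) (k : E → E) (q : E → E →L[ℝ] ℝ)
    (δ : E → ℝ) (lam : ℝ) : Prop where
  isOpen : IsOpen U
  contDiffOn_F : ContDiffOn ℝ 1 (Function.uncurry F) (U ×ˢ univ)
  contDiffOn_k : ContDiffOn ℝ 1 k U
  contDiffOn_q : ContDiffOn ℝ 1 (Function.uncurry fun y u => q y u) (U ×ˢ univ)
  contDiffOn_δ : ContDiffOn ℝ 1 δ U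
  noether : ∀ y ∈ U, ∀ u, fderiv ℝ (F y) u (k y) = q y u + δ y
  neg : ∀ y ∈ U, q y (k y) < 0
  pos : 0 < lam
  convex : ∀ y ∈ U, ∀ u v, lam * ‖v - u‖ ^ 2 ≤
    (fderiv ℝ (F y) v - fderiv ℝ (F y) u) (v - u) - 2 * q y (v - u) ^ 2 / q y (k y)

namespace IsCoordSymLagrangian

variable {U : Set E} {F : E → E → ℝ} {k : E → E} {q : E → E →L[ℝ] ℝ} {δ : E → ℝ} {lam : ℝ}

theorem mono (H : IsCoordSymLagrangian U F k q δ lam) {U' : Set E} (hU' : IsOpen U') (h : U' ⊆ U) :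
    IsCoordSymLagrangian U' F k q δ lam where
  isOpen := hU'
  contDiffOn_F := H.contDiffOn_F.mono (prod_mono h Subset.rfl)
  contDiffOn_k := H.contDiffOn_k.mono h
  contDiffOn_q := H.contDiffOn_q.mono (prod_mono h Subset.rfl)
  contDiffOn_δ := H.contDiffOn_δ.mono h
  noether y hy := H.noether y (h hy)
  neg y hy := H.neg y (h hy)
  pos := H.pos
  convex y hy := H.convex y (h hy)

/-- Equal momenta agree on `k y`, so by the Noether identity `q y` takes the same value at `u` and
`v`. The nonconvex correction then vanishes on `v - u`, where strong convexity applies undisturbed.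
-/
theorem momentum_injective (H : IsCoordSymLagrangian U F k q δ lam) {y : E} (hy : y ∈ U) {u v : E}
    (h : fderiv ℝ (F y) u = fderiv ℝ (F y) v) : u = v := by
  have h1 := H.noether y hy u
  have h2 := H.noether y hy v
  have h3 : q y (v - u) = 0 := by rw [map_sub]; rw [h, h2] at h1; linarith
  have h4 := H.convex y hy u v
  rw [h3, h, sub_self] at h4
  simp only [zero_apply, ne_eq, OfNat.ofNat_ne_zero, not_false_eq_true, zero_pow, mul_zero,
    zero_div, sub_zero] at h4
  have h5 : ‖v - u‖ ^ 2 ≤ 0 := by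
    by_contra hne
    exact absurd (mul_pos H.pos (not_le.1 hne)) (not_lt.2 h4)
  have h6 : ‖v - u‖ = 0 := pow_eq_zero_iff (two_ne_zero) |>.1 (le_antisymm h5 (sq_nonneg _))
  exact (sub_eq_zero.1 (norm_eq_zero.1 h6)).symm

/-- A velocity is bounded in terms of its momentum. -/
theorem norm_le_of_momentum (H : IsCoordSymLagrangian U F k q δ lam) {y : E} (hy : y ∈ U) (v : E) :
    ‖v‖ ≤ (‖fderiv ℝ (F y) v - fderiv ℝ (F y) 0‖ +
      2 * (‖fderiv ℝ (F y) v - fderiv ℝ (F y) 0‖ * ‖k y‖ * ‖q y‖ / |q y (k y)|)) / lam := by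
  set D := fderiv ℝ (F y) v - fderiv ℝ (F y) 0 with hD
  -- The Noether identity reads the charge off the momentum.
  have hq : q y v = D (k y) := by
    have h1 := H.noether y hy v
    have h2 := H.noether y hy 0
    rw [map_zero, zero_add] at h2
    rw [hD, sub_apply, h1, h2]; ring
  have hc := H.convex y hy 0 v
  rw [sub_zero, ← hD] at hc
  have hneg := H.neg y hy
  rcases (norm_nonneg v).eq_or_lt with h0 | h0
  · rw [← h0]; have := H.pos; positivity
  rw [le_div_iff₀ H.pos]
  have h1 : D v ≤ ‖D‖ * ‖v‖ := (le_abs_self _).trans (D.le_opNorm v)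
  -- Only one of the two factors is expressed through `D`; the other leaves a factor ‖v‖, to be
  -- cancelled against lam ‖v‖².
  have h2 : q y v ^ 2 ≤ (‖D‖ * ‖k y‖) * (‖q y‖ * ‖v‖) := by
    rw [← sq_abs, sq]
    refine mul_le_mul ?_ ((q y).le_opNorm v) (abs_nonneg _) (by positivity)
    rw [hq]; exact D.le_opNorm _
  have h3 : -(2 * q y v ^ 2 / q y (k y)) ≤
      2 * (‖D‖ * ‖k y‖ * (‖q y‖ * ‖v‖)) / |q y (k y)| := by
    rw [abs_of_neg hneg, div_neg, neg_le_neg_iff]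
    exact div_le_div_of_nonpos_of_le hneg.le (by linarith)
  have h4 : lam * ‖v‖ ^ 2 ≤ (‖D‖ + 2 * (‖D‖ * ‖k y‖ * ‖q y‖ / |q y (k y)|)) * ‖v‖ := by
    have : (‖D‖ + 2 * (‖D‖ * ‖k y‖ * ‖q y‖ / |q y (k y)|)) * ‖v‖ =
      ‖D‖ * ‖v‖ + 2 * (‖D‖ * ‖k y‖ * (‖q y‖ * ‖v‖)) / |q y (k y)| := by ring
    rw [this]; linarith
  rw [sq, ← mul_assoc] at h4
  rw [mul_comm]
  exact le_of_mul_le_mul_right h4 h0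

theorem continuousOn_q [FiniteDimensional ℝ E] (H : IsCoordSymLagrangian U F k q δ lam) :
    ContinuousOn q U :=
  continuousOn_clm_apply.2 fun u => H.contDiffOn_q.continuousOn.comp
    (continuousOn_id.prodMk continuousOn_const) fun _ hy => ⟨hy, mem_univ u⟩

/-- Regularity of the velocity: if the momentum is almost everywhere equal to a continuous
function, then so is the velocity. -/
theorem exists_continuousOn_velocity [FiniteDimensional ℝ E]
    (H : IsCoordSymLagrangian U F k q δ lam) {a b : ℝ} {y vel : ℝ → E}
    (hab : a < b) {P : ℝ → E →L[ℝ] ℝ} (hy : ContinuousOn y (Icc a b))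
    (hyU : ∀ s ∈ Icc a b, y s ∈ U) (hP : ContinuousOn P (Icc a b))
    (hvel : ∀ᵐ s, s ∈ Ioo a b → fderiv ℝ (F (y s)) (vel s) = P s) :
    ∃ V : ℝ → E, ContinuousOn V (Icc a b) ∧ (∀ᵐ s, s ∈ Ioo a b → vel s = V s) ∧
      ∀ s ∈ Icc a b, fderiv ℝ (F (y s)) (V s) = P s := by
  have := FiniteDimensional.proper ℝ E
  have hfd := continuousOn_fderiv_right H.isOpen H.contDiffOn_F
  have hR0 : ContinuousOn (fun s => fderiv ℝ (F (y s)) 0) (Icc a b) :=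
    hfd.comp (hy.prodMk continuousOn_const) fun s hs => ⟨hyU s hs, mem_univ _⟩
  have hqc : ContinuousOn (fun s => q (y s)) (Icc a b) := H.continuousOn_q.comp hy hyU
  have hkc : ContinuousOn (fun s => k (y s)) (Icc a b) := H.contDiffOn_k.continuousOn.comp hy hyU
  obtain ⟨B, hB⟩ := isCompact_Icc.exists_bound_of_continuousOn
    (f := fun s => (‖P s - fderiv ℝ (F (y s)) 0‖ + 2 * (‖P s - fderiv ℝ (F (y s)) 0‖ *
      ‖k (y s)‖ * ‖q (y s)‖ / |q (y s) (k (y s))|)) / lam) (s := Icc a b) (by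
    have hne : ∀ s ∈ Icc a b, |q (y s) (k (y s))| ≠ 0 := fun s hs =>
      abs_ne_zero.2 (H.neg _ (hyU s hs)).ne
    exact ((hP.sub hR0).norm.add (continuousOn_const.mul ((((hP.sub hR0).norm.mul hkc.norm).mul
      hqc.norm).div (hqc.clm_apply hkc).abs hne))).div_const _)
  have hbd : ∀ s ∈ Icc a b, ∀ v, fderiv ℝ (F (y s)) v = P s → ‖v‖ ≤ B := by
    intro s hs v hv
    have := H.norm_le_of_momentum (hyU s hs) v
    rw [hv] at this
    exact this.trans ((le_abs_self _).trans (hB s hs))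
  -- the graph of the velocity
  let Z : Set (ℝ × E) := {ξ | ξ ∈ Icc a b ×ˢ Metric.closedBall (0 : E) B ∧
    fderiv ℝ (F (y ξ.1)) ξ.2 - P ξ.1 = 0}
  have hZ : IsCompact Z := by
    have hc : ContinuousOn (fun ξ : ℝ × E => fderiv ℝ (F (y ξ.1)) ξ.2 - P ξ.1)
        (Icc a b ×ˢ Metric.closedBall (0 : E) B) := by
      refine ContinuousOn.sub ?_ (hP.comp continuousOn_fst fun ξ hξ => hξ.1)
      exact hfd.comp ((hy.comp continuousOn_fst fun ξ hξ => hξ.1).prodMk continuousOn_snd)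
        fun ξ hξ => ⟨hyU _ hξ.1, mem_univ _⟩
    exact (isCompact_Icc.prod (isCompact_closedBall 0 B)).of_isClosed_subset
      (hc.preimage_isClosed_of_isClosed (isClosed_Icc.prod Metric.isClosed_closedBall)
        (isClosed_singleton (x := 0))) fun ξ hξ => hξ.1
  -- The projection of the compact set `Z` is closed. It contains almost every time, hence a dense
  -- set of times, hence all of them: the prescribed momentum is attained at the exceptional times
  -- too.
  have hsurj : ∀ s ∈ Icc a b, ∃ v, (s, v) ∈ Z := by
    have hcl : IsClosed (Prod.fst '' Z) := (hZ.image continuous_fst).isClosed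
    have hdense : Ioo a b ⊆ closure (Prod.fst '' Z) := by
      intro s hs
      rw [mem_closure_iff]
      intro O hO hsO
      by_contra hemp
      have hnull : volume (O ∩ Ioo a b) = 0 := by
        refine measure_mono_null ?_ (ae_iff.1 hvel)
        intro t ht
        simp only [mem_ofPred_eq, Classical.not_imp]
        refine ⟨ht.2, fun h => hemp ⟨t, ht.1, (t, vel t), ⟨⟨Ioo_subset_Icc_self ht.2, ?_⟩, ?_⟩, rfl⟩⟩
        · simpa using hbd t (Ioo_subset_Icc_self ht.2) _ h
        · simp [h]
      have := (hO.inter isOpen_Ioo).measure_eq_zero_iff volume |>.1 hnull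
      exact (this ▸ (⟨hsO, hs⟩ : s ∈ O ∩ Ioo a b) : s ∈ (∅ : Set ℝ))
    rw [hcl.closure_eq] at hdense
    have : Icc a b ⊆ Prod.fst '' Z := by
      rw [← closure_Ioo hab.ne]; exact hcl.closure_subset_iff.2 hdense
    intro s hs
    obtain ⟨⟨s', v⟩, hξ, rfl⟩ := this hs
    exact ⟨v, hξ⟩
  choose! V hV using hsurj
  -- Injectivity of the momentum makes `Z` the graph of `V`, and a function with compact graph is
  -- continuous.
  have hmem : ∀ ξ ∈ Z, ξ.2 = V ξ.1 := fun ξ hξ =>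
    H.momentum_injective (hyU _ hξ.1.1) ((sub_eq_zero.1 hξ.2).trans
      (sub_eq_zero.1 (hV ξ.1 hξ.1.1).2).symm)
  refine ⟨V, ?_, ?_, fun s hs => sub_eq_zero.1 (hV s hs).2⟩
  · rw [continuousOn_iff_isClosed]
    intro T hT
    refine ⟨Prod.fst '' (Z ∩ Prod.snd ⁻¹' T),
      ((hZ.inter_right (hT.preimage continuous_snd)).image continuous_fst).isClosed, ?_⟩
    ext s
    constructor
    · rintro ⟨hs, hsI⟩
      exact ⟨⟨(s, V s), ⟨hV s hsI, hs⟩, rfl⟩, hsI⟩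
    · rintro ⟨⟨ξ, ⟨hξ, hξT⟩, rfl⟩, hsI⟩
      refine ⟨?_, hsI⟩
      rw [mem_preimage, ← hmem ξ hξ]; exact hξT
  · filter_upwards [hvel] with s hs hsab
    have hsI := Ioo_subset_Icc_self hsab
    exact hmem (s, vel s) ⟨⟨hsI, by simpa using hbd s hsI _ (hs hsab)⟩, sub_eq_zero.2 (hs hsab)⟩

/-- The excess of the Lagrangian over its tangent hyperplanes. -/
theorem le_excess (H : IsCoordSymLagrangian U F k q δ lam) {y : E} (hy : y ∈ U) (u v : E) :
    q y (v - u) ^ 2 / q y (k y) ≤ F y v - F y u - fderiv ℝ (F y) u (v - u) := by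
  have hFd : ∀ u, HasFDerivAt (F y) (fderiv ℝ (F y) u) u := fun u =>
    (hasFDerivAt_right H.isOpen H.contDiffOn_F hy u).differentiableAt.hasFDerivAt
  -- The corrected function has monotone gradient and so lies above its tangent hyperplanes; for the
  -- subtracted quadratic part, the excess is exactly `q y (v - u) ^ 2 / q y (k y)`.
  have hd : ∀ u, HasFDerivAt (fun u => F y u - q y u ^ 2 * (q y (k y))⁻¹)
      (fderiv ℝ (F y) u - (q y (k y))⁻¹ • ((2 * q y u) • q y)) u := fun u => by
    have h1 := (((q y).hasFDerivAt (x := u)).pow 2).mul_const (q y (k y))⁻¹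
    refine (hFd u).sub ?_
    convert! h1 using 2
    simp
  have key := fderiv_apply_sub_le_of_monotone (fun u => (hd u).differentiableAt) (by
    intro u v
    have := H.convex y hy u v
    have hp : 0 ≤ lam * ‖v - u‖ ^ 2 := mul_nonneg H.pos.le (sq_nonneg _)
    rw [(hd u).fderiv, (hd v).fderiv]
    refine (hp.trans this).trans_eq ?_
    simp only [sub_apply, smul_apply, smul_eq_mul, map_sub]
    ring) u v
  rw [(hd u).fderiv] at key
  simp only [sub_apply, smul_apply, smul_eq_mul, map_sub] at key ⊢
  have : (q y v - q y u) ^ 2 / q y (k y) = q y v ^ 2 * (q y (k y))⁻¹ - q y u ^ 2 * (q y (k y))⁻¹ -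
    (q y (k y))⁻¹ * (2 * q y u * (q y v - q y u)) := by ring
  rw [this]; linarith

end IsCoordSymLagrangian

end CoordinateLagrangian

end SymLagrangian

namespace SymLagrangian

/-! ### Conservation of energy in coordinates. -/

section Energy

variable {E : Type*} [NormedAddCommGroup E] [NormedSpace ℝ E]

theorem isBigO_sub_of_hasDerivWithinAt {G : Type*} [NormedAddCommGroup G] [NormedSpace ℝ G]
    {f : ℝ → G} {f' : G} {I : Set ℝ} {s₀ : ℝ} (hf : HasDerivWithinAt f f' I s₀) :
    (fun s => f s - f s₀) =O[𝓝[I] s₀] fun s => s - s₀ := by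
  have h2 : (fun s => (s - s₀) • f') =O[𝓝[I] s₀] fun s => s - s₀ :=
    Asymptotics.IsBigO.of_bound ‖f'‖ (Eventually.of_forall fun s => by
      rw [norm_smul, mul_comm])
  refine ((hasDerivWithinAt_iff_isLittleO.1 hf).isBigO.add h2).congr_left fun s => ?_
  abel

/-- The increment of a function in the first variable, when the second one converges. -/
theorem isLittleO_sub_left {F : E → E → ℝ} {U : Set E} (hU : IsOpen U)
    (hF : ContDiffOn ℝ 1 (Function.uncurry F) (U ×ˢ univ)) {I : Set ℝ} {s₀ : ℝ}
    {y V : ℝ → E} {v : E} (hyU : y s₀ ∈ U) (hy : HasDerivWithinAt y v I s₀)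
    (hV : Tendsto V (𝓝[I] s₀) (𝓝 v)) :
    (fun s => F (y s) (V s) - F (y s₀) (V s) - (s - s₀) * fderiv ℝ (fun x => F x v) (y s₀) v)
      =o[𝓝[I] s₀] fun s => s - s₀ := by
  -- Both (y s, V s) and (y s₀, V s) move with `s`; strict differentiability lets mere convergence
  -- of `V` suffice.
  have hst := hasStrictFDerivAt_uncurry hU hF hyU v
  have hyt : Tendsto y (𝓝[I] s₀) (𝓝 (y s₀)) := hy.continuousWithinAt
  have ht : Tendsto (fun s => ((y s, V s), (y s₀, V s))) (𝓝[I] s₀)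
      (𝓝 ((y s₀, v), (y s₀, v))) :=
    (hyt.prodMk_nhds hV).prodMk_nhds (tendsto_const_nhds.prodMk_nhds hV)
  have h1 := hst.isLittleO.comp_tendsto ht
  have hO : (fun s => y s - y s₀) =O[𝓝[I] s₀] fun s => s - s₀ :=
    isBigO_sub_of_hasDerivWithinAt hy
  have h2 : (fun s => F (y s) (V s) - F (y s₀) (V s) -
      fderiv ℝ (fun x => F x v) (y s₀) (y s - y s₀)) =o[𝓝[I] s₀] fun s => s - s₀ := by
    refine (h1.trans_isBigO (k := fun s => s - s₀) ?_).congr_left fun s => ?_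
    · refine Asymptotics.IsBigO.trans (Asymptotics.isBigO_of_le _ fun s => ?_) hO
      simp
    · simp only [Function.comp_apply, Prod.mk_sub_mk, sub_self, Function.uncurry_apply_pair]
      rw [fderiv_uncurry_apply hU hF hyU]
      simp
  have h3 : (fun s => y s - y s₀ - (s - s₀) • v) =o[𝓝[I] s₀] fun s => s - s₀ :=
    hasDerivWithinAt_iff_isLittleO.1 hy
  have h4 := ((fderiv ℝ (fun x => F x v) (y s₀)).isBigO_comp _ _).trans_isLittleO h3
  refine (h2.add h4).congr_left fun s => ?_
  simp only [map_sub, map_smul, smul_eq_mul]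
  ring

theorem isBigO_sub_left {F : E → E → ℝ} {U : Set E} (hU : IsOpen U)
    (hF : ContDiffOn ℝ 1 (Function.uncurry F) (U ×ˢ univ)) {I : Set ℝ} {s₀ : ℝ}
    {y V : ℝ → E} {v : E} (hyU : y s₀ ∈ U) (hy : HasDerivWithinAt y v I s₀)
    (hV : Tendsto V (𝓝[I] s₀) (𝓝 v)) :
    (fun s => F (y s) (V s) - F (y s₀) (V s)) =O[𝓝[I] s₀] fun s => s - s₀ := by
  have h2 : (fun s => (s - s₀) * fderiv ℝ (fun x => F x v) (y s₀) v)
      =O[𝓝[I] s₀] fun s => s - s₀ := by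
    simpa only [mul_comm] using Asymptotics.isBigO_const_mul_self
      (fderiv ℝ (fun x => F x v) (y s₀) v) (fun s => s - s₀) (𝓝[I] s₀)
  refine ((isLittleO_sub_left hU hF hyU hy hV).isBigO.add h2).congr_left fun s => ?_
  ring

/-- Conservation of energy along a solution of the Euler–Lagrange equation. The Lagrangian is not
convex, but the failure is of second order because the Noether charge is differentiable. -/
theorem IsCoordSymLagrangian.hasDerivWithinAt_energy [FiniteDimensional ℝ E] {U : Set E}
    {F : E → E → ℝ} {k : E → E} {q : E → E →L[ℝ] ℝ} {δ : E → ℝ} {lam : ℝ}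
    (H : IsCoordSymLagrangian U F k q δ lam) {I : Set ℝ} {s₀ : ℝ} (hs₀ : s₀ ∈ I) {y V : ℝ → E}
    (hyU : ∀ s ∈ I, y s ∈ U) (hy : HasDerivWithinAt y (V s₀) I s₀)
    (hV : ContinuousWithinAt V I s₀)
    (hp : HasDerivWithinAt (fun s => fderiv ℝ (F (y s)) (V s))
      (fderiv ℝ (fun x => F x (V s₀)) (y s₀)) I s₀) :
    HasDerivWithinAt (fun s => fderiv ℝ (F (y s)) (V s) (V s) - F (y s) (V s)) 0 I s₀ := by
  set l := 𝓝[I] s₀ with hl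
  set p : ℝ → E →L[ℝ] ℝ := fun s => fderiv ℝ (F (y s)) (V s) with hpdef
  set Lx := fderiv ℝ (fun x => F x (V s₀)) (y s₀) with hLx
  have hVt : Tendsto V l (𝓝 (V s₀)) := hV
  have hyc : Tendsto y l (𝓝 (y s₀)) := hy.continuousWithinAt
  have hU0 := hyU s₀ hs₀
  -- the increments of momentum and position compensate
  have hT : ∀ W : ℝ → E, Tendsto W l (𝓝 (V s₀)) →
      (fun s => (p s - p s₀) (W s) - (F (y s) (W s) - F (y s₀) (W s))) =o[l] fun s => s - s₀ := by
    intro W hW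
    have h1 := isLittleO_sub_left H.isOpen H.contDiffOn_F hU0 hy hW
    have h2 : (fun s => p s - p s₀ - (s - s₀) • Lx) =o[l] fun s => s - s₀ :=
      hasDerivWithinAt_iff_isLittleO.1 hp
    have h3 : (fun s => (p s - p s₀ - (s - s₀) • Lx) (W s)) =o[l] fun s => s - s₀ := by
      have hWO : W =O[l] fun _ => (1 : ℝ) := hW.isBigO_one ℝ
      refine Asymptotics.IsBigO.trans_isLittleO ?_ ((h2.norm_left.mul_isBigO hWO.norm_left).congr_right
        fun s => mul_one _)
      exact Asymptotics.isBigO_of_le _ fun s => by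
        rw [norm_mul, norm_norm, norm_norm]; exact ContinuousLinearMap.le_opNorm _ _
    have h4 : (fun s => (s - s₀) * Lx (W s - V s₀)) =o[l] fun s => s - s₀ := by
      have h5 : (fun s => Lx (W s - V s₀)) =o[l] fun _ => (1 : ℝ) := by
        rw [Asymptotics.isLittleO_one_iff]
        have : Tendsto (fun s => W s - V s₀) l (𝓝 0) := by
          simpa using hW.sub_const (V s₀)
        rw [← map_zero Lx]
        exact (Lx.continuous.tendsto 0).comp this
      simpa using (Asymptotics.isBigO_refl (fun s => s - s₀) l).mul_isLittleO h5
    refine ((h3.add h4).sub h1).congr_left fun s => ?_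
    simp only [sub_apply, smul_apply, smul_eq_mul, map_sub]
    ring
  have hT1 := hT V hVt
  have hT2 := hT (fun _ => V s₀) tendsto_const_nhds
  -- the Noether charge is differentiable along the curve
  have hN : (fun s => q (y s) (V s) - q (y s₀) (V s₀)) =O[l] fun s => s - s₀ := by
    have hk : HasDerivWithinAt (fun s => k (y s)) (fderiv ℝ k (y s₀) (V s₀)) I s₀ :=
      ((H.contDiffOn_k.contDiffAt (H.isOpen.mem_nhds hU0)).differentiableAt
        one_ne_zero).hasFDerivAt.comp_hasDerivWithinAt s₀ hy
    have hδ : HasDerivWithinAt (fun s => δ (y s)) (fderiv ℝ δ (y s₀) (V s₀)) I s₀ :=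
      ((H.contDiffOn_δ.contDiffAt (H.isOpen.mem_nhds hU0)).differentiableAt
        one_ne_zero).hasFDerivAt.comp_hasDerivWithinAt s₀ hy
    have h1 := isBigO_sub_of_hasDerivWithinAt ((hp.clm_apply hk).sub hδ)
    refine h1.congr' ?_ EventuallyEq.rfl
    filter_upwards [self_mem_nhdsWithin] with s hs
    have e1 := H.noether _ (hyU s hs) (V s)
    have e2 := H.noether _ hU0 (V s₀)
    simp only [Pi.sub_apply]
    rw [e1, e2]; ring
  have hq1 := isBigO_sub_left H.isOpen H.contDiffOn_q hU0 hy hVt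
  have hq2 := isBigO_sub_left H.isOpen H.contDiffOn_q hU0 hy
    (tendsto_const_nhds (x := V s₀) (f := l))
  have hsq : ∀ f : ℝ → ℝ, f =O[l] (fun s => s - s₀) → (fun s => f s ^ 2) =o[l] fun s => s - s₀ := by
    intro f hf
    have h1 : f =o[l] fun _ => (1 : ℝ) := by
      refine hf.trans_isLittleO ((Asymptotics.isLittleO_one_iff ℝ).2 ?_)
      have : Tendsto (fun s => s - s₀) (𝓝 s₀) (𝓝 0) := by
        simpa using (tendsto_id (α := ℝ) (x := 𝓝 s₀)).sub_const s₀
      exact this.mono_left nhdsWithin_le_nhds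
    simpa [sq] using hf.mul_isLittleO h1
  -- The value of `q (y s₀)` on V s - V s₀ is the increment of q(V) along the curve minus an
  -- increment in the position alone. Both are O(s - s₀), although `V` is only continuous.
  have hS1 : (fun s => q (y s₀) (V s - V s₀) ^ 2 / q (y s₀) (k (y s₀))) =o[l] fun s => s - s₀ := by
    have := (hsq _ (hN.sub hq1)).const_mul_left (q (y s₀) (k (y s₀)))⁻¹
    refine this.congr_left fun s => ?_
    simp only [map_sub]; ring
  have hS2 : (fun s => q (y s) (V s₀ - V s) ^ 2 / q (y s) (k (y s))) =o[l] fun s => s - s₀ := by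
    have h1 := hsq _ (hN.sub hq2)
    have h2 : (fun s => (q (y s) (k (y s)))⁻¹) =O[l] fun _ => (1 : ℝ) := by
      have hqk : ContinuousOn (fun y => q y (k y)) U :=
        H.continuousOn_q.clm_apply H.contDiffOn_k.continuousOn
      exact (((hqk.continuousAt (H.isOpen.mem_nhds hU0)).tendsto.comp hyc).inv₀ (H.neg _ hU0).ne).isBigO_one ℝ
    refine (h2.mul_isLittleO h1).congr (fun s => ?_) fun s => one_mul _
    simp only [map_sub]; ring
  rw [hasDerivWithinAt_iff_isLittleO]
  refine Asymptotics.IsBigO.trans_isLittleO (Asymptotics.IsBigO.of_bound 1 ?_)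
    ((hT1.norm_left.add hT2.norm_left).add (hS1.norm_left.add hS2.norm_left))
  filter_upwards [self_mem_nhdsWithin] with s hs
  -- The tangent inequality at `y s₀` bounds the energy increment from above, the one at `y s` from
  -- below.
  have e1 := H.le_excess hU0 (V s₀) (V s)
  have e2 := H.le_excess (hyU s hs) (V s) (V s₀)
  simp only [smul_zero, sub_zero, Real.norm_eq_abs, one_mul]
  refine le_trans ?_ (le_abs_self _)
  simp only [sub_apply, map_sub, hpdef] at e1 e2 ⊢
  rw [abs_le]
  constructor
  · have := neg_abs_le ((fderiv ℝ (F (y s)) (V s)) (V s₀) - (fderiv ℝ (F (y s₀)) (V s₀)) (V s₀) -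
      (F (y s) (V s₀) - F (y s₀) (V s₀)))
    have := neg_abs_le ((q (y s) (V s₀) - q (y s) (V s)) ^ 2 / q (y s) (k (y s)))
    have := abs_nonneg ((q (y s₀) (V s) - q (y s₀) (V s₀)) ^ 2 / q (y s₀) (k (y s₀)))
    have := abs_nonneg ((fderiv ℝ (F (y s)) (V s)) (V s) - (fderiv ℝ (F (y s₀)) (V s₀)) (V s) -
      (F (y s) (V s) - F (y s₀) (V s)))
    linarith
  · have := le_abs_self ((fderiv ℝ (F (y s)) (V s)) (V s) - (fderiv ℝ (F (y s₀)) (V s₀)) (V s) -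
      (F (y s) (V s) - F (y s₀) (V s)))
    have := neg_abs_le ((q (y s₀) (V s) - q (y s₀) (V s₀)) ^ 2 / q (y s₀) (k (y s₀)))
    have := abs_nonneg ((q (y s) (V s₀) - q (y s) (V s)) ^ 2 / q (y s) (k (y s)))
    have := abs_nonneg ((fderiv ℝ (F (y s)) (V s)) (V s₀) - (fderiv ℝ (F (y s₀)) (V s₀)) (V s₀) -
      (F (y s) (V s₀) - F (y s₀) (V s₀)))
    linarith

end Energy

end SymLagrangian
namespace SymLagrangian

set_option linter.unusedSectionVars false

/-! ### Lagrangians, vector fields and one-forms in a chart. -/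

section Charts

variable {m : ℕ} {M : Type*} [TopologicalSpace M]
  [ChartedSpace (EuclideanSpace ℝ (Fin (m + 1))) M] [IsManifold (𝓡 (m + 1)) ∞ M]
local notation "𝔼" => EuclideanSpace ℝ (Fin (m + 1))

theorem one_add_one_le_infty : (1 : ℕ∞ω) + 1 ≤ ∞ := by
  rw [one_add_one_eq_two]
  exact WithTop.coe_le_coe.2 (le_top (a := (2 : ℕ∞)))

theorem chart_mdifferentiable {e : OpenPartialHomeomorph M 𝔼} (he : e ∈ smoothCharts m M) :
    e.MDifferentiable (𝓡 (m + 1)) (𝓡 (m + 1)) :=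
  ⟨(contMDiffOn_of_mem_maximalAtlas he).mdifferentiableOn (by simp),
    (contMDiffOn_symm_of_mem_maximalAtlas he).mdifferentiableOn (by simp)⟩

/-- The tangent space at `x` in the coordinates `e`. -/
noncomputable def coordEquiv {e : OpenPartialHomeomorph M 𝔼} (he : e ∈ smoothCharts m M) {x : M}
    (hx : x ∈ e.source) : TangentSpace (𝓡 (m + 1)) x ≃L[ℝ] 𝔼 :=
  ((chart_mdifferentiable he).mfderiv hx).trans (NormedSpace.fromTangentSpace (e x))

theorem coordEquiv_apply {e : OpenPartialHomeomorph M 𝔼} (he : e ∈ smoothCharts m M) {x : M}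
    (hx : x ∈ e.source) (v : TangentSpace (𝓡 (m + 1)) x) :
    coordEquiv he hx v = coordVec e x v := rfl

theorem coordEquiv_symm_apply {e : OpenPartialHomeomorph M 𝔼} (he : e ∈ smoothCharts m M) {x : M}
    (hx : x ∈ e.source) (u : 𝔼) :
    (coordEquiv he hx).symm u = mfderiv (𝓡 (m + 1)) (𝓡 (m + 1)) e.symm (e x) u := rfl

theorem coordLagrangian_coordVec {e : OpenPartialHomeomorph M 𝔼} (he : e ∈ smoothCharts m M) {x : M}
    (hx : x ∈ e.source) (L : TangentBundle (𝓡 (m + 1)) M → ℝ) (v : TangentSpace (𝓡 (m + 1)) x) :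
    coordLagrangian e L (e x) (coordVec e x v) = L ⟨x, v⟩ := by
  have h1 := (coordEquiv he hx).symm_apply_apply v
  rw [coordEquiv_symm_apply, coordEquiv_apply] at h1
  unfold coordLagrangian
  have h2 := e.left_inv hx
  rw [h1]
  congr 1
  rw [h2]

theorem fderiv_coordLagrangian {e : OpenPartialHomeomorph M 𝔼} (he : e ∈ smoothCharts m M) {x : M}
    (hx : x ∈ e.source) (L : TangentBundle (𝓡 (m + 1)) M → ℝ) (v w : TangentSpace (𝓡 (m + 1)) x) :
    vertDeriv L x v w = fderiv ℝ (coordLagrangian e L (e x)) (coordVec e x v) (coordVec e x w) := by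
  have h1 : (fun w : TangentSpace (𝓡 (m + 1)) x => L ⟨x, w⟩) =
    coordLagrangian e L (e x) ∘ coordEquiv he hx := by
    ext v; exact (coordLagrangian_coordVec he hx L v).symm
  unfold vertDeriv
  rw [h1]
  -- The chain rule is stated on the model space, with which the tangent space coincides by
  -- definition.
  have key : ∀ (i : 𝔼 ≃L[ℝ] 𝔼) (f : 𝔼 → ℝ) (v w : 𝔼), fderiv ℝ (f ∘ i) v w = fderiv ℝ f (i v) (i w) :=
    fun i f v w => by rw [i.comp_right_fderiv]; rfl
  exact key (coordEquiv he hx) (coordLagrangian e L (e x)) v w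

/-- The parametrization of `TM` by the coordinates induced by `e`. -/
noncomputable def coordParam (e : OpenPartialHomeomorph M 𝔼) (ξ : 𝔼 × 𝔼) : TangentBundle (𝓡 (m + 1)) M :=
  ⟨e.symm ξ.1, mfderiv (𝓡 (m + 1)) (𝓡 (m + 1)) e.symm ξ.1 ξ.2⟩

/-- Over the model space the tangent bundle is a product. This identification and its inverse carry
manifold smoothness on `TM` to ordinary smoothness on pairs (position, velocity). -/
theorem contMDiff_modelProd_symm :
    ContMDiff 𝓘(ℝ, 𝔼 × 𝔼) (𝓡 (m + 1)).tangent 1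
      (fun ξ : 𝔼 × 𝔼 => (⟨ξ.1, ξ.2⟩ : TangentBundle (𝓡 (m + 1)) 𝔼)) := by
  have h := contMDiff_tangentBundleModelSpaceHomeomorph_symm (n := 1) (I := 𝓡 (m + 1))
  rw [modelWithCornersSelf_prod]
  exact h

theorem contMDiff_modelProd :
    ContMDiff (𝓡 (m + 1)).tangent 𝓘(ℝ, 𝔼 × 𝔼) 1
      (fun ξ : TangentBundle (𝓡 (m + 1)) 𝔼 => ((ξ.1, ξ.2) : 𝔼 × 𝔼)) := by
  have h := contMDiff_tangentBundleModelSpaceHomeomorph (n := 1) (I := 𝓡 (m + 1))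
  rw [modelWithCornersSelf_prod]
  exact h

/-- The parametrization is the tangent map of `e.symm`, one order less smooth than the chart. -/
theorem contMDiffOn_coordParam {e : OpenPartialHomeomorph M 𝔼} (he : e ∈ smoothCharts m M) :
    ContMDiffOn 𝓘(ℝ, 𝔼 × 𝔼) (𝓡 (m + 1)).tangent 1 (coordParam e) (e.target ×ˢ univ) := by
  have h1 := (contMDiffOn_symm_of_mem_maximalAtlas he).contMDiffOn_tangentMapWithin
    (m := 1) one_add_one_le_infty e.open_target.uniqueMDiffOn
  refine (h1.comp (contMDiff_modelProd_symm.contMDiffOn (s := e.target ×ˢ univ))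
    fun ξ hξ => hξ.1).congr fun ξ hξ => ?_
  simp only [coordParam, Function.comp_apply, tangentMapWithin]
  rw [mfderivWithin_of_isOpen e.open_target hξ.1]

theorem contDiffOn_coordLagrangian {e : OpenPartialHomeomorph M 𝔼} (he : e ∈ smoothCharts m M)
    {L : TangentBundle (𝓡 (m + 1)) M → ℝ} (hL : ContMDiff (𝓡 (m + 1)).tangent 𝓘(ℝ, ℝ) 1 L) :
    ContDiffOn ℝ 1 (Function.uncurry (coordLagrangian e L)) (e.target ×ˢ univ) :=
  contMDiffOn_iff_contDiffOn.1 (hL.comp_contMDiffOn (contMDiffOn_coordParam he))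

/-- The vector field `K` in the coordinates `e`. -/
noncomputable def coordField (e : OpenPartialHomeomorph M 𝔼)
    (K : ∀ x : M, TangentSpace (𝓡 (m + 1)) x) (y : 𝔼) :
    𝔼 :=
  coordVec e (e.symm y) (K (e.symm y))

/-- The one-form `Q` in the coordinates `e`. -/
noncomputable def coordForm (e : OpenPartialHomeomorph M 𝔼)
    (Q : ∀ x : M, TangentSpace (𝓡 (m + 1)) x →L[ℝ] ℝ) (y : 𝔼) : 𝔼 →L[ℝ] ℝ :=
  (Q (e.symm y)).comp ((mfderiv (𝓡 (m + 1)) (𝓡 (m + 1)) e.symm y).comp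
    ((NormedSpace.fromTangentSpace (𝕜 := ℝ) y).symm : 𝔼 →L[ℝ] _))

/-- A one-form is a Lagrangian linear in the velocity, so the results on Lagrangians in coordinates
apply to it. -/
theorem coordForm_apply (e : OpenPartialHomeomorph M 𝔼)
    (Q : ∀ x : M, TangentSpace (𝓡 (m + 1)) x →L[ℝ] ℝ) (y u : 𝔼) :
    coordForm e Q y u = coordLagrangian e (fun ξ => Q ξ.proj ξ.snd) y u := rfl

theorem coordForm_coordVec {e : OpenPartialHomeomorph M 𝔼} (he : e ∈ smoothCharts m M) {x : M}
    (hx : x ∈ e.source) (Q : ∀ x : M, TangentSpace (𝓡 (m + 1)) x →L[ℝ] ℝ)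
    (v : TangentSpace (𝓡 (m + 1)) x) : coordForm e Q (e x) (coordVec e x v) = Q x v := by
  rw [coordForm_apply, coordLagrangian_coordVec he hx]

theorem coordField_apply {e : OpenPartialHomeomorph M 𝔼} {x : M} (hx : x ∈ e.source)
    (K : ∀ x : M, TangentSpace (𝓡 (m + 1)) x) : coordField e K (e x) = coordVec e x (K x) := by
  unfold coordField
  rw [e.left_inv hx]

theorem contDiffOn_coordField {e : OpenPartialHomeomorph M 𝔼} (he : e ∈ smoothCharts m M)
    {K : ∀ x : M, TangentSpace (𝓡 (m + 1)) x}
    (hK : ContMDiff (𝓡 (m + 1)) (𝓡 (m + 1)).tangent 1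
      (fun x => (⟨x, K x⟩ : TangentBundle (𝓡 (m + 1)) M))) :
    ContDiffOn ℝ 1 (coordField e K) e.target := by
  have h1 := (contMDiffOn_of_mem_maximalAtlas he).contMDiffOn_tangentMapWithin
    (m := 1) one_add_one_le_infty e.open_source.uniqueMDiffOn
  have h2 : ContMDiffOn (𝓡 (m + 1)) (𝓡 (m + 1)) 1 e.symm e.target :=
    (contMDiffOn_symm_of_mem_maximalAtlas he).of_le (by simp)
  have h3 := contMDiff_modelProd.comp_contMDiffOn (h1.comp (hK.comp_contMDiffOn h2)
    fun y hy => e.map_target hy)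
  refine (contMDiffOn_iff_contDiffOn.1 h3).snd.congr fun y hy => ?_
  simp only [Function.comp_apply, tangentMapWithin]
  rw [mfderivWithin_of_isOpen e.open_source (e.map_target hy)]
  rfl

theorem contDiffOn_comp_symm {e : OpenPartialHomeomorph M 𝔼} (he : e ∈ smoothCharts m M)
    {d : M → ℝ} (hd : ContMDiff (𝓡 (m + 1)) 𝓘(ℝ, ℝ) 1 d) :
    ContDiffOn ℝ 1 (d ∘ e.symm) e.target :=
  contMDiffOn_iff_contDiffOn.1 (hd.comp_contMDiffOn
    ((contMDiffOn_symm_of_mem_maximalAtlas he).of_le (by simp)))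

theorem coordLagrangian_convexLagrangian {e : OpenPartialHomeomorph M 𝔼}
    (he : e ∈ smoothCharts m M) (L : TangentBundle (𝓡 (m + 1)) M → ℝ)
    (K : ∀ x : M, TangentSpace (𝓡 (m + 1)) x) (Q : ∀ x : M, TangentSpace (𝓡 (m + 1)) x →L[ℝ] ℝ)
    {y : 𝔼} (hy : y ∈ e.target) (u : 𝔼) :
    coordLagrangian e (convexLagrangian L K Q) y u =
      coordLagrangian e L y u - coordForm e Q y u ^ 2 / coordForm e Q y (coordField e K y) := by
  have h := coordForm_coordVec he (e.map_target hy) Q (K (e.symm y))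
  rw [e.right_inv hy] at h
  rw [coordField, h]
  rfl

end Charts

end SymLagrangian

namespace SymLagrangian

set_option linter.unusedSectionVars false

/-! ### Velocities of curves in a chart. -/

section Velocity

variable {m : ℕ} {M : Type*} [TopologicalSpace M]
  [ChartedSpace (EuclideanSpace ℝ (Fin (m + 1))) M] [IsManifold (𝓡 (m + 1)) ∞ M]

local notation "𝔼" => EuclideanSpace ℝ (Fin (m + 1))

theorem hasDerivWithinAt_chart_comp {e : OpenPartialHomeomorph M 𝔼} (he : e ∈ smoothCharts m M)
    {z : ℝ → M} {s : ℝ} (hzs : z s ∈ e.source)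
    (hz : MDifferentiableWithinAt 𝓘(ℝ, ℝ) (𝓡 (m + 1)) z (Icc 0 1) s) :
    HasDerivWithinAt (e ∘ z) (coordVec e (z s) (velocity m z s)) (Icc 0 1) s := by
  have h1 := ((chart_mdifferentiable he).mdifferentiableAt hzs).hasMFDerivAt.comp_hasMFDerivWithinAt
    s hz.hasMFDerivWithinAt
  let D : ℝ →L[ℝ] 𝔼 := (mfderiv (𝓡 (m + 1)) (𝓡 (m + 1)) e (z s)).comp
    (mfderivWithin 𝓘(ℝ, ℝ) (𝓡 (m + 1)) z (Icc 0 1) s)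
  have h2 : HasFDerivWithinAt (e ∘ z) D (Icc 0 1) s := hasMFDerivWithinAt_iff_hasFDerivWithinAt.1 h1
  exact h2.hasDerivWithinAt

theorem mdifferentiableWithinAt_of_chart {e : OpenPartialHomeomorph M 𝔼}
    (he : e ∈ smoothCharts m M) {z : ℝ → M} {s : ℝ} {I : Set ℝ} (hzs : z s ∈ e.source)
    (hzc : ContinuousWithinAt z I s) (hz : DifferentiableWithinAt ℝ (e ∘ z) I s) :
    MDifferentiableWithinAt 𝓘(ℝ, ℝ) (𝓡 (m + 1)) z I s := by
  have h1 : MDifferentiableWithinAt 𝓘(ℝ, ℝ) (𝓡 (m + 1)) (e ∘ z) I s :=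
    hz.mdifferentiableWithinAt
  have h2 : MDifferentiableWithinAt 𝓘(ℝ, ℝ) (𝓡 (m + 1)) (e.symm ∘ (e ∘ z)) I s :=
    ((chart_mdifferentiable he).mdifferentiableAt_symm (e.map_source hzs)).comp_mdifferentiableWithinAt
      s h1
  refine h2.congr_of_eventuallyEq ?_ ?_
  · filter_upwards [hzc (e.open_source.mem_nhds hzs)] with t ht
    exact (e.left_inv ht).symm
  · exact (e.left_inv hzs).symm

theorem coordVec_velocity {e : OpenPartialHomeomorph M 𝔼} (he : e ∈ smoothCharts m M)
    {z : ℝ → M} {s : ℝ} {u : 𝔼} (hs : s ∈ Icc (0 : ℝ) 1) (hzs : z s ∈ e.source)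
    (hzc : ContinuousWithinAt z (Icc 0 1) s) (hu : HasDerivWithinAt (e ∘ z) u (Icc 0 1) s) :
    coordVec e (z s) (velocity m z s) = u := by
  have h1 := hasDerivWithinAt_chart_comp he hzs
    (mdifferentiableWithinAt_of_chart he hzs hzc hu.differentiableWithinAt)
  exact (uniqueDiffOn_Icc zero_lt_one s hs).eq_deriv _ h1 hu

end Velocity

/-! ### Local comparison of the Riemannian and Euclidean structures. -/

section Riemannian

variable {m : ℕ} {M : Type*} [MetricSpace M]
  [ChartedSpace (EuclideanSpace ℝ (Fin (m + 1))) M] [IsManifold (𝓡 (m + 1)) ∞ M]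
  [RiemannianBundle (fun x : M => TangentSpace (𝓡 (m + 1)) x)]
  [IsContinuousRiemannianBundle (EuclideanSpace ℝ (Fin (m + 1)))
    (fun x : M => TangentSpace (𝓡 (m + 1)) x)]

local notation "𝔼" => EuclideanSpace ℝ (Fin (m + 1))

theorem continuousOn_norm_coordParam {e : OpenPartialHomeomorph M 𝔼} (he : e ∈ smoothCharts m M) :
    ContinuousOn (fun ξ : 𝔼 × 𝔼 => ‖(coordParam e ξ).2‖) (e.target ×ˢ univ) := by
  have h := (contMDiffOn_coordParam he).continuousOn
  have h2 := ContinuousOn.inner_bundle (F := 𝔼) (E := fun x : M => TangentSpace (𝓡 (m + 1)) x)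
    (b := fun ξ => (coordParam e ξ).1) (v := fun ξ => (coordParam e ξ).2)
    (w := fun ξ => (coordParam e ξ).2) h h
  refine (Real.continuous_sqrt.comp_continuousOn h2).congr fun ξ _ => ?_
  exact norm_eq_sqrt_real_inner _

/-- The Riemannian norm is locally comparable to the Euclidean norm in the coordinates `e`. -/
theorem exists_norm_comparison {e : OpenPartialHomeomorph M 𝔼} (he : e ∈ smoothCharts m M) {y₀ : 𝔼}
    (hy₀ : y₀ ∈ e.target) :
    ∃ c > (0 : ℝ), ∃ C > (0 : ℝ), ∃ r > (0 : ℝ), Metric.ball y₀ r ⊆ e.target ∧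
      ∀ x ∈ e.source, e x ∈ Metric.ball y₀ r → ∀ v : TangentSpace (𝓡 (m + 1)) x,
        c * ‖coordVec e x v‖ ≤ ‖v‖ ∧ ‖v‖ ≤ C * ‖coordVec e x v‖ := by
  obtain ⟨r, hr, hrt⟩ := Metric.nhds_basis_closedBall.mem_iff.1 (e.open_target.mem_nhds hy₀)
  -- By homogeneity it is enough to bound the Riemannian norm and its inverse on Euclidean unit
  -- vectors, which over a closed ball form a compact set.
  have hK : IsCompact (Metric.closedBall y₀ r ×ˢ Metric.sphere (0 : 𝔼) 1) :=
    (isCompact_closedBall _ _).prod (isCompact_sphere _ _)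
  have hN : ContinuousOn (fun ξ : 𝔼 × 𝔼 => ‖(coordParam e ξ).2‖)
      (Metric.closedBall y₀ r ×ˢ Metric.sphere (0 : 𝔼) 1) :=
    (continuousOn_norm_coordParam he).mono (prod_mono hrt (subset_univ _))
  have hsymm : ∀ x (hx : x ∈ e.source) (u : 𝔼),
      ‖(coordParam e (e x, u)).2‖ = ‖(coordEquiv he hx).symm u‖ := by
    intro x hx u
    rw [coordEquiv_symm_apply, coordParam]
    dsimp only
    rw [e.left_inv hx]
  have hpos : ∀ ξ ∈ Metric.closedBall y₀ r ×ˢ Metric.sphere (0 : 𝔼) 1,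
      ‖(coordParam e ξ).2‖ ≠ 0 := by
    rintro ⟨y, u⟩ ⟨hy, hu⟩ h0
    have hyt := hrt hy
    have h1 := hsymm (e.symm y) (e.map_target hyt) u
    rw [e.right_inv hyt, h0] at h1
    have h2 := norm_eq_zero.1 h1.symm
    rw [map_eq_zero_iff _ (coordEquiv he (e.map_target hyt)).symm.injective] at h2
    simp [h2] at hu
  obtain ⟨C₁, hC₁⟩ := hK.exists_bound_of_continuousOn hN
  obtain ⟨C₂, hC₂⟩ := hK.exists_bound_of_continuousOn (hN.inv₀ hpos)
  refine ⟨(max C₂ 1)⁻¹, by positivity, max C₁ 1, by positivity, r, hr,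
    Metric.ball_subset_closedBall.trans hrt, fun x hx hxr v => ?_⟩
  set u := coordVec e x v with hu
  have hv : v = (coordEquiv he hx).symm u := ((coordEquiv he hx).symm_apply_apply v).symm
  rcases eq_or_ne u 0 with h0 | h0
  · rw [hv, h0, map_zero, norm_zero, norm_zero]; simp
  have hu0 : 0 < ‖u‖ := norm_pos_iff.2 h0
  have hmem : (e x, ‖u‖⁻¹ • u) ∈ Metric.closedBall y₀ r ×ˢ Metric.sphere (0 : 𝔼) 1 :=
    ⟨Metric.ball_subset_closedBall hxr, by simp [norm_smul, hu0.ne']⟩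
  have hscale : ‖(coordParam e (e x, ‖u‖⁻¹ • u)).2‖ = ‖u‖⁻¹ * ‖v‖ := by
    rw [hsymm x hx, map_smul, ← hv, norm_smul, norm_inv, norm_norm]
  have b1 := (le_abs_self _).trans (hC₁ _ hmem)
  have b2 := (le_abs_self _).trans (hC₂ _ hmem)
  have hp := hpos _ hmem
  rw [Pi.inv_apply] at b2
  rw [hscale] at b1 b2 hp
  have hv0 : 0 < ‖v‖ := lt_of_le_of_ne (norm_nonneg v) fun h => hp (by rw [← h, mul_zero])
  constructor
  · have h3 : (‖u‖⁻¹ * ‖v‖)⁻¹ ≤ max C₂ 1 := b2.trans (le_max_left _ _)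
    rw [mul_inv, inv_inv, ← div_eq_mul_inv, div_le_iff₀ hv0] at h3
    rwa [inv_mul_le_iff₀ (by positivity)]
  · have h3 : ‖u‖⁻¹ * ‖v‖ ≤ max C₁ 1 := b1.trans (le_max_left _ _)
    rwa [inv_mul_le_iff₀ hu0, mul_comm] at h3

variable [IsRiemannianManifold (𝓡 (m + 1)) M]

/-- The inverse of a chart is locally Lipschitz for the Riemannian distance. -/
theorem exists_dist_symm_le {e : OpenPartialHomeomorph M 𝔼} (he : e ∈ smoothCharts m M) {y₀ : 𝔼}
    (hy₀ : y₀ ∈ e.target) :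
    ∃ C > (0 : ℝ), ∃ r > (0 : ℝ), Metric.ball y₀ r ⊆ e.target ∧
      ∀ y ∈ Metric.ball y₀ r, ∀ y' ∈ Metric.ball y₀ r,
        dist (e.symm y) (e.symm y') ≤ C * dist y y' := by
  obtain ⟨c, -, C, hC, r, hr, hrt, hcmp⟩ := exists_norm_comparison he hy₀
  refine ⟨C, hC, r, hr, hrt, fun y hy y' hy' => ?_⟩
  -- The distance is at most the length of the image of the coordinate segment, which stays in the
  -- ball by convexity.
  let η : ℝ → 𝔼 := fun t => y + t • (y' - y)
  have hη : ∀ t ∈ Icc (0 : ℝ) 1, η t ∈ Metric.ball y₀ r := fun t ht =>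
    (convex_ball y₀ r).add_smul_sub_mem hy hy' ht
  have hηd : ∀ t, HasDerivAt η (y' - y) t := fun t => by
    have h := ((hasDerivAt_id t).smul_const (y' - y)).const_add y
    rw [one_smul] at h
    exact h
  have hηs : ContDiff ℝ 1 η := contDiff_const.add (contDiff_id.smul contDiff_const)
  let γ : ℝ → M := e.symm ∘ η
  have hγ : ContMDiffOn 𝓘(ℝ, ℝ) (𝓡 (m + 1)) 1 γ (Icc 0 1) :=
    ((contMDiffOn_symm_of_mem_maximalAtlas he).of_le (by simp)).comp
      hηs.contMDiff.contMDiffOn fun t ht => hrt (hη t ht)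
  have hle := riemannianEDist_le_pathELength (I := 𝓡 (m + 1)) hγ rfl rfl zero_le_one
  rw [← IsRiemannianManifold.out (I := 𝓡 (m + 1)), pathELength_eq_lintegral_mfderivWithin_Icc] at hle
  have hvel : ∀ t ∈ Icc (0 : ℝ) 1, ‖velocity m γ t‖ₑ ≤ ENNReal.ofReal (C * dist y y') := by
    intro t ht
    have hsrc : γ t ∈ e.source := e.map_target (hrt (hη t ht))
    have hr' : ∀ s ∈ Icc (0 : ℝ) 1, (e ∘ γ) s = η s := fun s hs => e.right_inv (hrt (hη s hs))
    have h1 : HasDerivWithinAt (e ∘ γ) (y' - y) (Icc 0 1) t :=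
      (hηd t).hasDerivWithinAt.congr hr' (hr' t ht)
    have h2 := coordVec_velocity he ht hsrc (hγ.continuousOn t ht) h1
    have h3 := (hcmp (γ t) hsrc (by rw [← Function.comp_apply (f := e), hr' t ht]; exact hη t ht)
      (velocity m γ t)).2
    rw [h2, ← dist_eq_norm, dist_comm] at h3
    rw [← ofReal_norm]
    exact ENNReal.ofReal_le_ofReal h3
  have h4 : edist (γ 0) (γ 1) ≤ ENNReal.ofReal (C * dist y y') := by
    refine hle.trans ((setLIntegral_mono' measurableSet_Icc hvel).trans_eq ?_)
    simp
  rw [edist_dist, ENNReal.ofReal_le_ofReal_iff (by positivity)] at h4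
  simpa [γ, η] using h4

/-- A chart is locally Lipschitz for the Riemannian distance. -/
theorem exists_dist_chart_le {e : OpenPartialHomeomorph M 𝔼} (he : e ∈ smoothCharts m M) {x₀ : M}
    (hx₀ : x₀ ∈ e.source) :
    ∃ C > (0 : ℝ), ∃ ρ > (0 : ℝ), Metric.ball x₀ ρ ⊆ e.source ∧
      ∀ x ∈ Metric.ball x₀ ρ, ∀ x' ∈ Metric.ball x₀ ρ, dist (e x) (e x') ≤ C * dist x x' := by
  obtain ⟨c, hc, C, -, r, hr, hrt, hcmp⟩ := exists_norm_comparison he (e.map_source hx₀)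
  have hnhds : e.source ∩ e ⁻¹' Metric.ball (e x₀) r ∈ 𝓝 x₀ :=
    inter_mem (e.open_source.mem_nhds hx₀)
      ((e.continuousAt hx₀).preimage_mem_nhds (Metric.ball_mem_nhds _ hr))
  obtain ⟨R, hR, hRs⟩ := Metric.mem_nhds_iff.1 hnhds
  -- Two points of the ball of radius R/3 are less than 2R/3 apart, and a path of length below 2R/3
  -- starting in that ball stays in the ball of radius `R`, where the norms are comparable.
  refine ⟨c⁻¹, by positivity, R / 3, by positivity,
    (Metric.ball_subset_ball (by linarith)).trans fun x hx => (hRs hx).1, fun x hx x' hx' => ?_⟩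
  rw [Metric.mem_ball] at hx hx'
  have hxx' : dist x x' < 2 * R / 3 := by
    have := dist_triangle_right x x' x₀; linarith
  -- it suffices to bound by the length of a path
  suffices h : ∀ d, dist x x' < d → d < 2 * R / 3 → dist (e x) (e x') ≤ c⁻¹ * d by
    have h2 : ∀ᶠ d in 𝓝[>] (dist x x'), dist (e x) (e x') ≤ c⁻¹ * d := by
      filter_upwards [Ioo_mem_nhdsGT hxx'] with d hd using h d hd.1 hd.2
    have h3 : Tendsto (fun d => c⁻¹ * d) (𝓝[>] (dist x x')) (𝓝 (c⁻¹ * dist x x')) :=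
      ((continuous_const.mul continuous_id).tendsto _).mono_left nhdsWithin_le_nhds
    exact ge_of_tendsto h3 h2
  intro d hd hdR
  have hd0 : 0 < d := dist_nonneg.trans_lt hd
  have hed : riemannianEDist (𝓡 (m + 1)) x x' < ENNReal.ofReal d := by
    rw [← IsRiemannianManifold.out (I := 𝓡 (m + 1)), edist_dist]
    exact (ENNReal.ofReal_lt_ofReal_iff hd0).2 hd
  obtain ⟨γ, hγ0, hγ1, hγ, hlen⟩ := exists_lt_of_riemannianEDist_lt hed
  have hmem : ∀ t ∈ Icc (0 : ℝ) 1, γ t ∈ Metric.ball x₀ R := by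
    intro t ht
    have h1 := riemannianEDist_le_pathELength (I := 𝓡 (m + 1))
      (hγ.mono (Icc_subset_Icc_right ht.2)) hγ0 rfl ht.1
    have h2 := (h1.trans (pathELength_mono le_rfl ht.2)).trans_lt hlen
    rw [← IsRiemannianManifold.out (I := 𝓡 (m + 1)), edist_dist,
      ENNReal.ofReal_lt_ofReal_iff hd0, dist_comm] at h2
    rw [Metric.mem_ball]
    have := dist_triangle (γ t) x x₀; linarith
  have hsrc : ∀ t ∈ Icc (0 : ℝ) 1, γ t ∈ e.source := fun t ht => (hRs (hmem t ht)).1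
  have hf : ContDiffOn ℝ 1 (e ∘ γ) (Icc 0 1) := contMDiffOn_iff_contDiffOn.1
    (((contMDiffOn_of_mem_maximalAtlas he).of_le (by simp)).comp hγ hsrc)
  have hder : ∀ t ∈ Icc (0 : ℝ) 1,
      derivWithin (e ∘ γ) (Icc 0 1) t = coordVec e (γ t) (velocity m γ t) := fun t ht =>
    (hasDerivWithinAt_chart_comp he (hsrc t ht) ((hγ t ht).mdifferentiableWithinAt
      one_ne_zero)).derivWithin (uniqueDiffOn_Icc zero_lt_one t ht)
  have hcont : ContinuousOn (derivWithin (e ∘ γ) (Icc 0 1)) (Icc 0 1) :=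
    hf.continuousOn_derivWithin (uniqueDiffOn_Icc zero_lt_one) le_rfl
  have hftc := sub_eq_integral_of_ae_hasDerivAt (f := e ∘ γ) (g := derivWithin (e ∘ γ) (Icc 0 1))
    (a := 0) (b := 1) (by
      rw [← uIcc_of_le (zero_le_one (α := ℝ))] at hf
      exact hf.absolutelyContinuousOnInterval)
    (by rw [← uIcc_of_le (zero_le_one (α := ℝ))] at hcont ⊢; exact hcont.intervalIntegrable)
    (by
      have h0 : ∀ᵐ t : ℝ, t ≠ 0 := by simp [ae_iff]
      have h1 : ∀ᵐ t : ℝ, t ≠ 1 := by simp [ae_iff]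
      filter_upwards [h0, h1] with t ht0 ht1 ht
      rw [uIcc_of_le zero_le_one] at ht
      exact ((hf.differentiableOn one_ne_zero t ht).hasDerivWithinAt).hasDerivAt
        (Icc_mem_nhds (lt_of_le_of_ne ht.1 ht0.symm) (lt_of_le_of_ne ht.2 ht1))) 1 right_mem_uIcc
  have hbound : edist (e x) (e x') ≤ ENNReal.ofReal c⁻¹ * ENNReal.ofReal d := by
    rw [edist_comm, edist_eq_enorm_sub, ← hγ0, ← hγ1]
    rw [Function.comp_apply, Function.comp_apply] at hftc
    rw [hftc, intervalIntegral.integral_of_le zero_le_one]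
    refine (enorm_integral_le_lintegral_enorm _).trans ?_
    rw [restrict_Ioc_eq_restrict_Icc]
    refine le_trans ?_ (mul_le_mul_right hlen.le _)
    rw [pathELength_eq_lintegral_mfderivWithin_Icc, ← lintegral_const_mul' _ _ ENNReal.ofReal_ne_top]
    refine setLIntegral_mono' measurableSet_Icc fun t ht => ?_
    have h1 := (hcmp (γ t) (hsrc t ht) (hRs (hmem t ht)).2 (velocity m γ t)).1
    change _ ≤ _ * ‖velocity m γ t‖ₑ
    rw [hder t ht, ← ofReal_norm, ← ofReal_norm (velocity m γ t),
      ← ENNReal.ofReal_mul (by positivity)]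
    refine ENNReal.ofReal_le_ofReal ?_
    rwa [le_inv_mul_iff₀ hc]
  rw [edist_dist, ← ENNReal.ofReal_mul (by positivity),
    ENNReal.ofReal_le_ofReal_iff (by positivity)] at hbound
  exact hbound

end Riemannian

end SymLagrangian

namespace SymLagrangian

/-! ### Growth of functions homogeneous of degree two in the velocity. -/

section Homogeneous

variable {E : Type*} [NormedAddCommGroup E] [NormedSpace ℝ E] [FiniteDimensional ℝ E]

/-- Growth of a function that is homogeneous of degree two in the second variable. -/
theorem exists_growth_of_homogeneous {G : E → E → ℝ} {U : Set E} (hU : IsOpen U)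
    (hG : ContDiffOn ℝ 1 (Function.uncurry G) (U ×ˢ univ))
    (hhom : ∀ y u (t : ℝ), G y (t • u) = t ^ 2 * G y u) {y₀ : E} (hy₀ : y₀ ∈ U) :
    ∃ r > (0 : ℝ), ∃ C > (0 : ℝ), Metric.ball y₀ r ⊆ U ∧ ∀ y ∈ Metric.ball y₀ r, ∀ u,
      |G y u| ≤ C * (‖u‖ ^ 2 + 1) ∧ ‖fderiv ℝ (Function.uncurry G) (y, u)‖ ≤ C * (‖u‖ ^ 2 + 1) := by
  have := FiniteDimensional.proper ℝ E
  obtain ⟨r, hr, hrU⟩ := Metric.nhds_basis_closedBall.mem_iff.1 (hU.mem_nhds hy₀)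
  have hK : IsCompact (Metric.closedBall y₀ r ×ˢ Metric.closedBall (0 : E) 1) :=
    (isCompact_closedBall _ _).prod (isCompact_closedBall _ _)
  have hKU : Metric.closedBall y₀ r ×ˢ Metric.closedBall (0 : E) 1 ⊆ U ×ˢ univ :=
    prod_mono hrU (subset_univ _)
  obtain ⟨C₁, hC₁⟩ := hK.exists_bound_of_continuousOn (hG.continuousOn.mono hKU)
  obtain ⟨C₂, hC₂⟩ := hK.exists_bound_of_continuousOn
    ((continuousOn_fderiv_uncurry hU hG).mono hKU)
  set C := max (max C₁ C₂) 1 with hC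
  have hC0 : 0 < C := by positivity
  have h1C : C₁ ≤ C := (le_max_left _ _).trans (le_max_left _ _)
  have h2C : C₂ ≤ C := (le_max_right _ _).trans (le_max_left _ _)
  refine ⟨r, hr, C, hC0, Metric.ball_subset_closedBall.trans hrU, fun y hy u => ?_⟩
  have hyc := Metric.ball_subset_closedBall hy
  have hu2 : 0 ≤ ‖u‖ ^ 2 := sq_nonneg _
  -- Compactness handles the velocities in the unit ball; the others are rescaled to the unit
  -- sphere.
  rcases le_total ‖u‖ 1 with hu | hu
  · have hmem : (y, u) ∈ Metric.closedBall y₀ r ×ˢ Metric.closedBall (0 : E) 1 :=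
      ⟨hyc, by simpa using hu⟩
    exact ⟨((hC₁ _ hmem).trans h1C).trans (by nlinarith),
      ((hC₂ _ hmem).trans h2C).trans (by nlinarith)⟩
  · have hu0 : 0 < ‖u‖ := zero_lt_one.trans_le hu
    set t := ‖u‖⁻¹ with ht
    have ht1 : t ≤ 1 := inv_le_one_of_one_le₀ hu
    have ht0 : 0 < t := by positivity
    have hmem : (y, t • u) ∈ Metric.closedBall y₀ r ×ˢ Metric.closedBall (0 : E) 1 :=
      ⟨hyc, by simp [norm_smul, ht, hu0.ne']⟩
    have htt : ‖u‖ ^ 2 * t ^ 2 = 1 := by rw [ht]; field_simp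
    constructor
    · have h := hC₁ _ hmem
      rw [Function.uncurry_apply_pair, hhom, norm_mul, norm_pow, Real.norm_eq_abs, Real.norm_eq_abs,
        abs_of_pos ht0] at h
      calc |G y u| = ‖u‖ ^ 2 * (t ^ 2 * |G y u|) := by rw [← mul_assoc, htt, one_mul]
        _ ≤ ‖u‖ ^ 2 * C := mul_le_mul_of_nonneg_left (h.trans h1C) hu2
        _ ≤ C * (‖u‖ ^ 2 + 1) := by nlinarith
    · let Φ : E × E →L[ℝ] E × E :=
        (ContinuousLinearMap.fst ℝ E E).prod (t • ContinuousLinearMap.snd ℝ E E)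
      have hΦ : ‖Φ‖ ≤ 1 := by
        refine ContinuousLinearMap.opNorm_le_bound _ zero_le_one fun ξ => ?_
        rw [one_mul]
        refine max_le (norm_fst_le ξ) ?_
        change ‖t • ξ.2‖ ≤ ‖ξ‖
        rw [norm_smul, Real.norm_eq_abs, abs_of_pos ht0]
        exact (mul_le_of_le_one_left (norm_nonneg _) ht1).trans (norm_snd_le ξ)
      have heq : Function.uncurry G = fun ξ => ‖u‖ ^ 2 * Function.uncurry G (Φ ξ) := by
        ext ⟨a, b⟩
        change G a b = ‖u‖ ^ 2 * G a (t • b)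
        rw [hhom, ← mul_assoc, htt, one_mul]
      have hd : HasFDerivAt (Function.uncurry G)
          (‖u‖ ^ 2 • (fderiv ℝ (Function.uncurry G) (y, t • u)).comp Φ) (y, u) := by
        have h1 := (hasStrictFDerivAt_uncurry hU hG (hrU hyc) (t • u)).hasFDerivAt
        have h2 := (HasFDerivAt.comp (f := Φ) (y, u) h1 Φ.hasFDerivAt).const_mul (‖u‖ ^ 2)
        rw [heq]
        exact heq ▸ h2
      rw [hd.fderiv, norm_smul, norm_pow, norm_norm]
      have h3 : ‖(fderiv ℝ (Function.uncurry G) (y, t • u)).comp Φ‖ ≤ C :=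
        (ContinuousLinearMap.opNorm_comp_le _ _).trans
          ((mul_le_of_le_one_right (norm_nonneg _) hΦ).trans ((hC₂ _ hmem).trans h2C))
      calc _ ≤ ‖u‖ ^ 2 * C := mul_le_mul_of_nonneg_left h3 hu2
        _ ≤ C * (‖u‖ ^ 2 + 1) := by nlinarith

end Homogeneous

/-! ### The hypotheses on the Lagrangian in a chart. -/

section LocalAssumptions

set_option linter.unusedSectionVars false

variable {m : ℕ} {M : Type*} [MetricSpace M]
  [ChartedSpace (EuclideanSpace ℝ (Fin (m + 1))) M] [IsManifold (𝓡 (m + 1)) ∞ M]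
  [RiemannianBundle (fun x : M => TangentSpace (𝓡 (m + 1)) x)]
  [IsContinuousRiemannianBundle (EuclideanSpace ℝ (Fin (m + 1)))
    (fun x : M => TangentSpace (𝓡 (m + 1)) x)]

local notation "𝔼" => EuclideanSpace ℝ (Fin (m + 1))

variable {L : TangentBundle (𝓡 (m + 1)) M → ℝ} {K : ∀ x : M, TangentSpace (𝓡 (m + 1)) x}
  {Q : ∀ x : M, TangentSpace (𝓡 (m + 1)) x →L[ℝ] ℝ} {d : M → ℝ}

theorem coordForm_coordField_neg (hL : SymmetryAssumption L K Q d)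
    {e : OpenPartialHomeomorph M 𝔼} (he : e ∈ smoothCharts m M) {y : 𝔼} (hy : y ∈ e.target) :
    coordForm e Q y (coordField e K y) < 0 := by
  have h := coordForm_coordVec he (e.map_target hy) Q (K (e.symm y))
  rw [e.right_inv hy] at h
  rw [coordField, h]
  exact hL.neg _

theorem contDiffOn_coordForm (hL : SymmetryAssumption L K Q d)
    {e : OpenPartialHomeomorph M 𝔼} (he : e ∈ smoothCharts m M) :
    ContDiffOn ℝ 1 (Function.uncurry fun y u => coordForm e Q y u) (e.target ×ˢ univ) :=
  contDiffOn_coordLagrangian he hL.contMDiff_Q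

/-- The quadratic correction `Q(v)² / Q(K)` in coordinates. -/
noncomputable def coordQuadratic (e : OpenPartialHomeomorph M 𝔼)
    (K : ∀ x : M, TangentSpace (𝓡 (m + 1)) x)
    (Q : ∀ x : M, TangentSpace (𝓡 (m + 1)) x →L[ℝ] ℝ) (y u : 𝔼) : ℝ :=
  coordForm e Q y u ^ 2 / coordForm e Q y (coordField e K y)

theorem contDiffOn_coordQuadratic (hL : SymmetryAssumption L K Q d)
    {e : OpenPartialHomeomorph M 𝔼} (he : e ∈ smoothCharts m M) :
    ContDiffOn ℝ 1 (Function.uncurry (coordQuadratic e K Q)) (e.target ×ˢ univ) := by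
  have hq := contDiffOn_coordForm hL he
  have hk : ContDiffOn ℝ 1 (fun ξ : 𝔼 × 𝔼 => (ξ.1, coordField e K ξ.1)) (e.target ×ˢ univ) :=
    contDiffOn_fst.prodMk ((contDiffOn_coordField he hL.contMDiff_K).comp contDiffOn_fst
      fun ξ hξ => hξ.1)
  exact (hq.pow 2).div (hq.comp hk fun ξ hξ => ⟨hξ.1, mem_univ _⟩)
    fun ξ hξ => (coordForm_coordField_neg hL he hξ.1).ne

theorem uncurry_coordLagrangian_eqOn {e : OpenPartialHomeomorph M 𝔼}
    (he : e ∈ smoothCharts m M) : EqOn (Function.uncurry (coordLagrangian e (convexLagrangian L K Q)))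
      (Function.uncurry (coordLagrangian e L) - Function.uncurry (coordQuadratic e K Q))
      (e.target ×ˢ univ) :=
  fun ξ hξ => coordLagrangian_convexLagrangian he L K Q hξ.1 ξ.2

theorem contDiffOn_coord_convexLagrangian (hL : SymmetryAssumption L K Q d)
    {e : OpenPartialHomeomorph M 𝔼} (he : e ∈ smoothCharts m M) :
    ContDiffOn ℝ 1 (Function.uncurry (coordLagrangian e (convexLagrangian L K Q)))
      (e.target ×ˢ univ) :=
  ((contDiffOn_coordLagrangian he hL.contMDiff_L).sub (contDiffOn_coordQuadratic hL he)).congr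
    (uncurry_coordLagrangian_eqOn he)

theorem fderiv_coord_convexLagrangian (hL : SymmetryAssumption L K Q d)
    {e : OpenPartialHomeomorph M 𝔼} (he : e ∈ smoothCharts m M) {y : 𝔼} (hy : y ∈ e.target)
    (u w : 𝔼) :
    fderiv ℝ (coordLagrangian e (convexLagrangian L K Q) y) u w =
      fderiv ℝ (coordLagrangian e L y) u w -
        2 * coordForm e Q y u * coordForm e Q y w / coordForm e Q y (coordField e K y) := by
  have h1 := (hasFDerivAt_right e.open_target (contDiffOn_coordLagrangian he hL.contMDiff_L) hy
    u).differentiableAt.hasFDerivAt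
  have h2 := (((coordForm e Q y).hasFDerivAt (x := u)).pow 2).mul_const
    (coordForm e Q y (coordField e K y))⁻¹
  have h3 : coordLagrangian e (convexLagrangian L K Q) y = fun u =>
      coordLagrangian e L y u -
        coordForm e Q y u ^ 2 * (coordForm e Q y (coordField e K y))⁻¹ := by
    ext u
    rw [coordLagrangian_convexLagrangian he L K Q hy u, div_eq_mul_inv]
  have h4 := h1.sub h2
  rw [h3]
  refine (congrArg (fun T : 𝔼 →L[ℝ] ℝ => T w) (HasFDerivAt.fderiv h4)).trans ?_
  simp only [sub_apply, smul_apply, smul_eq_mul, nsmul_eq_mul, Nat.cast_ofNat]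
  ring

/-- By continuity the convexity constant stays above half its value at the centre, and replacing the
Riemannian norm by the Euclidean one costs the factor `c ^ 2`. Any smooth chart will do here. -/
theorem exists_isCoordSymLagrangian (hL : SymmetryAssumption L K Q d)
    (hLc : GrowthAssumption (convexLagrangian L K Q)) {e : OpenPartialHomeomorph M 𝔼}
    (he : e ∈ smoothCharts m M) {y₀ : 𝔼} (hy₀ : y₀ ∈ e.target) :
    ∃ r > (0 : ℝ), Metric.ball y₀ r ⊆ e.target ∧ ∃ lam, IsCoordSymLagrangian (Metric.ball y₀ r)
      (coordLagrangian e L) (coordField e K) (coordForm e Q) (d ∘ e.symm) lam := by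
  obtain ⟨Lam, hLamc, hLam0, hLam⟩ := hLc.convex
  obtain ⟨c, hc, C, hC, r₁, hr₁, hr₁t, hcmp⟩ := exists_norm_comparison he hy₀
  have hl0 := hLam0 (e.symm y₀)
  have hcont : ContinuousAt (fun y => Lam (e.symm y)) y₀ :=
    hLamc.continuousAt.comp (e.continuousAt_symm hy₀)
  have hev : ∀ᶠ y in 𝓝 y₀, Lam (e.symm y₀) / 2 < Lam (e.symm y) :=
    hcont.eventually (lt_mem_nhds (half_lt_self hl0))
  obtain ⟨r₂, hr₂, hr₂l⟩ := Metric.eventually_nhds_iff_ball.1 hev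
  have hsub : Metric.ball y₀ (min r₁ r₂) ⊆ e.target :=
    (Metric.ball_subset_ball (min_le_left _ _)).trans hr₁t
  have hsub' : Metric.ball y₀ (min r₁ r₂) ×ˢ (univ : Set 𝔼) ⊆ e.target ×ˢ univ :=
    prod_mono hsub Subset.rfl
  refine ⟨min r₁ r₂, lt_min hr₁ hr₂, hsub, Lam (e.symm y₀) / 2 * c ^ 2, ?_⟩
  exact
    { isOpen := Metric.isOpen_ball
      contDiffOn_F := (contDiffOn_coordLagrangian he hL.contMDiff_L).mono hsub'
      contDiffOn_k := (contDiffOn_coordField he hL.contMDiff_K).mono hsub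
      contDiffOn_q := (contDiffOn_coordForm hL he).mono hsub'
      contDiffOn_δ := (contDiffOn_comp_symm he hL.contMDiff_d).mono hsub
      noether := by
        intro y hy u
        have hys := e.map_target (hsub hy)
        have h1 := hL.noether (e.symm y) ((coordEquiv he hys).symm u)
        rw [fderiv_coordLagrangian he hys, ← coordForm_coordVec he hys, ← coordField_apply hys,
          ← coordEquiv_apply he hys, ContinuousLinearEquiv.apply_symm_apply,
          e.right_inv (hsub hy)] at h1
        exact h1
      neg := fun y hy => coordForm_coordField_neg hL he (hsub hy)
      pos := by positivity
      convex := by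
        intro y hy u v
        have hyt := hsub hy
        have hys := e.map_target hyt
        have hmem : e (e.symm y) ∈ Metric.ball y₀ r₁ := by
          rw [e.right_inv hyt]; exact Metric.ball_subset_ball (min_le_left _ _) hy
        have h1 := hLam (e.symm y) ((coordEquiv he hys).symm u) ((coordEquiv he hys).symm v)
        have h2 := (hcmp _ hys hmem
          ((coordEquiv he hys).symm v - (coordEquiv he hys).symm u)).1
        rw [sub_apply, fderiv_coordLagrangian he hys, fderiv_coordLagrangian he hys] at h1
        rw [← coordEquiv_apply he hys] at h2
        simp only [← coordEquiv_apply he hys] at h1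
        rw [map_sub, ContinuousLinearEquiv.apply_symm_apply,
          ContinuousLinearEquiv.apply_symm_apply] at h1 h2
        rw [e.right_inv hyt, fderiv_coord_convexLagrangian hL he hyt,
          fderiv_coord_convexLagrangian hL he hyt] at h1
        have h3 := hr₂l y (Metric.ball_subset_ball (min_le_right _ _) hy)
        have h4 : (c * ‖v - u‖) ^ 2 ≤
            ‖(coordEquiv he hys).symm v - (coordEquiv he hys).symm u‖ ^ 2 :=
          pow_le_pow_left₀ (by positivity) h2 2
        have h5 : Lam (e.symm y₀) / 2 * c ^ 2 * ‖v - u‖ ^ 2 ≤ Lam (e.symm y) *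
            ‖(coordEquiv he hys).symm v - (coordEquiv he hys).symm u‖ ^ 2 := by
          rw [mul_assoc, ← mul_pow]
          exact mul_le_mul h3.le h4 (by positivity) (hLam0 _).le
        refine (h5.trans h1).trans_eq ?_
        simp only [sub_apply, map_sub]
        ring }

/-- Quadratic growth of the Lagrangian and of its derivative, in a chart where the growth
conditions hold. -/
theorem exists_growth_coordLagrangian (hL : SymmetryAssumption L K Q d)
    {e : OpenPartialHomeomorph M 𝔼} (he : e ∈ smoothCharts m M) {C : M → ℝ} (hC : Continuous C)
    (hC0 : ∀ x, 0 < C x)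
    (hhoriz : ∀ x ∈ e.source, ∀ v w : TangentSpace (𝓡 (m + 1)) x,
      |horizDeriv e (convexLagrangian L K Q) x v w| ≤ C x * (‖v‖ ^ 2 + 1) * ‖w‖)
    (hvert : ∀ (x : M) (v : TangentSpace (𝓡 (m + 1)) x),
      ‖vertDeriv (convexLagrangian L K Q) x v‖ ≤ C x * (‖v‖ + 1))
    {y₀ : 𝔼} (hy₀ : y₀ ∈ e.target) :
    ∃ r > (0 : ℝ), ∃ A > (0 : ℝ), Metric.ball y₀ r ⊆ e.target ∧ ∀ y ∈ Metric.ball y₀ r, ∀ u,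
      |coordLagrangian e L y u| ≤ A * (‖u‖ ^ 2 + 1) ∧
      ‖fderiv ℝ (Function.uncurry (coordLagrangian e L)) (y, u)‖ ≤ A * (‖u‖ ^ 2 + 1) := by
  -- The correction Q²/Q(K) is homogeneous of degree two, so its growth is automatic; the assumed
  -- bounds concern the convex part.
  obtain ⟨r₁, hr₁, A₁, hA₁, hr₁t, hquad⟩ := exists_growth_of_homogeneous e.open_target
    (contDiffOn_coordQuadratic hL he) (fun y u t => by
      simp only [coordQuadratic, map_smul, smul_eq_mul]; ring) hy₀
  obtain ⟨c, -, N, hN, r₂, hr₂, hr₂t, hcmp⟩ := exists_norm_comparison he hy₀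
  have hFc := contDiffOn_coord_convexLagrangian hL he
  have hF := contDiffOn_coordLagrangian he hL.contMDiff_L
  -- bounds on the coefficients near `y₀`
  have hev : ∀ᶠ y in 𝓝 y₀, C (e.symm y) < C (e.symm y₀) + 1 :=
    (hC.continuousAt.comp (e.continuousAt_symm hy₀) :
      ContinuousAt (fun y => C (e.symm y)) y₀).eventually (gt_mem_nhds (lt_add_one _))
  -- The value at velocity zero together with the vertical derivative bounds the convex part on both
  -- sides.
  have hzero : ContinuousAt (fun y => |coordLagrangian e (convexLagrangian L K Q) y 0|) y₀ := by
    have h1 : ContinuousAt (Function.uncurry (coordLagrangian e (convexLagrangian L K Q))) (y₀, 0) :=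
      hFc.continuousOn.continuousAt ((e.open_target.prod isOpen_univ).mem_nhds ⟨hy₀, mem_univ _⟩)
    exact (ContinuousAt.comp (f := fun y : 𝔼 => (y, (0 : 𝔼))) h1
      (continuousAt_id.prodMk continuousAt_const)).abs
  obtain ⟨r₃, hr₃, hr₃b⟩ := Metric.eventually_nhds_iff_ball.1
    (hev.and (hzero.eventually (gt_mem_nhds (lt_add_one _))))
  set A₂ := C (e.symm y₀) + 1 with hA₂
  set A₃ := |coordLagrangian e (convexLagrangian L K Q) y₀ 0| + 1 with hA₃
  have hA₂0 : 0 < A₂ := by have := hC0 (e.symm y₀); positivity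
  have hA₃0 : 0 < A₃ := by positivity
  set r := min r₁ (min r₂ r₃) with hr
  have hrt : Metric.ball y₀ r ⊆ e.target := (Metric.ball_subset_ball (min_le_left _ _)).trans hr₁t
  -- vertical and horizontal derivatives of the convex part
  have hV : ∀ y ∈ Metric.ball y₀ r, ∀ u,
      ‖fderiv ℝ (coordLagrangian e (convexLagrangian L K Q) y) u‖ ≤ A₂ * (N * ‖u‖ + 1) * N := by
    intro y hy u
    have hys := e.map_target (hrt hy)
    have hmem : e (e.symm y) ∈ Metric.ball y₀ r₂ := by
      rw [e.right_inv (hrt hy)]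
      exact Metric.ball_subset_ball ((min_le_right _ _).trans (min_le_left _ _)) hy
    have hCy := (hr₃b y (Metric.ball_subset_ball
      ((min_le_right _ _).trans (min_le_right _ _)) hy)).1
    refine ContinuousLinearMap.opNorm_le_bound _ (by positivity) fun w => ?_
    have h1 := fderiv_coordLagrangian he hys (convexLagrangian L K Q)
      ((coordEquiv he hys).symm u) ((coordEquiv he hys).symm w)
    have h2 := (hcmp _ hys hmem ((coordEquiv he hys).symm u)).2
    have h3 := (hcmp _ hys hmem ((coordEquiv he hys).symm w)).2
    rw [← coordEquiv_apply he hys, ContinuousLinearEquiv.apply_symm_apply] at h2 h3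
    rw [← coordEquiv_apply he hys, ← coordEquiv_apply he hys,
      ContinuousLinearEquiv.apply_symm_apply, ContinuousLinearEquiv.apply_symm_apply,
      e.right_inv (hrt hy)] at h1
    rw [← h1]
    refine (ContinuousLinearMap.le_opNorm _ _).trans ?_
    rw [mul_assoc]
    refine mul_le_mul ((hvert _ _).trans ?_) h3 (norm_nonneg _) (by positivity)
    exact mul_le_mul hCy.le (by linarith) (by positivity) hA₂0.le
  have hH : ∀ y ∈ Metric.ball y₀ r, ∀ u,
      ‖fderiv ℝ (fun y => coordLagrangian e (convexLagrangian L K Q) y u) y‖ ≤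
        A₂ * ((N * ‖u‖) ^ 2 + 1) * N := by
    intro y hy u
    have hys := e.map_target (hrt hy)
    have hmem : e (e.symm y) ∈ Metric.ball y₀ r₂ := by
      rw [e.right_inv (hrt hy)]
      exact Metric.ball_subset_ball ((min_le_right _ _).trans (min_le_left _ _)) hy
    have hCy := (hr₃b y (Metric.ball_subset_ball
      ((min_le_right _ _).trans (min_le_right _ _)) hy)).1
    refine ContinuousLinearMap.opNorm_le_bound _ (by positivity) fun w => ?_
    have h1 := hhoriz _ hys ((coordEquiv he hys).symm u) ((coordEquiv he hys).symm w)
    have h2 := (hcmp _ hys hmem ((coordEquiv he hys).symm u)).2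
    have h3 := (hcmp _ hys hmem ((coordEquiv he hys).symm w)).2
    rw [← coordEquiv_apply he hys, ContinuousLinearEquiv.apply_symm_apply] at h2 h3
    rw [horizDeriv, ← coordEquiv_apply he hys, ← coordEquiv_apply he hys,
      ContinuousLinearEquiv.apply_symm_apply, ContinuousLinearEquiv.apply_symm_apply,
      e.right_inv (hrt hy)] at h1
    refine h1.trans ?_
    rw [mul_assoc (A₂ * _)]
    refine mul_le_mul ?_ h3 (norm_nonneg _) (by positivity)
    have h4 := pow_le_pow_left₀ (norm_nonneg _) h2 2
    exact mul_le_mul hCy.le (by linarith) (by positivity) hA₂0.le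
  -- The summands account for the value at velocity zero, the mean value inequality in the velocity,
  -- the horizontal derivative, the vertical derivative and the quadratic correction.
  set A := A₃ + 2 * A₂ * N * (N + 1) + A₂ * (N ^ 2 + 1) * N + A₂ * (N + 1) * N + A₁ with hA
  refine ⟨r, by positivity, A, by positivity, hrt, fun y hy u => ?_⟩
  have hy₁ := Metric.ball_subset_ball (min_le_left _ _) hy
  have hu : ‖u‖ ≤ ‖u‖ ^ 2 + 1 := by nlinarith [sq_nonneg (‖u‖ - 1), norm_nonneg u]
  have hu1 : 0 ≤ ‖u‖ ^ 2 := sq_nonneg _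
  have hu0 := norm_nonneg u
  constructor
  · have h1 : coordLagrangian e L y u = coordLagrangian e (convexLagrangian L K Q) y u +
        coordQuadratic e K Q y u := by
      rw [coordLagrangian_convexLagrangian he L K Q (hrt hy), coordQuadratic]; ring
    have h2 : |coordLagrangian e (convexLagrangian L K Q) y u -
        coordLagrangian e (convexLagrangian L K Q) y 0| ≤ A₂ * (N * ‖u‖ + 1) * N * ‖u‖ := by
      have h := (convex_closedBall (0 : 𝔼) ‖u‖).norm_image_sub_le_of_norm_hasFDerivWithin_le
        (f := coordLagrangian e (convexLagrangian L K Q) y)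
        (f' := fderiv ℝ (coordLagrangian e (convexLagrangian L K Q) y))
        (C := A₂ * (N * ‖u‖ + 1) * N) (x := 0) (y := u)
        (fun x _ => (hasFDerivAt_right e.open_target hFc (hrt hy)
          x).differentiableAt.hasFDerivAt.hasFDerivWithinAt)
        (fun x hx => (hV y hy x).trans (by
          have : ‖x‖ ≤ ‖u‖ := by simpa using hx
          gcongr)) (by simp) (by simp)
      simpa using h
    have h3 := (hr₃b y (Metric.ball_subset_ball
      ((min_le_right _ _).trans (min_le_right _ _)) hy)).2
    have h4 := (hquad y hy₁ u).1
    have h5 : A₂ * (N * ‖u‖ + 1) * N * ‖u‖ ≤ 2 * A₂ * N * (N + 1) * (‖u‖ ^ 2 + 1) := by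
      have h6 : (N * ‖u‖ + 1) * ‖u‖ ≤ (N + 1) * (‖u‖ ^ 2 + 1) := by nlinarith
      have h7 : 0 ≤ A₂ * N := by positivity
      have h8 := mul_le_mul_of_nonneg_left h6 h7
      have h9 : 0 ≤ A₂ * N * ((N + 1) * (‖u‖ ^ 2 + 1)) := by positivity
      linarith
    rw [h1]
    have h10 : |coordLagrangian e (convexLagrangian L K Q) y u| ≤
        A₂ * (N * ‖u‖ + 1) * N * ‖u‖ + A₃ := by
      have := abs_sub_abs_le_abs_sub (coordLagrangian e (convexLagrangian L K Q) y u)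
        (coordLagrangian e (convexLagrangian L K Q) y 0)
      linarith
    have h11 : 0 ≤ A₂ * (N ^ 2 + 1) * N * (‖u‖ ^ 2 + 1) := by positivity
    have h12 : 0 ≤ A₂ * (N + 1) * N * (‖u‖ ^ 2 + 1) := by positivity
    have h13 : A₃ ≤ A₃ * (‖u‖ ^ 2 + 1) := by nlinarith
    refine (abs_add_le _ _).trans ?_
    rw [hA]
    linarith
  · have hd : fderiv ℝ (Function.uncurry (coordLagrangian e L)) (y, u) =
        fderiv ℝ (Function.uncurry (coordLagrangian e (convexLagrangian L K Q))) (y, u) +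
          fderiv ℝ (Function.uncurry (coordQuadratic e K Q)) (y, u) := by
      have h1 := (hasStrictFDerivAt_uncurry e.open_target hFc (hrt hy) u).hasFDerivAt.add
        (hasStrictFDerivAt_uncurry e.open_target (contDiffOn_coordQuadratic hL he) (hrt hy)
          u).hasFDerivAt
      refine (h1.congr_of_eventuallyEq ?_).fderiv
      filter_upwards [(e.open_target.prod isOpen_univ).mem_nhds
        (⟨hrt hy, mem_univ u⟩ : (y, u) ∈ e.target ×ˢ univ)] with ξ hξ
      have := uncurry_coordLagrangian_eqOn (L := L) (K := K) (Q := Q) he hξ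
      rw [Pi.add_apply, this, Pi.sub_apply]; ring
    rw [hd]
    refine (norm_add_le _ _).trans ?_
    have h1 := norm_fderiv_uncurry_le e.open_target hFc (hrt hy) u
    have h2 := hV y hy u
    have h3 := hH y hy u
    have h4 := (hquad y hy₁ u).2
    have h5 : A₂ * (N * ‖u‖ + 1) * N ≤ A₂ * (N + 1) * N * (‖u‖ ^ 2 + 1) := by
      have h6 : N * ‖u‖ + 1 ≤ (N + 1) * (‖u‖ ^ 2 + 1) := by nlinarith
      have h7 : 0 ≤ A₂ * N := by positivity
      nlinarith [mul_le_mul_of_nonneg_left h6 h7]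
    have h6 : A₂ * ((N * ‖u‖) ^ 2 + 1) * N ≤ A₂ * (N ^ 2 + 1) * N * (‖u‖ ^ 2 + 1) := by
      have h6 : (N * ‖u‖) ^ 2 + 1 ≤ (N ^ 2 + 1) * (‖u‖ ^ 2 + 1) := by nlinarith [sq_nonneg N]
      have h7 : 0 ≤ A₂ * N := by positivity
      nlinarith [mul_le_mul_of_nonneg_left h6 h7]
    have h7 : 0 ≤ 2 * A₂ * N * (N + 1) * (‖u‖ ^ 2 + 1) := by positivity
    have h8 : 0 ≤ A₃ * (‖u‖ ^ 2 + 1) := by positivity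
    rw [hA]
    linarith

end LocalAssumptions

end SymLagrangian

namespace SymLagrangian

/-! ### Arcs of a path contained in one chart. -/

section Arcs

set_option linter.unusedSectionVars false

variable {m : ℕ} {M : Type*} [MetricSpace M]
  [ChartedSpace (EuclideanSpace ℝ (Fin (m + 1))) M] [IsManifold (𝓡 (m + 1)) ∞ M]
  [RiemannianBundle (fun x : M => TangentSpace (𝓡 (m + 1)) x)]

local notation "𝔼" => EuclideanSpace ℝ (Fin (m + 1))

/-- On the ball `ball y₀ r` in the coordinates `e`, the Riemannian distance and norms are
comparable to the Euclidean ones. -/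
structure IsComparisonBall (e : OpenPartialHomeomorph M (EuclideanSpace ℝ (Fin (m + 1))))
    (y₀ : EuclideanSpace ℝ (Fin (m + 1))) (r C : ℝ) : Prop where
  mem_charts : e ∈ smoothCharts m M
  pos : 0 < C
  subset : Metric.ball y₀ r ⊆ e.target
  dist_symm : ∀ y ∈ Metric.ball y₀ r, ∀ y' ∈ Metric.ball y₀ r,
    dist (e.symm y) (e.symm y') ≤ C * dist y y'
  dist_le : ∀ y ∈ Metric.ball y₀ r, ∀ y' ∈ Metric.ball y₀ r,
    dist y y' ≤ C * dist (e.symm y) (e.symm y')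
  norm_le : ∀ x ∈ e.source, e x ∈ Metric.ball y₀ r → ∀ v : TangentSpace (𝓡 (m + 1)) x,
    ‖coordVec e x v‖ ≤ C * ‖v‖ ∧ ‖v‖ ≤ C * ‖coordVec e x v‖

theorem IsComparisonBall.mono {e : OpenPartialHomeomorph M 𝔼} {y₀ : 𝔼} {r r' C : ℝ}
    (h : IsComparisonBall e y₀ r C) (hr : r' ≤ r) : IsComparisonBall e y₀ r' C :=
  have hsub := Metric.ball_subset_ball (x := y₀) hr
  { mem_charts := h.mem_charts
    pos := h.pos
    subset := hsub.trans h.subset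
    dist_symm := fun y hy y' hy' => h.dist_symm y (hsub hy) y' (hsub hy')
    dist_le := fun y hy y' hy' => h.dist_le y (hsub hy) y' (hsub hy')
    norm_le := fun x hx hxr => h.norm_le x hx (hsub hxr) }

theorem exists_isComparisonBall
    [IsContinuousRiemannianBundle (EuclideanSpace ℝ (Fin (m + 1)))
      (fun x : M => TangentSpace (𝓡 (m + 1)) x)] [IsRiemannianManifold (𝓡 (m + 1)) M]
    {e : OpenPartialHomeomorph M 𝔼} (he : e ∈ smoothCharts m M) {y₀ : 𝔼} (hy₀ : y₀ ∈ e.target) :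
    ∃ r > (0 : ℝ), ∃ C, IsComparisonBall e y₀ r C := by
  obtain ⟨c, hc, C₁, hC₁, r₁, hr₁, hr₁t, hnorm⟩ := exists_norm_comparison he hy₀
  obtain ⟨C₂, hC₂, r₂, hr₂, hr₂t, hsymm⟩ := exists_dist_symm_le he hy₀
  obtain ⟨C₃, hC₃, ρ, hρ, hρs, hdist⟩ := exists_dist_chart_le he (e.map_target hy₀)
  obtain ⟨r₃, hr₃, hr₃b⟩ := Metric.mem_nhds_iff.1
    ((e.continuousAt_symm hy₀).preimage_mem_nhds (Metric.ball_mem_nhds _ hρ))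
  set C := C₁ + C₂ + C₃ + c⁻¹ with hC
  have hci : 0 < c⁻¹ := by positivity
  have hs₁ : Metric.ball y₀ (min r₁ (min r₂ r₃)) ⊆ Metric.ball y₀ r₁ :=
    Metric.ball_subset_ball (min_le_left _ _)
  have hs₂ : Metric.ball y₀ (min r₁ (min r₂ r₃)) ⊆ Metric.ball y₀ r₂ :=
    Metric.ball_subset_ball ((min_le_right _ _).trans (min_le_left _ _))
  have hs₃ : Metric.ball y₀ (min r₁ (min r₂ r₃)) ⊆ Metric.ball y₀ r₃ :=
    Metric.ball_subset_ball ((min_le_right _ _).trans (min_le_right _ _))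
  refine ⟨min r₁ (min r₂ r₃), by positivity, C, ?_⟩
  exact
    { mem_charts := he
      pos := by positivity
      subset := hs₁.trans hr₁t
      dist_symm := fun y hy y' hy' => (hsymm y (hs₂ hy) y' (hs₂ hy')).trans
        (mul_le_mul_of_nonneg_right (by linarith) dist_nonneg)
      dist_le := fun y hy y' hy' => by
        have h := hdist _ (hr₃b (hs₃ hy)) _ (hr₃b (hs₃ hy'))
        rw [e.right_inv (hr₁t (hs₁ hy)), e.right_inv (hr₁t (hs₁ hy'))] at h
        exact h.trans (mul_le_mul_of_nonneg_right (by linarith) dist_nonneg)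
      norm_le := fun x hx hxr v => by
        obtain ⟨h1, h2⟩ := hnorm x hx (hs₁ hxr) v
        refine ⟨?_, h2.trans (mul_le_mul_of_nonneg_right (by linarith) (norm_nonneg _))⟩
        have h3 : ‖coordVec e x v‖ ≤ c⁻¹ * ‖v‖ := by rwa [le_inv_mul_iff₀ hc]
        exact h3.trans (mul_le_mul_of_nonneg_right (by linarith) (norm_nonneg _)) }

/-- The arc of `z` over `[a, b]` lies in a comparison ball. -/
structure IsChartedArc (e : OpenPartialHomeomorph M (EuclideanSpace ℝ (Fin (m + 1))))
    (y₀ : EuclideanSpace ℝ (Fin (m + 1))) (r C : ℝ) (z : ℝ → M) (a b : ℝ) : Prop where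
  ball : IsComparisonBall e y₀ r C
  lt : a < b
  subset : Icc a b ⊆ Icc 0 1
  mem_source : ∀ s ∈ Icc a b, z s ∈ e.source
  mem_ball : ∀ s ∈ Icc a b, e (z s) ∈ Metric.ball y₀ r

/-- The interval of radius η/2 about `s₀` is cut off at 0 and 1, so that at an endpoint it is
one-sided but still a neighbourhood within `[0, 1]`. -/
theorem exists_Icc_subset {X : Type*} [TopologicalSpace X] {z : ℝ → X}
    (hz : ContinuousOn z (Icc 0 1)) {s₀ : ℝ} (hs₀ : s₀ ∈ Icc (0 : ℝ) 1) {O : Set X} (hO : O ∈ 𝓝 (z s₀)) :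
    ∃ a b : ℝ, a < b ∧ Icc a b ⊆ Icc 0 1 ∧ Icc a b ∈ 𝓝[Icc 0 1] s₀ ∧ ∀ s ∈ Icc a b, z s ∈ O := by
  obtain ⟨η, hη, hηO⟩ := Metric.mem_nhdsWithin_iff.1 (hz s₀ hs₀ hO)
  refine ⟨max 0 (s₀ - η / 2), min 1 (s₀ + η / 2), ?_, ?_, ?_, ?_⟩
  · rw [max_lt_iff, lt_min_iff, lt_min_iff]
    have := hs₀.1; have := hs₀.2
    refine ⟨⟨?_, ?_⟩, ?_, ?_⟩ <;> linarith
  · exact Icc_subset_Icc (le_max_left _ _) (min_le_left _ _)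
  · refine Metric.mem_nhdsWithin_iff.2 ⟨η / 2, by positivity, fun s hs => ?_⟩
    have h1 := hs.1
    rw [Metric.mem_ball, Real.dist_eq, abs_lt] at h1
    exact ⟨max_le hs.2.1 (by linarith), le_min hs.2.2 (by linarith)⟩
  · intro s hs
    have h1 := (le_max_right _ _).trans hs.1
    have h2 := hs.2.trans (min_le_right _ _)
    have h3 := (le_max_left _ _).trans hs.1
    have h4 := hs.2.trans (min_le_left _ _)
    refine hηO ⟨?_, h3, h4⟩
    rw [Metric.mem_ball, Real.dist_eq, abs_lt]
    constructor <;> linarith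

theorem exists_isChartedArc {e : OpenPartialHomeomorph M 𝔼} {z : ℝ → M}
    (hz : ContinuousOn z (Icc 0 1)) {s₀ : ℝ} (hs₀ : s₀ ∈ Icc (0 : ℝ) 1) (hzs : z s₀ ∈ e.source)
    {r C : ℝ} (hr : 0 < r) (h : IsComparisonBall e (e (z s₀)) r C) :
    ∃ a b : ℝ, IsChartedArc e (e (z s₀)) r C z a b ∧ Icc a b ∈ 𝓝[Icc 0 1] s₀ := by
  have hO : e.source ∩ e ⁻¹' Metric.ball (e (z s₀)) r ∈ 𝓝 (z s₀) :=
    inter_mem (e.open_source.mem_nhds hzs)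
      ((e.continuousAt hzs).preimage_mem_nhds (Metric.ball_mem_nhds _ hr))
  obtain ⟨a, b, hab, hsub, hnhds, hmem⟩ := exists_Icc_subset hz hs₀ hO
  exact ⟨a, b, ⟨h, hab, hsub, fun s hs => (hmem s hs).1, fun s hs => (hmem s hs).2⟩, hnhds⟩

theorem continuousOn_of_absolutelyContinuousOnInterval {z : ℝ → M}
    (hz : AbsolutelyContinuousOnInterval z 0 1) : ContinuousOn z (Icc 0 1) := by
  have hu : UniformContinuousOn z (uIcc 0 1) := by
    rw [Metric.uniformContinuousOn_iff]
    intro ε hε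
    obtain ⟨δ, hδ, h⟩ := (absolutelyContinuousOnInterval_iff z 0 1).1 hz ε hε
    refine ⟨δ, hδ, fun x hx y hy hxy => ?_⟩
    have := h (1, fun _ => (x, y)) ⟨fun i _ => ⟨hx, hy⟩, by simp⟩ (by simpa using hxy)
    simpa using this
  rw [← uIcc_of_le (zero_le_one (α := ℝ))]
  exact hu.continuousOn

theorem IsPath.continuousOn {p q : M} {z : ℝ → M} (hz : IsPath m p q z) :
    ContinuousOn z (Icc 0 1) :=
  continuousOn_of_absolutelyContinuousOnInterval hz.absolutelyContinuous

/-- The two velocities belong to fibres over points that are only provably equal, hence the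
formulation in the total space. -/
theorem mk_velocity_congr {z z' : ℝ → M} {s : ℝ} (h : z' =ᶠ[𝓝 s] z) :
    (⟨z' s, velocity m z' s⟩ : TangentBundle (𝓡 (m + 1)) M) = ⟨z s, velocity m z s⟩ := by
  have h1 : z' =ᶠ[𝓝[Icc 0 1] s] z := h.filter_mono nhdsWithin_le_nhds
  have h2 : (velocity m z' s : 𝔼) = (velocity m z s : 𝔼) :=
    DFunLike.congr_fun (h1.mfderivWithin_eq (I := 𝓘(ℝ, ℝ)) (I' := 𝓡 (m + 1)) h.self_of_nhds) (1 : ℝ)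
  refine TotalSpace.ext h.self_of_nhds ?_
  exact heq_of_eq h2

namespace IsChartedArc

variable {e : OpenPartialHomeomorph M (EuclideanSpace ℝ (Fin (m + 1)))}
  {y₀ : EuclideanSpace ℝ (Fin (m + 1))} {r C : ℝ} {z : ℝ → M} {a b : ℝ} {p q : M}

theorem dist_chart_le (h : IsChartedArc e y₀ r C z a b) {s t : ℝ} (hs : s ∈ Icc a b)
    (ht : t ∈ Icc a b) : dist (e (z s)) (e (z t)) ≤ C * dist (z s) (z t) := by
  have := h.ball.dist_le _ (h.mem_ball s hs) _ (h.mem_ball t ht)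
  rwa [e.left_inv (h.mem_source s hs), e.left_inv (h.mem_source t ht)] at this

theorem absolutelyContinuous (h : IsChartedArc e y₀ r C z a b) (hz : IsPath m p q z) :
    AbsolutelyContinuousOnInterval (e ∘ z) a b := by
  have hz' : AbsolutelyContinuousOnInterval z a b := hz.absolutelyContinuous.mono (by
    rw [uIcc_of_le h.lt.le, uIcc_of_le zero_le_one]; exact h.subset)
  refine absolutelyContinuousOnInterval_of_dist_le (C := C) hz' fun s hs t ht => ?_
  rw [uIcc_of_le h.lt.le] at hs ht
  refine (h.dist_chart_le hs ht).trans (mul_le_mul_of_nonneg_left ?_ h.ball.pos.le)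
  exact le_add_of_nonneg_right dist_nonneg

theorem continuousOn (h : IsChartedArc e y₀ r C z a b) (hz : IsPath m p q z) :
    ContinuousOn (e ∘ z) (Icc a b) :=
  e.continuousOn.comp (hz.continuousOn.mono h.subset) h.mem_source

theorem ae_hasDerivAt (h : IsChartedArc e y₀ r C z a b) (hz : IsPath m p q z) :
    ∀ᵐ s, s ∈ Ioo a b → HasDerivAt (e ∘ z) (deriv (e ∘ z) s) s := by
  filter_upwards [absolutelyContinuousOnInterval.ae_differentiableAt (h.absolutelyContinuous hz)]
    with s hs hsab
  refine (hs ?_).hasDerivAt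
  rw [uIcc_of_le h.lt.le]
  exact Ioo_subset_Icc_self hsab

theorem ae_coordVec_velocity (h : IsChartedArc e y₀ r C z a b) (hz : IsPath m p q z) :
    ∀ᵐ s, s ∈ Ioo a b → coordVec e (z s) (velocity m z s) = deriv (e ∘ z) s := by
  filter_upwards [h.ae_hasDerivAt hz] with s hs hsab
  have hsI := Ioo_subset_Icc_self hsab
  exact coordVec_velocity h.ball.mem_charts (h.subset hsI) (h.mem_source s hsI)
    (hz.continuousOn s (h.subset hsI)) (hs hsab).hasDerivWithinAt

theorem ae_lagrangian_eq (h : IsChartedArc e y₀ r C z a b) (hz : IsPath m p q z)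
    (L : TangentBundle (𝓡 (m + 1)) M → ℝ) : ∀ᵐ s, s ∈ Ioo a b →
      L ⟨z s, velocity m z s⟩ = coordLagrangian e L (e (z s)) (deriv (e ∘ z) s) := by
  filter_upwards [h.ae_coordVec_velocity hz] with s hs hsab
  rw [← hs hsab, coordLagrangian_coordVec h.ball.mem_charts
    (h.mem_source s (Ioo_subset_Icc_self hsab))]

theorem integrableOn_norm_deriv_sq (h : IsChartedArc e y₀ r C z a b) (hz : IsPath m p q z) :
    IntegrableOn (fun s => ‖deriv (e ∘ z) s‖ ^ 2) (Ioo a b) := by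
  refine ⟨((measurable_deriv _).norm.pow_const 2).aestronglyMeasurable, ?_⟩
  have hsub : Ioo a b ⊆ Icc 0 1 := Ioo_subset_Icc_self.trans h.subset
  have hle : ∫⁻ s in Ioo a b, ‖‖deriv (e ∘ z) s‖ ^ 2‖ₑ ≤
      ∫⁻ s in Ioo a b, ENNReal.ofReal C ^ 2 * ‖velocity m z s‖ₑ ^ 2 := by
    refine lintegral_mono_ae ?_
    rw [ae_restrict_iff' measurableSet_Ioo]
    filter_upwards [h.ae_coordVec_velocity hz] with s hs hsab
    have hsI := Ioo_subset_Icc_self hsab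
    have h1 := (h.ball.norm_le _ (h.mem_source s hsI) (h.mem_ball s hsI) (velocity m z s)).1
    rw [hs hsab] at h1
    rw [enorm_pow, enorm_norm, ← mul_pow, ← ofReal_norm, ← ofReal_norm (velocity m z s),
      ← ENNReal.ofReal_mul h.ball.pos.le]
    exact pow_le_pow_left₀ bot_le (ENNReal.ofReal_le_ofReal h1) 2
  refine hle.trans_lt ?_
  rw [lintegral_const_mul' _ _ (by simp)]
  exact ENNReal.mul_lt_top (by simp)
    ((lintegral_mono_set hsub).trans_lt hz.finiteEnergy)

end IsChartedArc

/-- The variation of `z` in the coordinates `e` in direction `w`. -/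
noncomputable def chartVariation (e : OpenPartialHomeomorph M (EuclideanSpace ℝ (Fin (m + 1))))
    (z : ℝ → M) (a b : ℝ) (w : ℝ → EuclideanSpace ℝ (Fin (m + 1))) (ε s : ℝ) : M :=
  open Classical in if s ∈ Icc a b then e.symm (e (z s) + ε • w s) else z s

/-! ### Variations of a path inside one chart. -/

section Variation

variable {e : OpenPartialHomeomorph M (EuclideanSpace ℝ (Fin (m + 1)))}
  {y₀ : EuclideanSpace ℝ (Fin (m + 1))} {r C : ℝ} {z : ℝ → M} {a b : ℝ} {p q : M}
  {w : ℝ → EuclideanSpace ℝ (Fin (m + 1))} {ε : ℝ}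

theorem chartVariation_of_mem {s : ℝ} (hs : s ∈ Icc a b) :
    chartVariation e z a b w ε s = e.symm (e (z s) + ε • w s) := if_pos hs

theorem chartVariation_of_eq_zero (h : IsChartedArc e y₀ r C z a b) {s : ℝ} (hs : w s = 0) :
    chartVariation e z a b w ε s = z s := by
  by_cases hsI : s ∈ Icc a b
  · rw [chartVariation_of_mem hsI, hs, smul_zero, add_zero, e.left_inv (h.mem_source s hsI)]
  · exact if_neg hsI

theorem chartVariation_zero (h : IsChartedArc e y₀ r C z a b) :
    chartVariation e z a b w 0 = z := by
  ext s
  by_cases hsI : s ∈ Icc a b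
  · rw [chartVariation_of_mem hsI, zero_smul, add_zero, e.left_inv (h.mem_source s hsI)]
  · exact if_neg hsI

/-- The coordinate arc is compact in an open ball, so some thickening of it stays in the ball, and
`w` is bounded on the arc. -/
theorem eventually_mem_ball (h : IsChartedArc e y₀ r C z a b) (hz : IsPath m p q z)
    (hw : Continuous w) :
    ∃ ε₀ > (0 : ℝ), ∀ ε : ℝ, |ε| < ε₀ → ∀ s ∈ Icc a b, e (z s) + ε • w s ∈ Metric.ball y₀ r := by
  obtain ⟨W, hW⟩ := isCompact_Icc.exists_bound_of_continuousOn (hw.continuousOn (s := Icc a b))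
  obtain ⟨δ, hδ, hδb⟩ := (isCompact_Icc.image_of_continuousOn
    (h.continuousOn hz)).exists_thickening_subset_open Metric.isOpen_ball
    (image_subset_iff.2 fun s hs => h.mem_ball s hs)
  refine ⟨δ / (|W| + 1), by positivity, fun ε hε s hs => hδb ?_⟩
  rw [Metric.mem_thickening_iff]
  refine ⟨e (z s), mem_image_of_mem _ hs, ?_⟩
  rw [dist_eq_norm, add_sub_cancel_left, norm_smul, Real.norm_eq_abs]
  rw [lt_div_iff₀ (by positivity)] at hε
  refine lt_of_le_of_lt (mul_le_mul_of_nonneg_left ?_ (abs_nonneg ε)) hε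
  exact (hW s hs).trans ((le_abs_self W).trans (by linarith))

/-- Pointwise properties of the variation, for parameters such that it stays in the ball. -/
structure IsSmallVariation (e : OpenPartialHomeomorph M (EuclideanSpace ℝ (Fin (m + 1))))
    (y₀ : EuclideanSpace ℝ (Fin (m + 1))) (r C : ℝ) (z : ℝ → M) (a b : ℝ) (p q : M)
    (w : ℝ → EuclideanSpace ℝ (Fin (m + 1))) (ε : ℝ) : Prop where
  arc : IsChartedArc e y₀ r C z a b
  path : IsPath m p q z
  smooth : ContDiff ℝ ∞ w
  compact : HasCompactSupport w
  support : tsupport w ⊆ Ioo a b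
  mem : ∀ s ∈ Icc a b, e (z s) + ε • w s ∈ Metric.ball y₀ r

namespace IsSmallVariation

theorem chart_comp (H : IsSmallVariation e y₀ r C z a b p q w ε) {s : ℝ} (hs : s ∈ Icc a b) :
    chartVariation e z a b w ε s ∈ e.source ∧
      e (chartVariation e z a b w ε s) = e (z s) + ε • w s := by
  have ht := H.arc.ball.subset (H.mem s hs)
  rw [chartVariation_of_mem hs]
  exact ⟨e.map_target ht, e.right_inv ht⟩

theorem eq_zero (H : IsSmallVariation e y₀ r C z a b p q w ε) {s : ℝ} (hs : s ∉ Ioo a b) :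
    w s = 0 :=
  image_eq_zero_of_notMem_tsupport fun h => hs (H.support h)

theorem dist_self_le (H : IsSmallVariation e y₀ r C z a b p q w ε) (s : ℝ) :
    dist (chartVariation e z a b w ε s) (z s) ≤ C * (|ε| * ‖w s‖) := by
  by_cases hs : s ∈ Icc a b
  · have h := H.arc.ball.dist_symm _ (H.mem s hs) _ (H.arc.mem_ball s hs)
    rwa [e.left_inv (H.arc.mem_source s hs), dist_eq_norm, add_sub_cancel_left, norm_smul,
      Real.norm_eq_abs, ← chartVariation_of_mem hs] at h
  · rw [chartVariation_of_eq_zero H.arc (H.eq_zero fun h => hs (Ioo_subset_Icc_self h)), dist_self]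
    have := H.arc.ball.pos
    positivity

theorem absolutelyContinuous (H : IsSmallVariation e y₀ r C z a b p q w ε) :
    AbsolutelyContinuousOnInterval (chartVariation e z a b w ε) 0 1 := by
  obtain ⟨Λ, hΛ⟩ := H.smooth.lipschitzWith_of_hasCompactSupport H.compact (by simp)
  have hC := H.arc.ball.pos
  -- `C * C` comes from the chart followed by its inverse, the second term from the Lipschitz
  -- constant of `w`, and `1` from the distance along `z` itself when one of the two points is not
  -- moved.
  set A : ℝ := C * C + C * |ε| * Λ + 1 with hA
  have hA0 : 0 ≤ C * C := by positivity
  have hA1 : 0 ≤ C * |ε| * Λ := by positivity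
  -- the case where one of the points is not moved
  have hout : ∀ s t : ℝ, w t = 0 → dist (chartVariation e z a b w ε s) (chartVariation e z a b w ε t)
      ≤ A * (dist (z s) (z t) + dist s t) := by
    intro s t ht
    rw [chartVariation_of_eq_zero H.arc ht]
    have h1 := H.dist_self_le s
    have h2 : ‖w s‖ ≤ Λ * dist s t := by
      have := hΛ.dist_le_mul s t
      rwa [ht, dist_zero_right] at this
    have h3 : C * (|ε| * ‖w s‖) ≤ C * |ε| * Λ * dist s t := by
      rw [mul_assoc, mul_assoc]
      exact mul_le_mul_of_nonneg_left (mul_le_mul_of_nonneg_left h2 (abs_nonneg _)) hC.le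
    have h4 := dist_triangle (chartVariation e z a b w ε s) (z s) (z t)
    have h5 := dist_nonneg (x := z s) (y := z t)
    have h6 := dist_nonneg (x := s) (y := t)
    rw [hA]; nlinarith
  refine absolutelyContinuousOnInterval_of_dist_le (C := A) H.path.absolutelyContinuous
    fun s _ t _ => ?_
  by_cases ht : t ∈ Icc a b
  · by_cases hs : s ∈ Icc a b
    · rw [chartVariation_of_mem hs, chartVariation_of_mem ht]
      have h1 := H.arc.ball.dist_symm _ (H.mem s hs) _ (H.mem t ht)
      have h2 := dist_add_add_le (e (z s)) (ε • w s) (e (z t)) (ε • w t)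
      have h3 := H.arc.dist_chart_le hs ht
      have h4 : dist (ε • w s) (ε • w t) ≤ |ε| * (Λ * dist s t) := by
        rw [dist_smul₀, Real.norm_eq_abs]
        exact mul_le_mul_of_nonneg_left (hΛ.dist_le_mul s t) (abs_nonneg _)
      have h5 := dist_nonneg (x := z s) (y := z t)
      have h6 := dist_nonneg (x := s) (y := t)
      have h7 : C * dist (e (z s) + ε • w s) (e (z t) + ε • w t) ≤
          C * (C * dist (z s) (z t) + |ε| * (Λ * dist s t)) :=
        mul_le_mul_of_nonneg_left (by linarith) hC.le
      rw [hA]; nlinarith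
    · rw [dist_comm, dist_comm (z s), dist_comm s]
      exact hout t s (H.eq_zero fun h => hs (Ioo_subset_Icc_self h))
  · exact hout s t (H.eq_zero fun h => ht (Ioo_subset_Icc_self h))

theorem continuousOn (H : IsSmallVariation e y₀ r C z a b p q w ε) :
    ContinuousOn (chartVariation e z a b w ε) (Icc 0 1) :=
  continuousOn_of_absolutelyContinuousOnInterval H.absolutelyContinuous

theorem mk_velocity_eq_of_notMem (H : IsSmallVariation e y₀ r C z a b p q w ε) {s : ℝ}
    (hs : s ∉ tsupport w) :
    (⟨chartVariation e z a b w ε s, velocity m (chartVariation e z a b w ε) s⟩ :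
      TangentBundle (𝓡 (m + 1)) M) = ⟨z s, velocity m z s⟩ := by
  refine mk_velocity_congr ?_
  filter_upwards [(isClosed_tsupport w).isOpen_compl.mem_nhds hs] with t ht
  exact chartVariation_of_eq_zero H.arc (image_eq_zero_of_notMem_tsupport ht)

theorem hasDerivAt_chart_comp (H : IsSmallVariation e y₀ r C z a b p q w ε) {s : ℝ}
    (hs : s ∈ Ioo a b) {u : 𝔼} (hu : HasDerivAt (e ∘ z) u s) :
    HasDerivAt (e ∘ chartVariation e z a b w ε) (u + ε • deriv w s) s := by
  have h1 : HasDerivAt w (deriv w s) s :=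
    ((H.smooth.differentiable (by simp)) s).hasDerivAt
  refine (hu.add (h1.const_smul ε)).congr_of_eventuallyEq ?_
  filter_upwards [Ioo_mem_nhds hs.1 hs.2] with t ht
  exact (H.chart_comp (Ioo_subset_Icc_self ht)).2

theorem coordVec_velocity (H : IsSmallVariation e y₀ r C z a b p q w ε) {s : ℝ}
    (hs : s ∈ Ioo a b) {u : 𝔼} (hu : HasDerivAt (e ∘ z) u s) :
    coordVec e (chartVariation e z a b w ε s) (velocity m (chartVariation e z a b w ε) s) =
      u + ε • deriv w s := by
  have hsI := Ioo_subset_Icc_self hs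
  exact SymLagrangian.coordVec_velocity H.arc.ball.mem_charts (H.arc.subset hsI)
    (H.chart_comp hsI).1 (H.continuousOn s (H.arc.subset hsI))
    (H.hasDerivAt_chart_comp hs hu).hasDerivWithinAt

theorem lagrangian_eq (H : IsSmallVariation e y₀ r C z a b p q w ε)
    (L : TangentBundle (𝓡 (m + 1)) M → ℝ) {s : ℝ}
    (hs : s ∈ Ioo a b) {u : 𝔼} (hu : HasDerivAt (e ∘ z) u s) :
    L ⟨chartVariation e z a b w ε s, velocity m (chartVariation e z a b w ε) s⟩ =
      coordLagrangian e L (e (z s) + ε • w s) (u + ε • deriv w s) := by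
  have hsI := Ioo_subset_Icc_self hs
  rw [← H.coordVec_velocity hs hu, ← (H.chart_comp hsI).2, coordLagrangian_coordVec
    H.arc.ball.mem_charts (H.chart_comp hsI).1]

theorem enorm_velocity_le (H : IsSmallVariation e y₀ r C z a b p q w ε) {s : ℝ}
    (hs : s ∈ Ioo a b) {u : 𝔼} (hu : HasDerivAt (e ∘ z) u s) :
    ‖velocity m (chartVariation e z a b w ε) s‖ₑ ^ 2 ≤
      ENNReal.ofReal (C ^ 2 * (2 * ‖u‖ ^ 2 + 2 * (ε ^ 2 * ‖deriv w s‖ ^ 2))) := by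
  have hsI := Ioo_subset_Icc_self hs
  have h1 := (H.arc.ball.norm_le _ (H.chart_comp hsI).1
    (by rw [(H.chart_comp hsI).2]; exact H.mem s hsI)
    (velocity m (chartVariation e z a b w ε) s)).2
  rw [H.coordVec_velocity hs hu] at h1
  have h2 := norm_add_le u (ε • deriv w s)
  rw [norm_smul, Real.norm_eq_abs] at h2
  rw [← ofReal_norm, ← ENNReal.ofReal_pow (norm_nonneg _)]
  refine ENNReal.ofReal_le_ofReal ?_
  have hC := H.arc.ball.pos
  have h3 : ‖velocity m (chartVariation e z a b w ε) s‖ ≤ C * (‖u‖ + |ε| * ‖deriv w s‖) :=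
    h1.trans (mul_le_mul_of_nonneg_left h2 hC.le)
  refine (pow_le_pow_left₀ (norm_nonneg _) h3 2).trans ?_
  rw [mul_pow, ← sq_abs ε, ← mul_pow |ε|]
  refine mul_le_mul_of_nonneg_left ?_ (sq_nonneg _)
  nlinarith [sq_nonneg (‖u‖ - |ε| * ‖deriv w s‖)]

theorem finiteEnergy (H : IsSmallVariation e y₀ r C z a b p q w ε) :
    ∫⁻ s in Icc (0 : ℝ) 1, ‖velocity m (chartVariation e z a b w ε) s‖ₑ ^ 2 < ⊤ := by
  have hw' : Continuous (deriv w) := H.smooth.continuous_deriv (by simp)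
  set G : ℝ → ℝ := fun s =>
    C ^ 2 * (2 * ‖deriv (e ∘ z) s‖ ^ 2 + 2 * (ε ^ 2 * ‖deriv w s‖ ^ 2)) with hG
  have hGi : IntegrableOn G (Ioo a b) := by
    have h1 := H.arc.integrableOn_norm_deriv_sq H.path
    have h2 : IntegrableOn (fun s => 2 * (ε ^ 2 * ‖deriv w s‖ ^ 2)) (Ioo a b) :=
      ((by fun_prop : Continuous fun s => 2 * (ε ^ 2 * ‖deriv w s‖ ^ 2)).continuousOn.integrableOn_Icc
        (a := a) (b := b)).mono_set Ioo_subset_Icc_self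
    exact ((h1.const_mul 2).add h2).const_mul (C ^ 2)
  -- At almost every time one of the two summands dominates: the coordinate bound inside the arc,
  -- the energy density of `z` elsewhere.
  have hle : ∫⁻ s in Icc (0 : ℝ) 1, ‖velocity m (chartVariation e z a b w ε) s‖ₑ ^ 2 ≤
      ∫⁻ s in Icc (0 : ℝ) 1, ((Ioo a b).indicator (fun s => ENNReal.ofReal (G s)) s +
        ‖velocity m z s‖ₑ ^ 2) := by
    refine lintegral_mono_ae ?_
    filter_upwards [ae_restrict_of_ae (H.arc.ae_hasDerivAt H.path)] with s hs
    by_cases hsI : s ∈ Ioo a b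
    · rw [indicator_of_mem hsI]
      exact (H.enorm_velocity_le hsI (hs hsI)).trans le_self_add
    · have h := H.mk_velocity_eq_of_notMem fun h => hsI (H.support h)
      have h' : ‖velocity m (chartVariation e z a b w ε) s‖ₑ = ‖velocity m z s‖ₑ :=
        congrArg (fun ξ : TangentBundle (𝓡 (m + 1)) M => ‖ξ.snd‖ₑ) h
      rw [h']
      exact le_add_self
  refine hle.trans_lt ?_
  have hGm : AEMeasurable ((Ioo a b).indicator fun s => ENNReal.ofReal (G s))
      (volume.restrict (Icc (0 : ℝ) 1)) := by
    have : Measurable G := by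
      have := measurable_deriv (e ∘ z)
      have := hw'.measurable
      rw [hG]; fun_prop
    exact (this.ennreal_ofReal.indicator measurableSet_Ioo).aemeasurable
  rw [lintegral_add_left' hGm, ENNReal.add_lt_top]
  refine ⟨?_, H.path.finiteEnergy⟩
  refine (setLIntegral_le_lintegral _ _).trans_lt ?_
  rw [lintegral_indicator measurableSet_Ioo]
  refine lt_of_le_of_lt (lintegral_mono fun s => ?_) hGi.2
  exact Real.ofReal_le_enorm _

theorem isPath (H : IsSmallVariation e y₀ r C z a b p q w ε) :
    IsPath m p q (chartVariation e z a b w ε) where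
  absolutelyContinuous := H.absolutelyContinuous
  finiteEnergy := H.finiteEnergy
  left := by
    rw [← H.path.left]
    refine chartVariation_of_eq_zero H.arc (H.eq_zero fun h => ?_)
    exact absurd (H.arc.subset (left_mem_Icc.2 H.arc.lt.le)).1 (not_le.2 h.1)
  right := by
    rw [← H.path.right]
    refine chartVariation_of_eq_zero H.arc (H.eq_zero fun h => ?_)
    exact absurd (H.arc.subset (right_mem_Icc.2 H.arc.lt.le)).2 (not_le.2 h.2)

end IsSmallVariation

end Variation

end Arcs

end SymLagrangian

namespace SymLagrangian

/-! ### Admissible variations and the derivative of the action. -/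

section Sobolev

variable {m : ℕ}

/-- For a family affine in ε the difference quotient equals its limit as soon as ε is small and
nonzero. -/
theorem sobolevDifferentiableAtZero_of_eventually
    {u : ℝ → ℝ → EuclideanSpace ℝ (Fin (m + 1))} {w : ℝ → EuclideanSpace ℝ (Fin (m + 1))} {a b : ℝ}
    (hw : ContDiff ℝ ∞ w) (hu : ∀ᶠ ε in 𝓝 (0 : ℝ), ∀ s ∈ Icc a b, u ε s = u 0 s + ε • w s)
    (hd : ∀ᵐ s, s ∈ Ioo a b → ∀ ε : ℝ,
      deriv (fun t => u 0 t + ε • w t) s = deriv (u 0) s + ε • deriv w s) :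
    SobolevDifferentiableAtZero u a b := by
  have hw' : Continuous (deriv w) := hw.continuous_deriv (by simp)
  refine ⟨w, ?_, ?_, ?_⟩
  · exact (hw.of_le (by simp)).contDiffOn.absolutelyContinuousOnInterval
  · have : IsFiniteMeasure (volume.restrict (Icc a b)) := ⟨by simp⟩
    obtain ⟨W, hW⟩ := isCompact_Icc.exists_bound_of_continuousOn (hw'.continuousOn (s := Icc a b))
    refine MemLp.of_bound hw'.aestronglyMeasurable W ?_
    exact (ae_restrict_iff' measurableSet_Icc).2 (Eventually.of_forall hW)
  · refine tendsto_nhds_of_eventually_eq ?_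
    filter_upwards [hu.filter_mono nhdsWithin_le_nhds, self_mem_nhdsWithin] with ε hε hε0
    have hε0 : ε ≠ 0 := hε0
    have h1 : (fun s => ε⁻¹ • (u ε s - u 0 s) - w s) =ᵐ[volume.restrict (Icc a b)] 0 := by
      refine (ae_restrict_iff' measurableSet_Icc).2 (Eventually.of_forall fun s hs => ?_)
      change ε⁻¹ • (u ε s - u 0 s) - w s = 0
      rw [hε s hs, add_sub_cancel_left, inv_smul_smul₀ hε0, sub_self]
    have h2 : (fun s => ε⁻¹ • (deriv (u ε) s - deriv (u 0) s) - deriv w s)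
        =ᵐ[volume.restrict (Icc a b)] 0 := by
      -- The family is controlled only on `[a, b]`, so derivatives are compared at interior points.
      rw [restrict_Ioo_eq_restrict_Icc.symm]
      refine (ae_restrict_iff' measurableSet_Ioo).2 ?_
      filter_upwards [hd] with s hs hsab
      have h3 : u ε =ᶠ[𝓝 s] fun t => u 0 t + ε • w t := by
        filter_upwards [Ioo_mem_nhds hsab.1 hsab.2] with t ht using hε t (Ioo_subset_Icc_self ht)
      rw [h3.deriv_eq, hs hsab, add_sub_cancel_left, inv_smul_smul₀ hε0, sub_self, Pi.zero_apply]
    rw [eLpNorm_congr_ae h1, eLpNorm_congr_ae h2, eLpNorm_zero, add_zero]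

end Sobolev

section Action

set_option linter.unusedSectionVars false

variable {m : ℕ} {M : Type*} [MetricSpace M]
  [ChartedSpace (EuclideanSpace ℝ (Fin (m + 1))) M] [IsManifold (𝓡 (m + 1)) ∞ M]
  [RiemannianBundle (fun x : M => TangentSpace (𝓡 (m + 1)) x)]

local notation "𝔼" => EuclideanSpace ℝ (Fin (m + 1))

variable {e : OpenPartialHomeomorph M (EuclideanSpace ℝ (Fin (m + 1)))}
  {y₀ : EuclideanSpace ℝ (Fin (m + 1))} {r C : ℝ} {z : ℝ → M} {a b : ℝ} {p q : M}
  {w : ℝ → EuclideanSpace ℝ (Fin (m + 1))}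

/-- The variation of `z` in the coordinates `e` in direction `w`, for small parameters. -/
noncomputable def smallChartVariation (e : OpenPartialHomeomorph M (EuclideanSpace ℝ (Fin (m + 1))))
    (z : ℝ → M) (a b : ℝ) (w : ℝ → EuclideanSpace ℝ (Fin (m + 1))) (ε₀ ε : ℝ) : ℝ → M :=
  open Classical in if |ε| < ε₀ then chartVariation e z a b w ε else z

/-- `IsVariation` asks for a path at every ε, whence the constant family for large ε. At times in
the support of `w` the chart `e` over `[a, b]` shows differentiability; any other time has an
interval that misses the support, where the family is constant for small ε. -/
theorem isVariation_smallChartVariation {ε₀ : ℝ} (hε₀ : 0 < ε₀)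
    (H : ∀ ε : ℝ, |ε| < ε₀ → IsSmallVariation e y₀ r C z a b p q w ε) :
    IsVariation (m := m) p q z (smallChartVariation e z a b w ε₀) := by
  have h0 := H 0 (by simpa using hε₀)
  have hzc := h0.path.continuousOn
  have hγ0 : smallChartVariation e z a b w ε₀ 0 = z := by
    unfold smallChartVariation
    rw [if_pos (by simpa using hε₀), chartVariation_zero h0.arc]
  have hev : ∀ᶠ ε in 𝓝 (0 : ℝ), |ε| < ε₀ := by
    filter_upwards [Metric.ball_mem_nhds (0 : ℝ) hε₀] with ε hε
    simpa using hε
  have hγ : ∀ ε : ℝ, |ε| < ε₀ → smallChartVariation e z a b w ε₀ ε = chartVariation e z a b w ε :=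
    fun ε hε => if_pos hε
  refine ⟨fun ε => ?_, hγ0, fun s hs => ?_⟩
  · by_cases hε : |ε| < ε₀
    · rw [hγ ε hε]; exact (H ε hε).isPath
    · unfold smallChartVariation; rw [if_neg hε]; exact h0.path
  · by_cases hsw : s ∈ tsupport w
    · have hsI := h0.support hsw
      refine ⟨a, b, h0.arc.lt, h0.arc.subset,
        mem_nhdsWithin_of_mem_nhds (Icc_mem_nhds hsI.1 hsI.2), e, h0.arc.ball.mem_charts, ?_, ?_⟩
      · filter_upwards [hev] with ε hε t ht
        rw [hγ ε hε]; exact ((H ε hε).chart_comp ht).1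
      · refine sobolevDifferentiableAtZero_of_eventually h0.smooth ?_ ?_
        · filter_upwards [hev] with ε hε t ht
          rw [hγ ε hε, hγ0]; exact ((H ε hε).chart_comp ht).2
        · filter_upwards [h0.arc.ae_hasDerivAt h0.path] with t ht htab ε
          rw [hγ0]
          have h1 : HasDerivAt w (deriv w t) t :=
            ((h0.smooth.differentiable (by simp)) t).hasDerivAt
          exact ((ht htab).add (h1.const_smul ε)).deriv
    · have hO : (chartAt 𝔼 (z s)).source ×ˢ (tsupport w)ᶜ ∈ 𝓝 (z s, s) :=
        prod_mem_nhds ((chartAt 𝔼 (z s)).open_source.mem_nhds (mem_chart_source 𝔼 (z s)))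
          ((isClosed_tsupport w).isOpen_compl.mem_nhds hsw)
      -- Applied to the graph of `z`, so that one interval both stays in the chart and avoids the
      -- support.
      obtain ⟨a', b', hab, hsub, hnhds, hmem⟩ :=
        exists_Icc_subset (z := fun t => (z t, t)) (hzc.prodMk continuousOn_id) hs hO
      have hfix : ∀ ε : ℝ, |ε| < ε₀ → ∀ t ∈ Icc a' b',
          smallChartVariation e z a b w ε₀ ε t = z t := fun ε hε t ht => by
        rw [hγ ε hε]
        exact chartVariation_of_eq_zero h0.arc (image_eq_zero_of_notMem_tsupport (hmem t ht).2)
      refine ⟨a', b', hab, hsub, hnhds, chartAt 𝔼 (z s),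
        IsManifold.chart_mem_maximalAtlas (z s), ?_, ?_⟩
      · filter_upwards [hev] with ε hε t ht
        rw [hfix ε hε t ht]
        exact (hmem t ht).1
      · refine sobolevDifferentiableAtZero_of_eventually (w := fun _ => 0) contDiff_const ?_ ?_
        · filter_upwards [hev] with ε hε t ht
          rw [hfix ε hε t ht, hγ0, smul_zero, add_zero]
        · refine Eventually.of_forall fun t _ ε => ?_
          simp only [smul_zero, add_zero, deriv_const']

/-- Only the change of the action is written in coordinates, since the chart covers just one arc;
integrability of both pieces is what allows the integral to be split. -/
theorem action_chartVariation {ε : ℝ} (H : IsSmallVariation e y₀ r C z a b p q w ε)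
    (L : TangentBundle (𝓡 (m + 1)) M → ℝ)
    (hLz : IntervalIntegrable (fun s => L ⟨z s, velocity m z s⟩) volume 0 1)
    (hD : IntervalIntegrable (fun s =>
      coordLagrangian e L (e (z s) + ε • w s) (deriv (e ∘ z) s + ε • deriv w s) -
        coordLagrangian e L (e (z s)) (deriv (e ∘ z) s)) volume a b) :
    action L (chartVariation e z a b w ε) = action L z + ∫ s in a..b,
      (coordLagrangian e L (e (z s) + ε • w s) (deriv (e ∘ z) s + ε • deriv w s) -
        coordLagrangian e L (e (z s)) (deriv (e ∘ z) s)) := by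
  set D : ℝ → ℝ := fun s =>
    coordLagrangian e L (e (z s) + ε • w s) (deriv (e ∘ z) s + ε • deriv w s) -
        coordLagrangian e L (e (z s)) (deriv (e ∘ z) s) with hDdef
  have hab := H.arc.lt.le
  have hsub : Ioo a b ⊆ Ioc 0 1 := fun s hs =>
    ⟨lt_of_le_of_lt (H.arc.subset (left_mem_Icc.2 hab)).1 hs.1,
      (H.arc.subset (Ioo_subset_Icc_self hs)).2⟩
  have hae : ∀ᵐ s ∂volume.restrict (Ioc (0 : ℝ) 1),
      L ⟨chartVariation e z a b w ε s, velocity m (chartVariation e z a b w ε) s⟩ =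
        L ⟨z s, velocity m z s⟩ + (Ioo a b).indicator D s := by
    filter_upwards [ae_restrict_of_ae (H.arc.ae_hasDerivAt H.path),
      ae_restrict_of_ae (H.arc.ae_lagrangian_eq H.path L)] with s hs hs'
    by_cases hsI : s ∈ Ioo a b
    · rw [indicator_of_mem hsI, H.lagrangian_eq L hsI (hs hsI), hs' hsI, hDdef]
      ring
    · rw [indicator_of_notMem hsI, add_zero,
        H.mk_velocity_eq_of_notMem fun h => hsI (H.support h)]
  have hDi : IntegrableOn D (Ioo a b) := (intervalIntegrable_iff_integrableOn_Ioo_of_le hab).1 hD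
  have hLi : IntegrableOn (fun s => L ⟨z s, velocity m z s⟩) (Ioc 0 1) :=
    (intervalIntegrable_iff_integrableOn_Ioc_of_le zero_le_one).1 hLz
  have hind : Integrable ((Ioo a b).indicator D) (volume.restrict (Ioc 0 1)) :=
    ((integrable_indicator_iff measurableSet_Ioo).2 hDi).restrict
  unfold action
  change _ = _ + ∫ s in a..b, D s
  rw [intervalIntegral.integral_of_le zero_le_one, intervalIntegral.integral_of_le zero_le_one,
    integral_congr_ae hae, integral_add hLi hind, integral_indicator measurableSet_Ioo,
    Measure.restrict_restrict measurableSet_Ioo, inter_eq_left.2 hsub,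
    intervalIntegral.integral_of_le hab, ← integral_Ioc_eq_integral_Ioo]

/-- The weak Euler-Lagrange equations in the coordinates `e`. -/
theorem IsCriticalPoint.integral_fderiv_eq_zero {L : TangentBundle (𝓡 (m + 1)) M → ℝ}
    (hz : IsCriticalPoint L p q z) (hL : ContMDiff (𝓡 (m + 1)).tangent 𝓘(ℝ, ℝ) 1 L)
    (harc : IsChartedArc e y₀ r C z a b)
    (hLz : IntervalIntegrable (fun s => L ⟨z s, velocity m z s⟩) volume 0 1)
    {g : ℝ → ℝ} (hg : IntervalIntegrable g volume a b) {ρ : ℝ} (hρ : 0 < ρ)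
    (hbound : ∀ᵐ s, s ∈ Ioo a b → ∀ x ∈ Metric.ball (e (z s)) ρ, x ∈ e.target ∧
      ∀ v ∈ Metric.ball (deriv (e ∘ z) s) ρ,
        ‖fderiv ℝ (Function.uncurry (coordLagrangian e L)) (x, v)‖ ≤ g s)
    (hw : ContDiff ℝ ∞ w) (hwc : HasCompactSupport w) (hws : tsupport w ⊆ Ioo a b) :
    ∫ s in a..b, fderiv ℝ (Function.uncurry (coordLagrangian e L)) (e (z s), deriv (e ∘ z) s)
      (w s, deriv w s) = 0 := by
  obtain ⟨hint, hder⟩ := hasDerivAt_integral_variation e.open_target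
    (contDiffOn_coordLagrangian harc.ball.mem_charts hL) harc.lt.le hρ (harc.continuousOn hz.1)
    (measurable_deriv (e ∘ z)) hw.continuous (hw.continuous_deriv (by simp)) hg hbound
  obtain ⟨ε₀, hε₀, hmem⟩ := eventually_mem_ball harc hz.1 hw.continuous
  have H : ∀ ε : ℝ, |ε| < ε₀ → IsSmallVariation e y₀ r C z a b p q w ε := fun ε hε =>
    ⟨harc, hz.1, hw, hwc, hws, hmem ε hε⟩
  have hcrit := hz.2 _ (isVariation_smallChartVariation hε₀ H)
  have hev : ∀ᶠ ε in 𝓝 (0 : ℝ), |ε| < ε₀ := by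
    filter_upwards [Metric.ball_mem_nhds (0 : ℝ) hε₀] with ε hε
    simpa using hε
  have hder' := hder.const_add (action L z)
  have heq : (fun ε => action L (smallChartVariation e z a b w ε₀ ε)) =ᶠ[𝓝 0] fun ε : ℝ =>
      action L z + ∫ s in a..b,
      (coordLagrangian e L ((e ∘ z) s + ε • w s) (deriv (e ∘ z) s + ε • deriv w s) -
        coordLagrangian e L ((e ∘ z) s) (deriv (e ∘ z) s)) := by
    filter_upwards [hev, hint] with ε hε hi
    unfold smallChartVariation
    rw [if_pos hε]
    exact action_chartVariation (H ε hε) L hLz hi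
  exact (hder'.congr_of_eventuallyEq heq).unique hcrit

end Action

end SymLagrangian

namespace SymLagrangian

/-! ### Critical points are of class C^1. -/

section Regularity

set_option linter.unusedSectionVars false

variable {m : ℕ} {M : Type*} [MetricSpace M]
  [ChartedSpace (EuclideanSpace ℝ (Fin (m + 1))) M] [IsManifold (𝓡 (m + 1)) ∞ M]
  [RiemannianBundle (fun x : M => TangentSpace (𝓡 (m + 1)) x)]
  [IsContinuousRiemannianBundle (EuclideanSpace ℝ (Fin (m + 1)))
    (fun x : M => TangentSpace (𝓡 (m + 1)) x)] [IsRiemannianManifold (𝓡 (m + 1)) M]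

local notation "𝔼" => EuclideanSpace ℝ (Fin (m + 1))

variable {L : TangentBundle (𝓡 (m + 1)) M → ℝ} {K : ∀ x : M, TangentSpace (𝓡 (m + 1)) x}
  {Q : ∀ x : M, TangentSpace (𝓡 (m + 1)) x →L[ℝ] ℝ} {d : M → ℝ} {p q : M} {z : ℝ → M}

/-- Every point of a path lies on an arc along which `L` and its differential have quadratic
growth, in a suitable chart. -/
theorem exists_isChartedArc_growth (hL : SymmetryAssumption L K Q d)
    (hLc : GrowthAssumption (convexLagrangian L K Q)) (hz : IsPath m p q z) {s₀ : ℝ}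
    (hs₀ : s₀ ∈ Icc (0 : ℝ) 1) :
    ∃ (e : OpenPartialHomeomorph M 𝔼) (y₀ : 𝔼) (r C a b ρ A : ℝ), IsChartedArc e y₀ r C z a b ∧
      Icc a b ∈ 𝓝[Icc 0 1] s₀ ∧ 0 < ρ ∧ 0 < A ∧
      (∀ s ∈ Icc a b, ∀ x ∈ Metric.ball (e (z s)) ρ, x ∈ e.target ∧ ∀ u,
        |coordLagrangian e L x u| ≤ A * (‖u‖ ^ 2 + 1) ∧
        ‖fderiv ℝ (Function.uncurry (coordLagrangian e L)) (x, u)‖ ≤ A * (‖u‖ ^ 2 + 1)) ∧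
      ∃ lam, IsCoordSymLagrangian (Metric.ball y₀ r) (coordLagrangian e L) (coordField e K)
        (coordForm e Q) (d ∘ e.symm) lam := by
  obtain ⟨C₀, hC₀, hC₀0, -, ⟨𝒰, h𝒰, hcover, hhoriz⟩, hvert⟩ := hLc.growth
  obtain ⟨e, he𝒰, hes⟩ := hcover (z s₀)
  have he := h𝒰 he𝒰
  have hy₀ := e.map_source hes
  obtain ⟨r₁, hr₁, A, hA, hr₁t, hgrowth⟩ :=
    exists_growth_coordLagrangian hL he hC₀ hC₀0 (hhoriz e he𝒰) hvert hy₀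
  obtain ⟨r₂, hr₂, C, hball⟩ := exists_isComparisonBall he hy₀
  obtain ⟨r₃, hr₃, -, lam, hsym⟩ := exists_isCoordSymLagrangian hL hLc he hy₀
  -- Half of `r₁` goes to the arc; the other half is the margin `ρ` around its points in which the
  -- growth bounds persist.
  have hr : 0 < min (r₁ / 2) (min r₂ r₃) := by positivity
  have hle₁ : min (r₁ / 2) (min r₂ r₃) ≤ r₁ / 2 := min_le_left _ _
  have hle₂ : min (r₁ / 2) (min r₂ r₃) ≤ r₂ := (min_le_right _ _).trans (min_le_left _ _)
  have hle₃ : min (r₁ / 2) (min r₂ r₃) ≤ r₃ := (min_le_right _ _).trans (min_le_right _ _)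
  obtain ⟨a, b, harc, hnhds⟩ :=
    exists_isChartedArc hz.continuousOn hs₀ hes hr (hball.mono hle₂)
  refine ⟨e, e (z s₀), _, C, a, b, r₁ / 2, A, harc, hnhds, by positivity, hA, ?_,
    lam, hsym.mono Metric.isOpen_ball (Metric.ball_subset_ball hle₃)⟩
  intro s hs x hx
  have hxr : x ∈ Metric.ball (e (z s₀)) r₁ := by
    have h1 := harc.mem_ball s hs
    rw [Metric.mem_ball] at h1 hx ⊢
    linarith [dist_triangle x (e (z s)) (e (z s₀))]
  exact ⟨hr₁t hxr, hgrowth x hxr⟩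

/-- Near each time, quadratic growth and finite energy give integrability; compactness of `[0, 1]`
does the rest. -/
theorem intervalIntegrable_lagrangian (hL : SymmetryAssumption L K Q d)
    (hLc : GrowthAssumption (convexLagrangian L K Q)) (hz : IsPath m p q z) :
    IntervalIntegrable (fun s => L ⟨z s, velocity m z s⟩) volume 0 1 := by
  rw [intervalIntegrable_iff_integrableOn_Icc_of_le zero_le_one]
  refine LocallyIntegrableOn.integrableOn_isCompact (fun s₀ hs₀ => ?_) isCompact_Icc
  obtain ⟨e, y₀, r, C, a, b, ρ, A, harc, hnhds, hρ, hA, hgrowth, -⟩ :=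
    exists_isChartedArc_growth hL hLc hz hs₀
  refine ⟨Icc a b, hnhds, ?_⟩
  rw [integrableOn_Icc_iff_integrableOn_Ioo]
  have hF := contDiffOn_coordLagrangian harc.ball.mem_charts hL.contMDiff_L
  have hmem : ∀ s ∈ Icc a b, e (z s) ∈ e.target := fun s hs => e.map_source (harc.mem_source s hs)
  have hm : AEStronglyMeasurable (fun s => Function.uncurry (coordLagrangian e L)
      ((e ∘ z) s, deriv (e ∘ z) s)) (volume.restrict (Ioo a b)) := by
    refine aestronglyMeasurable_comp_of_continuousOn (g := fun s => ((e ∘ z) s, deriv (e ∘ z) s))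
      (e.open_target.prod isOpen_univ).measurableSet hF.continuousOn ?_ ?_
    · exact (((harc.continuousOn hz).mono Ioo_subset_Icc_self).aemeasurable
        measurableSet_Ioo).prodMk (measurable_deriv _).aemeasurable
    · exact (ae_restrict_iff' measurableSet_Ioo).2 (Eventually.of_forall fun s hs =>
        ⟨hmem s (Ioo_subset_Icc_self hs), mem_univ _⟩)
  have hG : IntegrableOn (fun s => A * (‖deriv (e ∘ z) s‖ ^ 2 + 1)) (Ioo a b) :=
    ((harc.integrableOn_norm_deriv_sq hz).add (integrableOn_const (by simp))).const_mul A
  have hi : IntegrableOn (fun s => Function.uncurry (coordLagrangian e L)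
      ((e ∘ z) s, deriv (e ∘ z) s)) (Ioo a b) := by
    refine Integrable.mono' hG hm ((ae_restrict_iff' measurableSet_Ioo).2
      (Eventually.of_forall fun s hs => ?_))
    exact ((hgrowth s (Ioo_subset_Icc_self hs) _ (Metric.mem_ball_self hρ)).2 _).1
  refine hi.congr ((ae_restrict_iff' measurableSet_Ioo).2 ?_)
  filter_upwards [harc.ae_lagrangian_eq hz L] with s hs hsab using (hs hsab).symm

/-- The integrated Euler-Lagrange equations. -/
theorem IsCriticalPoint.exists_momentum_eq {e : OpenPartialHomeomorph M 𝔼} {y₀ : 𝔼}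
    {r C a b ρ : ℝ} {g : ℝ → ℝ} (hL : SymmetryAssumption L K Q d)
    (hLc : GrowthAssumption (convexLagrangian L K Q)) (hz : IsCriticalPoint L p q z)
    (harc : IsChartedArc e y₀ r C z a b) (hg : IntervalIntegrable g volume a b) (hρ : 0 < ρ)
    (hbound : ∀ᵐ s, s ∈ Ioo a b → ∀ x ∈ Metric.ball (e (z s)) ρ, x ∈ e.target ∧
      ∀ v ∈ Metric.ball (deriv (e ∘ z) s) ρ,
        ‖fderiv ℝ (Function.uncurry (coordLagrangian e L)) (x, v)‖ ≤ g s) :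
    IntervalIntegrable (fun s => fderiv ℝ (fun x => coordLagrangian e L x (deriv (e ∘ z) s))
      (e (z s))) volume a b ∧
    ∃ c, ∀ᵐ s, s ∈ Ioo a b → fderiv ℝ (coordLagrangian e L (e (z s))) (deriv (e ∘ z) s) =
      c + ∫ t in a..s, fderiv ℝ (fun x => coordLagrangian e L x (deriv (e ∘ z) t)) (e (z t)) := by
  refine ae_fderiv_eq_const_add_integral (y := e ∘ z) e.open_target
    (contDiffOn_coordLagrangian harc.ball.mem_charts hL.contMDiff_L) harc.lt
    (harc.continuousOn hz.1) (fun s hs => e.map_source (harc.mem_source s hs))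
    (measurable_deriv (e ∘ z)) hg ?_ fun w hw hwc hws =>
      hz.integral_fderiv_eq_zero hL.contMDiff_L harc (intervalIntegrable_lagrangian hL hLc hz.1) hg
        hρ hbound hw hwc hws
  filter_upwards [hbound] with s hs hsab
  exact (hs hsab _ (Metric.mem_ball_self hρ)).2 _ (Metric.mem_ball_self hρ)

/-- Extending `f` by its boundary values to all of ℝ gives a two-sided derivative, also at `a` and
`b`. -/
theorem hasDerivWithinAt_integral_of_continuousOn {G : Type*} [NormedAddCommGroup G]
    [NormedSpace ℝ G] [CompleteSpace G] {f : ℝ → G} {a b : ℝ} (hab : a ≤ b)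
    (hf : ContinuousOn f (Icc a b)) {s : ℝ} (hs : s ∈ Icc a b) :
    HasDerivWithinAt (fun u => ∫ t in a..u, f t) (f s) (Icc a b) s := by
  have h1 : Continuous (IccExtend hab ((Icc a b).domRestrict f)) :=
    (continuousOn_iff_continuous_domRestrict.1 hf).Icc_extend'
  have h2 := (h1.integral_hasStrictDerivAt a s).hasDerivAt.hasDerivWithinAt (s := Icc a b)
  rw [IccExtend_of_mem hab _ hs] at h2
  have h3 : ∀ u ∈ Icc a b, ∫ t in a..u, f t =
      ∫ t in a..u, IccExtend hab ((Icc a b).domRestrict f) t := fun u hu => by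
    refine intervalIntegral.integral_congr fun t ht => ?_
    rw [uIcc_of_le hu.1] at ht
    exact (IccExtend_of_mem hab ((Icc a b).domRestrict f) ⟨ht.1, ht.2.trans hu.2⟩).symm
  exact h2.congr h3 (h3 s hs)

theorem contDiffOn_one_of_hasDerivWithinAt {G : Type*} [NormedAddCommGroup G] [NormedSpace ℝ G]
    {f f' : ℝ → G} {I : Set ℝ} (hI : UniqueDiffOn ℝ I)
    (h : ∀ s ∈ I, HasDerivWithinAt f (f' s) I s) (hf' : ContinuousOn f' I) :
    ContDiffOn ℝ 1 f I :=
  (contDiffOn_one_iff_derivWithin hI).2 ⟨fun s hs => (h s hs).differentiableWithinAt,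
    hf'.congr fun s hs => (h s hs).derivWithin (hI s hs)⟩

/-- Critical points are of class `C^1`. -/
theorem IsCriticalPoint.contMDiffOn (hL : SymmetryAssumption L K Q d)
    (hLc : GrowthAssumption (convexLagrangian L K Q)) (hz : IsCriticalPoint L p q z) :
    ContMDiffOn 𝓘(ℝ, ℝ) (𝓡 (m + 1)) 1 z (Icc 0 1) := by
  intro s₀ hs₀
  obtain ⟨e, y₀, r, C, a, b, ρ, A, harc, hnhds, hρ, hA, hgrowth, lam, hsym⟩ :=
    exists_isChartedArc_growth hL hLc hz.1 hs₀
  have hab := harc.lt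
  have he := harc.ball.mem_charts
  -- The velocity is only square integrable so far, so the dominating function is quadratic in it;
  -- `ρ` allows for nearby velocities.
  have hg : IntervalIntegrable (fun s => A * ((‖deriv (e ∘ z) s‖ + ρ) ^ 2 + 1)) volume a b := by
    rw [intervalIntegrable_iff_integrableOn_Ioo_of_le hab.le]
    have h1 : IntegrableOn (fun s => A * (2 * ‖deriv (e ∘ z) s‖ ^ 2 + (2 * ρ ^ 2 + 1))) (Ioo a b) :=
      (((harc.integrableOn_norm_deriv_sq hz.1).const_mul 2).add
        (integrableOn_const (by simp))).const_mul A
    refine Integrable.mono' h1 ?_ (Eventually.of_forall fun s => ?_)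
    · have := measurable_deriv (e ∘ z)
      exact (by fun_prop : Measurable fun s =>
        A * ((‖deriv (e ∘ z) s‖ + ρ) ^ 2 + 1)).aestronglyMeasurable
    · rw [Real.norm_of_nonneg (by positivity)]
      refine mul_le_mul_of_nonneg_left ?_ hA.le
      nlinarith [sq_nonneg (‖deriv (e ∘ z) s‖ - ρ)]
  obtain ⟨hint, c, hc⟩ := hz.exists_momentum_eq hL hLc harc hg hρ
    (Eventually.of_forall fun s hs x hx => by
      obtain ⟨hxt, hxb⟩ := hgrowth s (Ioo_subset_Icc_self hs) x hx
      refine ⟨hxt, fun v hv => ((hxb v).2).trans (mul_le_mul_of_nonneg_left ?_ hA.le)⟩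
      have h1 : ‖v‖ ≤ ‖deriv (e ∘ z) s‖ + ρ := by
        rw [Metric.mem_ball, dist_eq_norm] at hv
        linarith [norm_le_norm_add_norm_sub' v (deriv (e ∘ z) s)]
      linarith [pow_le_pow_left₀ (norm_nonneg v) h1 2])
  have hint' := (intervalIntegrable_iff_integrableOn_Icc_of_le hab.le).1 hint
  have hP : ContinuousOn (fun s => c + ∫ t in a..s,
      fderiv ℝ (fun x => coordLagrangian e L x (deriv (e ∘ z) t)) (e (z t))) (Icc a b) := by
    rw [← uIcc_of_le hab.le] at hint' ⊢
    exact continuousOn_const.add (intervalIntegral.continuousOn_primitive_interval hint')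
  obtain ⟨V, hV, hVae, -⟩ := hsym.exists_continuousOn_velocity (y := e ∘ z) hab
    (harc.continuousOn hz.1) harc.mem_ball hP hc
  have hVd : ∀ᵐ s, s ∈ uIcc a b → HasDerivAt (e ∘ z) (V s) s := by
    rw [uIcc_of_le hab.le]
    filter_upwards [hVae, harc.ae_hasDerivAt hz.1, (countable_singleton a).ae_notMem volume,
      (countable_singleton b).ae_notMem volume] with s h1 h2 h3 h4 hs
    have hs' : s ∈ Ioo a b := ⟨lt_of_le_of_ne hs.1 (Ne.symm h3), lt_of_le_of_ne hs.2 h4⟩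
    rw [← h1 hs']
    exact h2 hs'
  have hVi : IntervalIntegrable V volume a b := by
    rw [← uIcc_of_le hab.le] at hV
    exact hV.intervalIntegrable
  -- The coordinate curve is a primitive of the continuous `V`, so `V` is its derivative at every
  -- time.
  have hFTC := sub_eq_integral_of_ae_hasDerivAt (harc.absolutelyContinuous hz.1) hVi hVd
  rw [uIcc_of_le hab.le] at hFTC
  have hder : ∀ s ∈ Icc a b, HasDerivWithinAt (e ∘ z) (V s) (Icc a b) s := fun s hs => by
    refine ((hasDerivWithinAt_integral_of_continuousOn hab.le hV hs).const_add
      ((e ∘ z) a)).congr (fun u hu => ?_) ?_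
    · rw [← hFTC u hu, add_sub_cancel]
    · rw [← hFTC s hs, add_sub_cancel]
  have hC1 : ContDiffOn ℝ 1 (e ∘ z) (Icc a b) :=
    contDiffOn_one_of_hasDerivWithinAt (uniqueDiffOn_Icc hab) hder hV
  have hzC1 : ContMDiffOn 𝓘(ℝ, ℝ) (𝓡 (m + 1)) 1 z (Icc a b) := by
    refine (((contMDiffOn_symm_of_mem_maximalAtlas he).of_le (by simp)).comp hC1.contMDiffOn
      fun s hs => e.map_source (harc.mem_source s hs)).congr fun s hs => ?_
    exact (e.left_inv (harc.mem_source s hs)).symm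
  exact (hzC1 s₀ (mem_of_mem_nhdsWithin hs₀ hnhds)).mono_of_mem_nhdsWithin hnhds

end Regularity

end SymLagrangian

namespace SymLagrangian

/-! ### Classical Euler–Lagrange equations and conservation of energy. -/

section EulerLagrange

set_option linter.unusedSectionVars false

variable {m : ℕ} {M : Type*} [MetricSpace M]
  [ChartedSpace (EuclideanSpace ℝ (Fin (m + 1))) M] [IsManifold (𝓡 (m + 1)) ∞ M]

local notation "𝔼" => EuclideanSpace ℝ (Fin (m + 1))

theorem hasDerivWithinAt_chart_comp_of_contMDiffOn {e : OpenPartialHomeomorph M 𝔼}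
    (he : e ∈ smoothCharts m M) {z : ℝ → M}
    (hz : ContMDiffOn 𝓘(ℝ, ℝ) (𝓡 (m + 1)) 1 z (Icc 0 1)) {s : ℝ} (hs : s ∈ Icc (0 : ℝ) 1)
    (hzs : z s ∈ e.source) :
    HasDerivWithinAt (e ∘ z) (coordVec e (z s) (velocity m z s)) (Icc 0 1) s :=
  hasDerivWithinAt_chart_comp he hzs ((hz s hs).mdifferentiableWithinAt (by simp))

theorem uniqueDiffOn_Icc_inter_preimage {e : OpenPartialHomeomorph M 𝔼} {z : ℝ → M}
    (hz : ContinuousOn z (Icc 0 1)) : UniqueDiffOn ℝ (Icc 0 1 ∩ z ⁻¹' e.source) := by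
  obtain ⟨u, hu, hzu⟩ := continuousOn_iff'.1 hz e.source e.open_source
  rw [inter_comm, hzu, inter_comm]
  exact (uniqueDiffOn_Icc zero_lt_one).inter hu

theorem continuousOn_coordVec_velocity {e : OpenPartialHomeomorph M 𝔼}
    (he : e ∈ smoothCharts m M) {z : ℝ → M}
    (hz : ContMDiffOn 𝓘(ℝ, ℝ) (𝓡 (m + 1)) 1 z (Icc 0 1)) :
    ContinuousOn (fun s => coordVec e (z s) (velocity m z s)) (Icc 0 1 ∩ z ⁻¹' e.source) := by
  have hU := uniqueDiffOn_Icc_inter_preimage (e := e) hz.continuousOn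
  have h1 : ContDiffOn ℝ 1 (e ∘ z) (Icc 0 1 ∩ z ⁻¹' e.source) :=
    (((contMDiffOn_of_mem_maximalAtlas he).of_le (by simp)).comp (hz.mono inter_subset_left)
      fun s hs => hs.2).contDiffOn
  refine ((contDiffOn_one_iff_derivWithin hU).1 h1).2.congr fun s hs => ?_
  exact (((hasDerivWithinAt_chart_comp_of_contMDiffOn he hz hs.1 hs.2).mono
    inter_subset_left).derivWithin (hU s hs)).symm

/-- A continuous function on an open set is bounded near a compact curve. -/
theorem exists_bound_near_curve {E : Type*} [NormedAddCommGroup E] [NormedSpace ℝ E]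
    [FiniteDimensional ℝ E] {G : Type*} [NormedAddCommGroup G] {U : Set E} (hU : IsOpen U)
    {Φ : E × E → G} (hΦ : ContinuousOn Φ (U ×ˢ univ)) {a b : ℝ} {y v : ℝ → E}
    (hy : ContinuousOn y (Icc a b)) (hyU : ∀ s ∈ Icc a b, y s ∈ U)
    (hv : ContinuousOn v (Icc a b)) :
    ∃ ρ > (0 : ℝ), ∃ B : ℝ, ∀ s ∈ Icc a b, ∀ x ∈ Metric.ball (y s) ρ, x ∈ U ∧
      ∀ u ∈ Metric.ball (v s) ρ, ‖Φ (x, u)‖ ≤ B := by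
  have := FiniteDimensional.proper ℝ E
  have hK := isCompact_Icc.image_of_continuousOn (hy.prodMk hv)
  obtain ⟨ρ, hρ, hsub⟩ := hK.exists_cthickening_subset_open (hU.prod isOpen_univ)
    (image_subset_iff.2 fun s hs => ⟨hyU s hs, mem_univ _⟩)
  obtain ⟨B, hB⟩ := hK.cthickening.exists_bound_of_continuousOn (hΦ.mono hsub)
  have hmem : ∀ s ∈ Icc a b, ∀ x ∈ Metric.ball (y s) ρ, ∀ u ∈ Metric.ball (v s) ρ,
      (x, u) ∈ Metric.cthickening ρ ((fun s => (y s, v s)) '' Icc a b) := fun s hs x hx u hu =>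
    Metric.mem_cthickening_of_dist_le _ _ _ _ (mem_image_of_mem _ hs) (max_le hx.le hu.le)
  exact ⟨ρ, hρ, B, fun s hs x hx =>
    ⟨(hsub (hmem s hs x hx _ (Metric.mem_ball_self hρ))).1, fun u hu => hB _ (hmem s hs x hx u hu)⟩⟩

variable [RiemannianBundle (fun x : M => TangentSpace (𝓡 (m + 1)) x)]
  [IsContinuousRiemannianBundle (EuclideanSpace ℝ (Fin (m + 1)))
    (fun x : M => TangentSpace (𝓡 (m + 1)) x)] [IsRiemannianManifold (𝓡 (m + 1)) M]

variable {L : TangentBundle (𝓡 (m + 1)) M → ℝ} {K : ∀ x : M, TangentSpace (𝓡 (m + 1)) x}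
  {Q : ∀ x : M, TangentSpace (𝓡 (m + 1)) x →L[ℝ] ℝ} {d : M → ℝ} {p q : M} {z : ℝ → M}

/-- The Euler-Lagrange equations for the momentum as a linear form on the coordinate space. -/
theorem IsCriticalPoint.hasDerivWithinAt_momentum (hL : SymmetryAssumption L K Q d)
    (hLc : GrowthAssumption (convexLagrangian L K Q)) (hz : IsCriticalPoint L p q z)
    {e : OpenPartialHomeomorph M 𝔼} (he : e ∈ smoothCharts m M) {s₀ : ℝ}
    (hs₀ : s₀ ∈ Icc (0 : ℝ) 1) (hzs : z s₀ ∈ e.source) :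
    HasDerivWithinAt
      (fun s => fderiv ℝ (coordLagrangian e L (e (z s))) (coordVec e (z s) (velocity m z s)))
      (fderiv ℝ (fun x => coordLagrangian e L x (coordVec e (z s₀) (velocity m z s₀))) (e (z s₀)))
      (Icc 0 1) s₀ := by
  have hzC := hz.contMDiffOn hL hLc
  obtain ⟨r, hr, C, hball⟩ := exists_isComparisonBall he (e.map_source hzs)
  obtain ⟨a, b, harc, hnhds⟩ := exists_isChartedArc hz.1.continuousOn hs₀ hzs hr hball
  have hab := harc.lt
  set W : ℝ → 𝔼 := fun s => coordVec e (z s) (velocity m z s) with hWdef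
  have hW : ContinuousOn W (Icc a b) := (continuousOn_coordVec_velocity he hzC).mono
    fun s hs => ⟨harc.subset hs, harc.mem_source s hs⟩
  have hy := harc.continuousOn hz.1
  have hyt : ∀ s ∈ Icc a b, (e ∘ z) s ∈ e.target := fun s hs => e.map_source (harc.mem_source s hs)
  have hF := contDiffOn_coordLagrangian he hL.contMDiff_L
  have hderiv : ∀ s ∈ Ioo a b, deriv (e ∘ z) s = W s := fun s hs => by
    have hsI := Ioo_subset_Icc_self hs
    exact ((hasDerivWithinAt_chart_comp_of_contMDiffOn he hzC (harc.subset hsI)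
      (harc.mem_source s hsI)).hasDerivAt
      (mem_of_superset (Icc_mem_nhds hs.1 hs.2) harc.subset)).deriv
  -- The velocity is now known to be continuous, so a constant dominates, and the chart need not
  -- belong to the atlas in which the growth bounds hold.
  obtain ⟨ρ, hρ, B, hB⟩ := exists_bound_near_curve e.open_target
    (continuousOn_fderiv_uncurry e.open_target hF) hy hyt hW
  obtain ⟨-, c, hc⟩ := hz.exists_momentum_eq hL hLc harc (g := fun _ => B)
    intervalIntegrable_const hρ (Eventually.of_forall fun s hs x hx => by
      rw [hderiv s hs]; exact hB s (Ioo_subset_Icc_self hs) x hx)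
  set Φ : ℝ → 𝔼 →L[ℝ] ℝ := fun s => fderiv ℝ (fun x => coordLagrangian e L x (W s)) ((e ∘ z) s)
    with hΦdef
  have hΦ : ContinuousOn Φ (Icc a b) := (continuousOn_fderiv_left e.open_target hF).comp
    (hy.prodMk hW) fun s hs => ⟨hyt s hs, mem_univ _⟩
  have hP : ContinuousOn (fun s => fderiv ℝ (coordLagrangian e L ((e ∘ z) s)) (W s)) (Icc a b) :=
    (continuousOn_fderiv_right e.open_target hF).comp (hy.prodMk hW)
      fun s hs => ⟨hyt s hs, mem_univ _⟩
  have hI : ∀ s ∈ Icc a b, HasDerivWithinAt (fun u => c + ∫ t in a..u, Φ t) (Φ s) (Icc a b) s :=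
    fun s hs => (hasDerivWithinAt_integral_of_continuousOn hab.le hΦ hs).const_add c
  -- Both sides are continuous, so equality almost everywhere is equality at every time of the arc.
  have heq : EqOn (fun s => fderiv ℝ (coordLagrangian e L ((e ∘ z) s)) (W s))
      (fun u => c + ∫ t in a..u, Φ t) (Icc a b) := by
    refine Measure.eqOn_Icc_of_ae_eq volume hab.ne ?_ hP
      fun s hs => (hI s hs).continuousWithinAt
    rw [← restrict_Ioo_eq_restrict_Icc]
    refine (ae_restrict_iff' measurableSet_Ioo).2 ?_
    filter_upwards [hc] with s hs hsab
    have h1 := hs hsab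
    rw [hderiv s hsab] at h1
    refine h1.trans (congrArg (c + ·) ?_)
    refine intervalIntegral.integral_congr_ae ?_
    filter_upwards with t ht
    rw [uIoc_of_le hsab.1.le] at ht
    rw [hderiv t ⟨ht.1, ht.2.trans_lt hsab.2⟩]
    rfl
  have hs₀I := mem_of_mem_nhdsWithin hs₀ hnhds
  exact ((hI s₀ hs₀I).congr heq (heq hs₀I)).mono_of_mem_nhdsWithin hnhds

theorem IsCriticalPoint.hasDerivWithinAt_partialV (hL : SymmetryAssumption L K Q d)
    (hLc : GrowthAssumption (convexLagrangian L K Q)) (hz : IsCriticalPoint L p q z)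
    {e : OpenPartialHomeomorph M 𝔼} (he : e ∈ smoothCharts m M) (i : Fin (m + 1)) {s : ℝ}
    (hs : s ∈ Icc (0 : ℝ) 1) (hzs : z s ∈ e.source) :
    HasDerivWithinAt (fun r => partialV e L i (z r) (velocity m z r))
      (partialX e L i (z s) (velocity m z s)) (Icc 0 1) s := by
  have h := (hz.hasDerivWithinAt_momentum hL hLc he hs hzs).clm_apply
    (hasDerivWithinAt_const s (Icc (0 : ℝ) 1) (EuclideanSpace.single i (1 : ℝ)))
  rw [map_zero, add_zero] at h
  exact h

theorem IsCriticalPoint.contDiffOn_partialV (hL : SymmetryAssumption L K Q d)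
    (hLc : GrowthAssumption (convexLagrangian L K Q)) (hz : IsCriticalPoint L p q z)
    {e : OpenPartialHomeomorph M 𝔼} (he : e ∈ smoothCharts m M) (i : Fin (m + 1)) :
    ContDiffOn ℝ 1 (fun s => partialV e L i (z s) (velocity m z s))
      (Icc 0 1 ∩ z ⁻¹' e.source) := by
  refine contDiffOn_one_of_hasDerivWithinAt
    (f' := fun s => partialX e L i (z s) (velocity m z s))
    (uniqueDiffOn_Icc_inter_preimage hz.1.continuousOn)
    (fun s hs => (hz.hasDerivWithinAt_partialV hL hLc he i hs.1 hs.2).mono inter_subset_left) ?_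
  have hy : ContinuousOn (e ∘ z) (Icc 0 1 ∩ z ⁻¹' e.source) :=
    e.continuousOn.comp (hz.1.continuousOn.mono inter_subset_left) fun s hs => hs.2
  have h := (continuousOn_fderiv_left e.open_target
    (contDiffOn_coordLagrangian he hL.contMDiff_L)).comp
    (hy.prodMk (continuousOn_coordVec_velocity he (hz.contMDiffOn hL hLc)))
    fun s hs => ⟨e.map_source hs.2, mem_univ _⟩
  exact h.clm_apply continuousOn_const

/-- Conservation of energy. -/
theorem IsCriticalPoint.exists_energy_eq (hL : SymmetryAssumption L K Q d)
    (hLc : GrowthAssumption (convexLagrangian L K Q)) (hz : IsCriticalPoint L p q z) :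
    ∃ E : ℝ, ∀ s ∈ Icc (0 : ℝ) 1,
      vertDeriv L (z s) (velocity m z s) (velocity m z s) - L ⟨z s, velocity m z s⟩ = E := by
  have hzC := hz.contMDiffOn hL hLc
  set f : ℝ → ℝ := fun s =>
    vertDeriv L (z s) (velocity m z s) (velocity m z s) - L ⟨z s, velocity m z s⟩ with hf
  have hder : ∀ s ∈ Icc (0 : ℝ) 1, HasDerivWithinAt f 0 (Icc 0 1) s := by
    intro s₀ hs₀
    have he : chartAt 𝔼 (z s₀) ∈ smoothCharts m M := IsManifold.chart_mem_maximalAtlas (z s₀)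
    set e := chartAt 𝔼 (z s₀) with hedef
    have hzs : z s₀ ∈ e.source := mem_chart_source 𝔼 (z s₀)
    obtain ⟨r, hr, hrt, lam, hsym⟩ := exists_isCoordSymLagrangian hL hLc he (e.map_source hzs)
    have hO : e.source ∩ e ⁻¹' Metric.ball (e (z s₀)) r ∈ 𝓝 (z s₀) :=
      inter_mem (e.open_source.mem_nhds hzs)
        ((e.continuousAt hzs).preimage_mem_nhds (Metric.ball_mem_nhds _ hr))
    obtain ⟨a, b, hab, hsub, hnhds, hmem⟩ := exists_Icc_subset hz.1.continuousOn hs₀ hO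
    have hs₀I := mem_of_mem_nhdsWithin hs₀ hnhds
    have h := hsym.hasDerivWithinAt_energy (y := e ∘ z)
      (V := fun s => coordVec e (z s) (velocity m z s)) hs₀I (fun s hs => (hmem s hs).2)
      ((hasDerivWithinAt_chart_comp_of_contMDiffOn he hzC hs₀ hzs).mono hsub)
      (((continuousOn_coordVec_velocity he hzC) s₀ ⟨hs₀, hzs⟩).mono
        fun s hs => ⟨hsub hs, (hmem s hs).1⟩)
      ((hz.hasDerivWithinAt_momentum hL hLc he hs₀ hzs).mono hsub)
    have heq : ∀ s ∈ Icc a b, f s = fderiv ℝ (coordLagrangian e L ((e ∘ z) s))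
        (coordVec e (z s) (velocity m z s)) (coordVec e (z s) (velocity m z s)) -
        coordLagrangian e L ((e ∘ z) s) (coordVec e (z s) (velocity m z s)) := fun s hs => by
      simp only [hf]
      rw [fderiv_coordLagrangian he (hmem s hs).1, Function.comp_apply,
        coordLagrangian_coordVec he (hmem s hs).1]
    exact (h.congr heq (heq s₀ hs₀I)).mono_of_mem_nhdsWithin hnhds
  refine ⟨f 0, constant_of_derivWithin_zero (fun s hs => (hder s hs).differentiableWithinAt)
    fun s hs => ?_⟩
  have hsI := Ico_subset_Icc_self hs
  exact (hder s hsI).derivWithin (uniqueDiffOn_Icc zero_lt_one s hsI)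

end EulerLagrange

end SymLagrangian
-- The main theorem.
theorem mainTheorem11 {m : ℕ} (hm : 1 ≤ m) {M : Type*} [MetricSpace M]
    [ChartedSpace (EuclideanSpace ℝ (Fin (m + 1))) M] [IsManifold (𝓡 (m + 1)) ∞ M]
    [ConnectedSpace M]
    [RiemannianBundle (fun x : M => TangentSpace (𝓡 (m + 1)) x)]
    [IsContMDiffRiemannianBundle (𝓡 (m + 1)) ∞ (EuclideanSpace ℝ (Fin (m + 1)))
      (fun x : M => TangentSpace (𝓡 (m + 1)) x)]
    [IsRiemannianManifold (𝓡 (m + 1)) M] [CompleteSpace M]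
    (L : TangentBundle (𝓡 (m + 1)) M → ℝ)
    (K : ∀ x : M, TangentSpace (𝓡 (m + 1)) x)
    (Q : ∀ x : M, TangentSpace (𝓡 (m + 1)) x →L[ℝ] ℝ) (d : M → ℝ)
    (hL : SymLagrangian.SymmetryAssumption L K Q d)
    (hLc : SymLagrangian.GrowthAssumption (SymLagrangian.convexLagrangian L K Q))
    (p q : M) (z : ℝ → M) (hz : SymLagrangian.IsCriticalPoint L p q z) :
    -- `z` is of class `C^1` on `[0, 1]`
    ContMDiffOn 𝓘(ℝ, ℝ) (𝓡 (m + 1)) 1 z (Icc 0 1) ∧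
    -- in every chart, `∂_v L(z, ż)` is of class `C^1` and the Euler-Lagrange equations hold
    (∀ e ∈ SymLagrangian.smoothCharts m M, ∀ i : Fin (m + 1),
      ContDiffOn ℝ 1 (fun s => SymLagrangian.partialV e L i (z s) (SymLagrangian.velocity m z s))
        (Icc 0 1 ∩ z ⁻¹' e.source) ∧
      ∀ s ∈ Icc (0 : ℝ) 1, z s ∈ e.source →
        HasDerivWithinAt
          (fun r => SymLagrangian.partialV e L i (z r) (SymLagrangian.velocity m z r))
          (SymLagrangian.partialX e L i (z s) (SymLagrangian.velocity m z s)) (Icc 0 1) s) ∧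
    -- conservation of energy
    ∃ E : ℝ, ∀ s ∈ Icc (0 : ℝ) 1,
      SymLagrangian.vertDeriv L (z s) (SymLagrangian.velocity m z s)
          (SymLagrangian.velocity m z s) -
        L ⟨z s, SymLagrangian.velocity m z s⟩ = E := by
  -- The local comparison of norms uses the metric only through its continuity.
  have : IsContinuousRiemannianBundle (EuclideanSpace ℝ (Fin (m + 1)))
      (fun x : M => TangentSpace (𝓡 (m + 1)) x) := by
    obtain ⟨g, hg, hgv⟩ := IsContMDiffRiemannianBundle.exists_contMDiff (IB := 𝓡 (m + 1)) (n := ∞)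
      (F := EuclideanSpace ℝ (Fin (m + 1))) (E := fun x : M => TangentSpace (𝓡 (m + 1)) x)
    exact ⟨g, hg.continuous, hgv⟩
  exact ⟨hz.contMDiffOn hL hLc, fun e he i => ⟨hz.contDiffOn_partialV hL hLc he i,
    fun s hs hzs => hz.hasDerivWithinAt_partialV hL hLc he i hs hzs⟩, hz.exists_energy_eq hL hLc⟩
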